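/- **Setting.** Fix a generalized linear model: with respect to a fixed measure the response has density $c(y,\phi)\exp\{(y\theta-b(\theta))/\phi\}$, with $\phi>0$ fixed and $\theta$ in an open interval, and the linear predictor $x$ determines $\theta=u(x)$ through $b'(u(x))=h(x)$, where $h:\mathbb R\to\mathbb R$ is strictly monotone. Put $v(x)=\phi\, b''(u(x))>0$ and $w(x)=h'(x)^2/v(x)$. For each $n$ let $\mathrm y_1,\dots,\mathrm y_n$ be independent responses following the model with linear predictors $\mathbf z_i^{\mathsf T}\boldsymbol\beta_{0n}$, where $\mathbf z_i=\mathbf z_{n,i}\in\mathbb R^{p_n}$ are known covariates and $\boldsymbol\beta_{0n}$ is interior to a compact set $\mathcal B_n\subset\mathbb R^{p_n}$. The data are distributed over $K=K_n$ clients; client $k$ holds the observations $i\in I_k$, $n_k=|I_k|$. Let $F_{n_k}(\boldsymbol\beta)=\sum_{i\in I_k}w(\mathbf z_i^{\mathsf T}\boldsymbol\beta)\mathbf z_i\mathbf z_i^{\mathsf T}$ and $F_n(\boldsymbol\beta)=\sum_{k=1}^K F_{n_k}(\boldsymbol\beta)$ be the local and global Fisher information matrices. A local MLE $\hat{\boldsymbol\beta}_{n_k}$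 is a measurable maximizer over $\mathcal B_n$ of the log-likelihood of client $k$, and the aggregated estimating equation (AEE) estimator is $$\bar{\boldsymbol\beta}_n^F=\sum_{k=1}^K\Big[\sum_{j=1}^K F_{n_j}(\hat{\boldsymbol\beta}_{n_j})\Big]^{-1}F_{n_k}(\hat{\boldsymbol\beta}_{n_k})\hat{\boldsymbol\beta}_{n_k}.$$ **Assumptions.** There are positive constants $c,C,r,R$, independent of $n,i,k$, such that for all large $n$: 1. $\mathrm E(\mathrm y_i-h(\mathbf z_i^{\mathsf T}\boldsymbol\beta_{0n}))^2\le C$ for all $i$. 2. $\{\boldsymbol\beta:\|\boldsymbol\beta-\boldsymbol\beta_{0n}\|\le r/\sqrt{p_n}\}\subseteq\mathcal B_n\subseteq\{\boldsymbol\beta:\|\boldsymbol\beta-\boldsymbol\beta_{0n}\|\le R\sqrt{p_n}\}$. 3. $u$ is three times and $w$ once continuously differentiable; $|h|,|h'|,|u'|,|u''|,|u'''|,|w|,|w'|$ are at most $C$ at $\mathbf z_i^{\mathsf T}\boldsymbol\beta$ for all $i$ and all $\boldsymbol\beta$ in the convex hull of $\mathcal B_n$; and $w(\mathbf z_i^{\mathsf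 T}\boldsymbol\beta_{0n})\ge c$ for all $i$. 4. For all $k$, the eigenvalues of $n_k^{-1}\sum_{i\in I_k}\mathbf z_i\mathbf z_i^{\mathsf T}$ lie in $[c,C]$; $\|\mathbf z_i\|^2\le Cp_n$ for all $i$; and $\sum_{i\in I_k}|\boldsymbol\alpha_1^{\mathsf T}\mathbf z_i|^2|\boldsymbol\alpha_2^{\mathsf T}\mathbf z_i|^2\le Cn_k$ for all unit vectors $\boldsymbol\alpha_1,\boldsymbol\alpha_2$. 5. $n_k\le Cn_l$ for all clients $k,l$. **Theorem.** (i) If $p_n=o(n)$ and $K=o(n/p_n^2)$, then local MLEs exist, and for every choice of local MLEs the AEE estimator is well defined and satisfies its estimating equation with probability tending to one: $$P\Big(\sum_{k}F_{n_k}(\hat{\boldsymbol\beta}_{n_k})\text{ is positive definite and }\Big[\sum_{k}F_{n_k}(\hat{\boldsymbol\beta}_{n_k})\Big]\bar{\boldsymbol\beta}_n^F=\sum_{k}F_{n_k}(\hat{\boldsymbol\beta}_{n_k})\hat{\boldsymbol\beta}_{n_k}\Big)\to1 .$$ (ii) If $p_n=o(\sqrt n)$ and $K=o(\sqrt n/p_n)$,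 then for every choice of local MLEs and all unit vectors $\boldsymbol\alpha=\boldsymbol\alpha_n\in\mathbb R^{p_n}$, $$\boldsymbol\alpha^{\mathsf T}F_n^{1/2}(\boldsymbol\beta_{0n})(\bar{\boldsymbol\beta}_n^F-\boldsymbol\beta_{0n})\to_d N(0,1).$$ -/

import Mathlib

open MeasureTheory ProbabilityTheory Filter Topology Asymptotics
open scoped Matrix MatrixOrder

noncomputable section

/-- A generalized linear model for a scalar response with a fixed dispersion parameter `disp`:
with respect to the measure `base` (Lebesgue, counting, ...), the response has the density
`c(y, disp) * exp ((y * θ - b θ) / disp)`, where the canonical parameter `θ` ranges over the open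
interval `dom`. The mean is `b' θ`, the inverse link is `h`, and `u` expresses the canonical
parameter through the linear predictor, `u = (b')⁻¹ ∘ h`. -/
structure GLM where
  base : Measure ℝ
  disp : ℝ
  c : ℝ → ℝ → ℝ
  b : ℝ → ℝ
  dom : Set ℝ
  h : ℝ → ℝ
  u : ℝ → ℝ
  disp_pos : 0 < disp
  c_nonneg : ∀ y, 0 ≤ c y disp
  c_measurable : Measurable fun y => c y disp
  dom_open : IsOpen dom
  dom_convex : Convex ℝ dom
  /-- the densities have total mass one -/
  normalized : ∀ θ ∈ dom,
    ∫⁻ y, ENNReal.ofReal (c y disp * Real.exp ((y * θ - b θ) / disp)) ∂base = 1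
  /-- the link function is strictly monotone -/
  h_strict : StrictMono h ∨ StrictAnti h
  u_mem : ∀ x, u x ∈ dom
  mean_u : ∀ x, deriv b (u x) = h x
  /-- the variance function is positive -/
  variance_pos : ∀ x, 0 < disp * deriv (deriv b) (u x)

namespace GLM

/-- The law of the response when the canonical parameter is `θ`. -/
def law (G : GLM) (θ : ℝ) : Measure ℝ :=
  G.base.withDensity fun y =>
    ENNReal.ofReal (G.c y G.disp * Real.exp ((y * θ - G.b θ) / G.disp))

/-- The variance of the response as a function of the linear predictor. -/
def v (G : GLM) (x : ℝ) : ℝ := G.disp * deriv (deriv G.b) (G.u x)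

/-- The weight function of the Fisher information. -/
def w (G : GLM) (x : ℝ) : ℝ := (deriv G.h x) ^ 2 * (G.v x)⁻¹

/-- The log-likelihood of one observation `y` with linear predictor `x`. -/
def logDensity (G : GLM) (y x : ℝ) : ℝ :=
  (y * G.u x - G.b (G.u x)) / G.disp + Real.log (G.c y G.disp)

end GLM

/-- Data from a generalized linear model distributed over clients, for every sample size `n`:
dimension `p n`, number of clients `K n`, the client `client n i` that holds observation `i`,
the known covariates `z n i`, the responses `y n i`, the true parameter `β₀ n` and the compact
parameter set `B n`. The responses are independent and follow the model at `β₀ n`. -/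
structure DistModel (G : GLM) {Ω : ℕ → Type*} [∀ n, MeasurableSpace (Ω n)]
    (P : ∀ n, Measure (Ω n)) where
  p : ℕ → ℕ
  K : ℕ → ℕ
  client : ∀ n, Fin n → Fin (K n)
  z : ∀ n, Fin n → EuclideanSpace ℝ (Fin (p n))
  y : ∀ n, Fin n → Ω n → ℝ
  β₀ : ∀ n, EuclideanSpace ℝ (Fin (p n))
  B : ∀ n, Set (EuclideanSpace ℝ (Fin (p n)))
  y_measurable : ∀ n i, Measurable (y n i)
  y_indep : ∀ n, iIndepFun (y n) (P n)
  y_law : ∀ n i, (P n).map (y n i) = G.law (G.u (inner ℝ (z n i) (β₀ n)))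
  B_compact : ∀ n, IsCompact (B n)
  β₀_interior : ∀ n, β₀ n ∈ interior (B n)

namespace DistModel

variable {G : GLM} {Ω : ℕ → Type*} [∀ n, MeasurableSpace (Ω n)] {P : ∀ n, Measure (Ω n)}

/-- The observations held by client `k`. -/
def obs (M : DistModel G P) (n : ℕ) (k : Fin (M.K n)) : Finset (Fin n) :=
  {i | M.client n i = k}

/-- The number `n_k` of observations held by client `k`. -/
def size (M : DistModel G P) (n : ℕ) (k : Fin (M.K n)) : ℕ := (M.obs n k).card

/-- The local log-likelihood of client `k`. -/
def localLogLik (M : DistModel G P) (n : ℕ) (k : Fin (M.K n)) (ω : Ω n)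
    (β : EuclideanSpace ℝ (Fin (M.p n))) : ℝ :=
  ∑ i ∈ M.obs n k, G.logDensity (M.y n i ω) (inner ℝ (M.z n i) β)

/-- The Fisher information matrix of client `k`. -/
def localFisher (M : DistModel G P) (n : ℕ) (k : Fin (M.K n))
    (β : EuclideanSpace ℝ (Fin (M.p n))) : Matrix (Fin (M.p n)) (Fin (M.p n)) ℝ :=
  ∑ i ∈ M.obs n k, G.w (inner ℝ (M.z n i) β) •
    Matrix.vecMulVec (M.z n i).ofLp (M.z n i).ofLp

/-- The Fisher information matrix of the full data. -/
def fisher (M : DistModel G P) (n : ℕ) (β : EuclideanSpace ℝ (Fin (M.p n))) :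
    Matrix (Fin (M.p n)) (Fin (M.p n)) ℝ :=
  ∑ i, G.w (inner ℝ (M.z n i) β) • Matrix.vecMulVec (M.z n i).ofLp (M.z n i).ofLp

/-- `βhat n k` is a local maximum likelihood estimator of client `k`: a measurable maximizer of
the local log-likelihood over the parameter set. -/
def IsLocalMLE (M : DistModel G P)
    (βhat : ∀ n, Fin (M.K n) → Ω n → EuclideanSpace ℝ (Fin (M.p n))) : Prop :=
  ∀ n k, Measurable (βhat n k) ∧
    ∀ ω, βhat n k ω ∈ M.B n ∧ IsMaxOn (M.localLogLik n k ω) (M.B n) (βhat n k ω)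

/-- The sum over the clients of the Fisher information matrices at the local estimates. -/
def fisherSum (M : DistModel G P)
    (βhat : ∀ n, Fin (M.K n) → Ω n → EuclideanSpace ℝ (Fin (M.p n))) (n : ℕ) (ω : Ω n) :
    Matrix (Fin (M.p n)) (Fin (M.p n)) ℝ :=
  ∑ k, M.localFisher n k (βhat n k ω)

/-- The aggregated estimating equation estimator
`∑ k, (∑ j, F_j (βhat_j))⁻¹ F_k (βhat_k) βhat_k`. -/
def aee (M : DistModel G P)
    (βhat : ∀ n, Fin (M.K n) → Ω n → EuclideanSpace ℝ (Fin (M.p n))) (n : ℕ) (ω : Ω n) :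
    EuclideanSpace ℝ (Fin (M.p n)) :=
  ∑ k, Matrix.toEuclideanLin
    ((M.fisherSum βhat n ω)⁻¹ * M.localFisher n k (βhat n k ω)) (βhat n k ω)

/-- The regularity conditions. All constants are independent of `n`, of the observation and of the
client. -/
structure Regular (M : DistModel G P) : Prop where
  /-- the errors have bounded second moments -/
  error_bdd : ∃ C : ℝ, ∀ᶠ n in atTop, ∀ i,
    ∫ ω, (M.y n i ω - G.h (inner ℝ (M.z n i) (M.β₀ n))) ^ 2 ∂(P n) ≤ C
  /-- the parameter sets are compact, with the true value in the interior, uniformly in `n` -/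
  param : ∃ r R : ℝ, 0 < r ∧ ∀ᶠ n in atTop,
    Metric.closedBall (M.β₀ n) (r / √(M.p n)) ⊆ M.B n ∧
    M.B n ⊆ Metric.closedBall (M.β₀ n) (R * √(M.p n))
  u_smooth : ContDiff ℝ 3 G.u
  w_smooth : ContDiff ℝ 1 G.w
  /-- uniform boundedness along the linear predictors of the parameters considered -/
  bdd : ∃ C : ℝ, ∀ᶠ n in atTop, ∀ i, ∀ β ∈ convexHull ℝ (M.B n),
    |G.h (inner ℝ (M.z n i) β)| ≤ C ∧
    |deriv G.h (inner ℝ (M.z n i) β)| ≤ C ∧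
    |deriv G.u (inner ℝ (M.z n i) β)| ≤ C ∧
    |iteratedDeriv 2 G.u (inner ℝ (M.z n i) β)| ≤ C ∧
    |iteratedDeriv 3 G.u (inner ℝ (M.z n i) β)| ≤ C ∧
    |G.w (inner ℝ (M.z n i) β)| ≤ C ∧
    |deriv G.w (inner ℝ (M.z n i) β)| ≤ C
  /-- the weights at the true value are bounded away from zero -/
  w_min : ∃ c : ℝ, 0 < c ∧ ∀ᶠ n in atTop, ∀ i, c ≤ G.w (inner ℝ (M.z n i) (M.β₀ n))
  /-- the extreme eigenvalues `min, max {aᵀ A a : ‖a‖ = 1}` of the local Gram matrices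
  `A = n_k⁻¹ ∑ z_i z_iᵀ` are bounded away from zero and from infinity -/
  gram : ∃ c C : ℝ, 0 < c ∧ ∀ᶠ n in atTop, ∀ k, ∀ a : EuclideanSpace ℝ (Fin (M.p n)), ‖a‖ = 1 →
    c ≤ (M.size n k : ℝ)⁻¹ * ∑ i ∈ M.obs n k, (inner ℝ a (M.z n i)) ^ 2 ∧
    (M.size n k : ℝ)⁻¹ * ∑ i ∈ M.obs n k, (inner ℝ a (M.z n i)) ^ 2 ≤ C
  cov_norm : ∃ C : ℝ, ∀ᶠ n in atTop, ∀ i, ‖M.z n i‖ ^ 2 ≤ C * M.p n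
  cov_fourth : ∃ C : ℝ, ∀ᶠ n in atTop, ∀ k, ∀ a₁ a₂ : EuclideanSpace ℝ (Fin (M.p n)),
    ‖a₁‖ = 1 → ‖a₂‖ = 1 →
    ∑ i ∈ M.obs n k, (inner ℝ a₁ (M.z n i)) ^ 2 * (inner ℝ a₂ (M.z n i)) ^ 2 ≤ C * M.size n k
  /-- the local sample sizes are of the same order -/
  balanced : ∃ C : ℝ, ∀ᶠ n in atTop, ∀ k l, (M.size n k : ℝ) ≤ C * M.size n l

end DistModel

end

/-! Write `e_i` for the deviation of a response from its mean, `p` and `K` for the dimension and the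
number of clients, `N` for the size of one client.

The core is a statement about one client, `exists_bad_event`: outside an event of probability
`O(p²/N)` every maximizer `β` of the local likelihood satisfies `‖β - β₀‖ ≤ D ‖score‖ / N` and `√p
‖β - β₀‖ ≤ τ`. The log-likelihood need not be concave, so this takes two stages. Since `β` is at
least as likely as `β₀`, the sum of divergences between the laws at `β₀` and `β` is at most `∑ e_i
(u(x_i) - u(x_i⁰))`, with `x_i`, `x_i⁰` the linear predictors at `β` and `β₀`. The divergences grow
like `N ‖β - β₀‖²` near the truth and stay of order `N` elsewhere (`le_sum_divergence`). The
supremum of the right side over the parameter set has second moment `O(p² N)`, by symmetrization and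
the contraction principle (`integral_sq_supForm_le`), so `β` lies in a fixed ball. There a
second-order expansion of `u` leaves only the score as leading term (`norm_le_of_local`); the random
matrices that occur are bounded in Frobenius norm, so that second moments of the errors suffice.

For (i), one client near the truth is enough: its information matrix is positive definite and the
others are positive semidefinite. Balance of the clients turns `p²/N` into `K p²/n`.

For (ii), all clients are needed at once, and the union bound costs `K · K p²/n = (K p/√n)²`. On the
good event the local score equations hold. They are linearized around `β₀` and summed in the
direction `a = F^(-1/2) α`, whose norm is `O(n^(-1/2))`. This gives a weighted sum of the errors
with variance `aᵀ F a = 1`, and a remainder whose dominating random variable has mean `O(K p/√n)`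
(`integral_remainder_le`, `abs_inner_fisher_sub_le`).

The weighted sum is asymptotically normal by Lindeberg's theorem: the squared weights are at most
`O(p/n)`, and the squared errors are uniformly integrable although only their second moments are
bounded. The latter uses the exponential family: for means bounded by `C`, the densities are
monotone in `θ` on `[C, ∞)` and on `(-∞, -C]`, so each tail is dominated by that of a single
integrable function (`exists_uniform_tail`). -/

namespace GLM

/-! ### Moments of the exponential family from its cumulant generating function. -/

variable (G : GLM)

/-- The measure that dominates all response laws, with the factor `c` absorbed. -/
noncomputable def refMeasure : Measure ℝ := G.base.withDensity fun y => ENNReal.ofReal (G.c y G.disp)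

lemma law_eq_withDensity (θ : ℝ) : G.law θ =
    G.refMeasure.withDensity fun y => ENNReal.ofReal (Real.exp ((y * θ - G.b θ) / G.disp)) := by
  unfold law refMeasure
  rw [← withDensity_mul _ (G.c_measurable.ennreal_ofReal) (by fun_prop)]
  congr 1
  ext y
  simp [ENNReal.ofReal_mul (G.c_nonneg y)]

lemma isProbabilityMeasure_law {θ : ℝ} (hθ : θ ∈ G.dom) : IsProbabilityMeasure (G.law θ) := by
  constructor
  rw [law, withDensity_apply _ MeasurableSet.univ, setLIntegral_univ]
  exact G.normalized θ hθ

lemma lintegral_exp_refMeasure {θ : ℝ} (hθ : θ ∈ G.dom) :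
    ∫⁻ y, ENNReal.ofReal (Real.exp (θ * (y / G.disp))) ∂G.refMeasure
      = ENNReal.ofReal (Real.exp (G.b θ / G.disp)) := by
  have h1 : ∫⁻ y, ENNReal.ofReal (Real.exp ((y * θ - G.b θ) / G.disp)) ∂G.refMeasure = 1 := by
    have := (G.isProbabilityMeasure_law hθ).measure_univ
    rwa [law_eq_withDensity, withDensity_apply _ MeasurableSet.univ, setLIntegral_univ] at this
  have h2 : ∀ y : ℝ, ENNReal.ofReal (Real.exp (θ * (y / G.disp)))
      = ENNReal.ofReal (Real.exp (G.b θ / G.disp)) *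
        ENNReal.ofReal (Real.exp ((y * θ - G.b θ) / G.disp)) := by
    intro y
    rw [← ENNReal.ofReal_mul (Real.exp_pos _).le, ← Real.exp_add]
    congr 2
    ring
  simp_rw [h2]
  rw [lintegral_const_mul _ (by fun_prop), h1, mul_one]

lemma integrable_exp_refMeasure {θ : ℝ} (hθ : θ ∈ G.dom) :
    Integrable (fun y => Real.exp (θ * (y / G.disp))) G.refMeasure := by
  refine ⟨by fun_prop, ?_⟩
  rw [hasFiniteIntegral_iff_ofReal (ae_of_all _ fun y => (Real.exp_pos _).le),
    G.lintegral_exp_refMeasure hθ]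
  exact ENNReal.ofReal_lt_top

lemma mgf_refMeasure {θ : ℝ} (hθ : θ ∈ G.dom) :
    mgf (fun y => y / G.disp) G.refMeasure θ = Real.exp (G.b θ / G.disp) := by
  rw [mgf, integral_eq_lintegral_of_nonneg_ae (ae_of_all _ fun y => (Real.exp_pos _).le)
    (by fun_prop), G.lintegral_exp_refMeasure hθ, ENNReal.toReal_ofReal (Real.exp_pos _).le]

lemma mem_interior_integrableExpSet {θ : ℝ} (hθ : θ ∈ G.dom) :
    θ ∈ interior (integrableExpSet (fun y => y / G.disp) G.refMeasure) :=
  interior_maximal (fun _ ht => G.integrable_exp_refMeasure ht) G.dom_open hθ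

/-- That the densities have mass one determines `b`: up to the dispersion it is the cumulant
generating function of `y / disp` under the reference measure. No smoothness of `b` is assumed;
analyticity, the mean and the variance all come from this identity. -/
lemma b_eq_cgf {θ : ℝ} (hθ : θ ∈ G.dom) :
    G.b θ = G.disp * cgf (fun y => y / G.disp) G.refMeasure θ := by
  rw [cgf, G.mgf_refMeasure hθ, Real.log_exp, mul_div_cancel₀ _ G.disp_pos.ne']

lemma b_eventuallyEq_cgf {θ : ℝ} (hθ : θ ∈ G.dom) :
    G.b =ᶠ[𝓝 θ] fun s => G.disp * cgf (fun y => y / G.disp) G.refMeasure s := by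
  filter_upwards [G.dom_open.mem_nhds hθ] with s hs using G.b_eq_cgf hs

lemma analyticAt_b {θ : ℝ} (hθ : θ ∈ G.dom) : AnalyticAt ℝ G.b θ :=
  (analyticAt_const.mul (analyticAt_cgf (G.mem_interior_integrableExpSet hθ))).congr
    (G.b_eventuallyEq_cgf hθ).symm

lemma hasDerivAt_b {θ : ℝ} (hθ : θ ∈ G.dom) : HasDerivAt G.b (deriv G.b θ) θ :=
  (G.analyticAt_b hθ).differentiableAt.hasDerivAt

lemma hasDerivAt_deriv_b {θ : ℝ} (hθ : θ ∈ G.dom) :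
    HasDerivAt (deriv G.b) (deriv (deriv G.b) θ) θ :=
  (G.analyticAt_b hθ).deriv.differentiableAt.hasDerivAt

lemma law_eq_tilted {θ : ℝ} (hθ : θ ∈ G.dom) :
    G.law θ = G.refMeasure.tilted (fun y => θ * (y / G.disp)) := by
  rw [law_eq_withDensity, Measure.tilted]
  have h := G.mgf_refMeasure hθ
  rw [mgf] at h
  simp_rw [h, ← Real.exp_sub]
  congr 1
  ext y
  congr 2
  ring

lemma deriv_b {θ : ℝ} (hθ : θ ∈ G.dom) :
    deriv G.b θ = G.disp * deriv (cgf (fun y => y / G.disp) G.refMeasure) θ := by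
  rw [(G.b_eventuallyEq_cgf hθ).deriv_eq, deriv_const_mul]
  exact (analyticAt_cgf (G.mem_interior_integrableExpSet hθ)).differentiableAt

lemma deriv_deriv_b {θ : ℝ} (hθ : θ ∈ G.dom) :
    deriv (deriv G.b) θ =
      G.disp * iteratedDeriv 2 (cgf (fun y => y / G.disp) G.refMeasure) θ := by
  have h : deriv G.b =ᶠ[𝓝 θ]
      fun s => G.disp * deriv (cgf (fun y => y / G.disp) G.refMeasure) s := by
    filter_upwards [G.dom_open.mem_nhds hθ] with s hs using G.deriv_b hs
  rw [h.deriv_eq, deriv_const_mul, iteratedDeriv_succ, iteratedDeriv_one]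
  exact (analyticAt_cgf (G.mem_interior_integrableExpSet hθ)).deriv.differentiableAt

lemma memLp_id_law {θ : ℝ} (hθ : θ ∈ G.dom) : MemLp (id : ℝ → ℝ) 2 (G.law θ) := by
  have h := memLp_tilted_mul (G.mem_interior_integrableExpSet hθ) 2
  rw [← G.law_eq_tilted hθ] at h
  have h2 := h.const_mul G.disp
  refine h2.congr_norm (by fun_prop) (ae_of_all _ fun y => ?_)
  simp only [id]
  rw [mul_div_cancel₀ _ G.disp_pos.ne']

lemma integral_id_law {θ : ℝ} (hθ : θ ∈ G.dom) : ∫ y, y ∂(G.law θ) = deriv G.b θ := by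
  have h := integral_tilted_mul_self (G.mem_interior_integrableExpSet hθ)
  rw [← G.law_eq_tilted hθ, integral_div] at h
  rw [G.deriv_b hθ, ← h, mul_div_cancel₀ _ G.disp_pos.ne']

lemma integral_sq_law {θ : ℝ} (hθ : θ ∈ G.dom) :
    ∫ y, (y - deriv G.b θ) ^ 2 ∂(G.law θ) = G.disp * deriv (deriv G.b) θ := by
  have h := variance_tilted_mul (G.mem_interior_integrableExpSet hθ)
  rw [← G.law_eq_tilted hθ, variance_eq_integral (by fun_prop), integral_div,
    G.integral_id_law hθ] at h
  simp_rw [← sub_div, div_pow, integral_div] at h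
  rw [G.deriv_deriv_b hθ, ← h]
  have := G.disp_pos.ne'
  field_simp

lemma deriv_deriv_b_nonneg {θ : ℝ} (hθ : θ ∈ G.dom) : 0 ≤ deriv (deriv G.b) θ := by
  have h := G.integral_sq_law hθ
  have h2 : 0 ≤ ∫ y, (y - deriv G.b θ) ^ 2 ∂(G.law θ) := integral_nonneg fun y => sq_nonneg _
  rw [h] at h2
  exact nonneg_of_mul_nonneg_right h2 G.disp_pos

/-- The second derivative of `b` is a variance divided by the dispersion, hence nonnegative. -/
lemma monotoneOn_deriv_b : MonotoneOn (deriv G.b) G.dom := by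
  refine monotoneOn_of_deriv_nonneg G.dom_convex
    (fun θ hθ => (G.hasDerivAt_deriv_b hθ).continuousAt.continuousWithinAt)
    (fun θ hθ => ?_) (fun θ hθ => ?_)
  · exact (G.hasDerivAt_deriv_b (interior_subset hθ)).differentiableAt.differentiableWithinAt
  · exact G.deriv_deriv_b_nonneg (interior_subset hθ)

lemma exists_b_sub_eq {θ θ' : ℝ} (hθ : θ ∈ G.dom) (hθ' : θ' ∈ G.dom) (h : θ ≤ θ') :
    ∃ ξ ∈ Set.Icc θ θ', ξ ∈ G.dom ∧ G.b θ' - G.b θ = deriv G.b ξ * (θ' - θ) := by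
  have hsub : Set.Icc θ θ' ⊆ G.dom := G.dom_convex.ordConnected.out hθ hθ'
  rcases h.eq_or_lt with rfl | hlt
  · exact ⟨θ, by simp, hθ, by simp⟩
  obtain ⟨ξ, hξ, he⟩ := exists_deriv_eq_slope G.b hlt
    (fun s hs => (G.hasDerivAt_b (hsub hs)).continuousAt.continuousWithinAt)
    (fun s hs => (G.hasDerivAt_b
      (hsub (Set.Ioo_subset_Icc_self hs))).differentiableAt.differentiableWithinAt)
  refine ⟨ξ, Set.Ioo_subset_Icc_self hξ, hsub (Set.Ioo_subset_Icc_self hξ), ?_⟩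
  rw [he, div_mul_cancel₀]
  exact sub_ne_zero.2 hlt.ne'

end GLM

/-! ### Uniform integrability of the squared responses. -/

lemma exists_seq_monotone_cofinal {S : Set ℝ} (hS : S.Nonempty) :
    ∃ t : ℕ → ℝ, Monotone t ∧ (∀ n, t n ∈ S) ∧ ∀ x ∈ S, ∃ n, x ≤ t n := by
  by_cases hmax : ∃ m ∈ S, ∀ x ∈ S, x ≤ m
  · obtain ⟨m, hm, hle⟩ := hmax
    exact ⟨fun _ => m, monotone_const, fun _ => hm, fun x hx => ⟨0, hle x hx⟩⟩
  push Not at hmax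
  -- Without a maximum, every point of `S` lies strictly below the supremum, taken in `EReal`
  -- because `S` may be unbounded; a sequence increasing to the supremum therefore passes every
  -- point.
  obtain ⟨v, hv, hlim, hmem⟩ := exists_seq_tendsto_sSup (S := ((↑) : ℝ → EReal) '' S)
    (hS.image _) (OrderTop.bddAbove _)
  choose t ht htv using hmem
  refine ⟨t, fun i j hij => ?_, ht, fun x hx => ?_⟩
  · rw [← EReal.coe_le_coe_iff, htv, htv]
    exact hv hij
  · obtain ⟨z, hz, hxz⟩ := hmax x hx
    have hlt : (x : EReal) < sSup (((↑) : ℝ → EReal) '' S) :=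
      (EReal.coe_lt_coe_iff.2 hxz).trans_le (le_sSup ⟨z, hz, rfl⟩)
    obtain ⟨n, hn⟩ := (hlim.eventually_const_lt hlt).exists
    refine ⟨n, ?_⟩
    rw [← htv n, EReal.coe_lt_coe_iff] at hn
    exact hn.le

/-- A family of functions that is monotone in its parameter and bounded in `L¹` has uniformly small
tails. -/
lemma exists_uniform_tail_of_monotone (μ : Measure ℝ) (S : Set ℝ) (f : ℝ → ℝ → ENNReal)
    (hf : ∀ θ, Measurable (f θ)) {A : Set ℝ} (hA : MeasurableSet A)
    (hmono : ∀ θ ∈ S, ∀ θ' ∈ S, θ ≤ θ' → ∀ y ∈ A, f θ y ≤ f θ' y) {D : ENNReal} (hD : D ≠ ⊤)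
    (hbdd : ∀ θ ∈ S, ∫⁻ y in A, f θ y ∂μ ≤ D) {ε : ENNReal} (hε : 0 < ε) :
    ∃ M : ℝ, ∀ M' ≥ M, ∀ θ ∈ S, ∫⁻ y in A ∩ {y | M' < |y|}, f θ y ∂μ ≤ ε := by
  rcases S.eq_empty_or_nonempty with rfl | hS
  · exact ⟨0, by simp⟩
  obtain ⟨t, ht, htS, htc⟩ := exists_seq_monotone_cofinal hS
  set F : ℕ → ℝ → ENNReal := fun n => A.indicator (f (t n)) with hF
  have hFm : ∀ n, Measurable (F n) := fun n => (hf _).indicator hA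
  have hFmono : Monotone F := by
    intro i j hij y
    by_cases hy : y ∈ A
    · simpa [hF, hy] using hmono _ (htS i) _ (htS j) (ht hij) y hy
    · simp [hF, hy]
  -- The supremum along the cofinal sequence dominates the whole family on `A` and, by monotone
  -- convergence, still has integral at most `D`. It is the density of a finite measure, whose tails
  -- vanish.
  set g : ℝ → ENNReal := fun y => ⨆ n, F n y with hg
  have hgm : Measurable g := Measurable.iSup hFm
  have hgint : ∫⁻ y, g y ∂μ ≤ D := by
    rw [hg, lintegral_iSup hFm hFmono]
    refine iSup_le fun n => ?_
    rw [hF, lintegral_indicator hA]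
    exact hbdd _ (htS n)
  set ν := μ.withDensity g with hν
  have hfin : IsFiniteMeasure ν := by
    constructor
    rw [hν, withDensity_apply _ MeasurableSet.univ, setLIntegral_univ]
    exact hgint.trans_lt hD.lt_top
  have hlim : Tendsto (fun M : ℝ => ν {y | M < |y|}) atTop (𝓝 0) := by
    have h0 : (⋂ M : ℝ, {y : ℝ | M < |y|}) = ∅ := by
      ext y
      simp only [Set.mem_iInter, Set.mem_ofPred_eq, Set.mem_empty_iff_false, iff_false, not_forall,
        not_lt]
      exact ⟨|y|, le_rfl⟩
    have := tendsto_measure_iInter_atTop (μ := ν) (s := fun M : ℝ => {y : ℝ | M < |y|})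
      (fun M => (measurableSet_lt measurable_const (by fun_prop)).nullMeasurableSet)
      (fun a b hab y hy => lt_of_le_of_lt hab hy) ⟨0, measure_ne_top _ _⟩
    rwa [h0, measure_empty] at this
  obtain ⟨M, hM⟩ := eventually_atTop.1 (hlim.eventually_le_const hε)
  refine ⟨M, fun M' hM' θ hθ => (le_trans ?_ (hM M' hM'))⟩
  have hms : MeasurableSet {y : ℝ | M' < |y|} := measurableSet_lt measurable_const (by fun_prop)
  rw [hν, withDensity_apply _ hms]
  obtain ⟨n, hn⟩ := htc θ hθ
  rw [← lintegral_indicator (hA.inter hms), ← lintegral_indicator hms]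
  refine lintegral_mono fun y => ?_
  by_cases hy : y ∈ {y : ℝ | M' < |y|}
  · by_cases hyA : y ∈ A
    · rw [Set.indicator_of_mem (Set.mem_inter hyA hy), Set.indicator_of_mem hy]
      refine le_trans ?_ (le_iSup (fun n => F n y) n)
      simpa [hF, hyA] using hmono _ hθ _ (htS n) hn y hyA
    · rw [Set.indicator_of_notMem (fun h => hyA h.1)]
      exact zero_le
  · rw [Set.indicator_of_notMem (fun h => hy h.2)]
    exact zero_le

namespace GLM

variable (G : GLM)

/-- By the mean value theorem the exponent increases by `(y - b'(ξ)) (θ' - θ) / disp`, and `b'(ξ) ≤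
b'(θ') ≤ C ≤ y`. -/
lemma density_mono {C θ θ' y : ℝ} (hθ : θ ∈ G.dom) (hθ' : θ' ∈ G.dom) (h : θ ≤ θ')
    (hC : deriv G.b θ' ≤ C) (hy : C ≤ y) :
    (y * θ - G.b θ) / G.disp ≤ (y * θ' - G.b θ') / G.disp := by
  obtain ⟨ξ, hξ, hξd, he⟩ := G.exists_b_sub_eq hθ hθ' h
  have h1 : deriv G.b ξ ≤ y := ((G.monotoneOn_deriv_b hξd hθ' hξ.2).trans hC).trans hy
  have h2 := mul_le_mul_of_nonneg_right h1 (sub_nonneg.2 h)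
  refine div_le_div_of_nonneg_right ?_ G.disp_pos.le
  linarith

lemma density_anti {C θ θ' y : ℝ} (hθ : θ ∈ G.dom) (hθ' : θ' ∈ G.dom) (h : θ ≤ θ')
    (hC : C ≤ deriv G.b θ) (hy : y ≤ C) :
    (y * θ' - G.b θ') / G.disp ≤ (y * θ - G.b θ) / G.disp := by
  obtain ⟨ξ, hξ, hξd, he⟩ := G.exists_b_sub_eq hθ hθ' h
  have h1 : y ≤ deriv G.b ξ := hy.trans (hC.trans (G.monotoneOn_deriv_b hθ hξd hξ.1))
  have h2 := mul_le_mul_of_nonneg_right h1 (sub_nonneg.2 h)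
  refine div_le_div_of_nonneg_right ?_ G.disp_pos.le
  linarith

lemma setLIntegral_law (θ : ℝ) {g : ℝ → ENNReal} (hg : Measurable g) {A : Set ℝ}
    (hA : MeasurableSet A) : ∫⁻ y in A, g y ∂(G.law θ) = ∫⁻ y in A,
      ENNReal.ofReal (Real.exp ((y * θ - G.b θ) / G.disp)) * g y ∂G.refMeasure := by
  rw [law_eq_withDensity, setLIntegral_withDensity_eq_setLIntegral_mul _ (by fun_prop) hg hA]
  rfl

/-- Responses with bounded means and second moments have uniformly integrable squares. -/
lemma exists_uniform_tail (C : ℝ) {ε : ENNReal} (hε : 0 < ε) :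
    ∃ M : ℝ, ∀ θ ∈ G.dom, |deriv G.b θ| ≤ C →
      ∫⁻ y, ENNReal.ofReal (y ^ 2) ∂(G.law θ) ≤ ENNReal.ofReal C →
      ∫⁻ y in {y | M < |y|}, ENNReal.ofReal (y ^ 2) ∂(G.law θ) ≤ ε := by
  set S : Set ℝ := {θ | θ ∈ G.dom ∧ |deriv G.b θ| ≤ C ∧
    ∫⁻ y, ENNReal.ofReal (y ^ 2) ∂(G.law θ) ≤ ENNReal.ofReal C} with hS
  set f : ℝ → ℝ → ENNReal := fun θ y =>
    ENNReal.ofReal (Real.exp ((y * θ - G.b θ) / G.disp)) * ENNReal.ofReal (y ^ 2) with hf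
  have hfm : ∀ θ, Measurable (f θ) := fun θ => by fun_prop
  have hsq : Measurable fun y : ℝ => ENNReal.ofReal (y ^ 2) := by fun_prop
  have hε2 : 0 < ε / 2 := ENNReal.half_pos hε.ne'
  obtain ⟨M₁, h₁⟩ := exists_uniform_tail_of_monotone G.refMeasure S f hfm
    (measurableSet_Ici (a := C)) (D := ENNReal.ofReal C) (ε := ε / 2)
    (fun θ hθ θ' hθ' h y hy => by
      refine mul_le_mul_left (ENNReal.ofReal_le_ofReal (Real.exp_le_exp.2 ?_)) _
      exact G.density_mono hθ.1 hθ'.1 h (abs_le.1 hθ'.2.1).2 hy)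
    ENNReal.ofReal_ne_top
    (fun θ hθ => by
      rw [← G.setLIntegral_law θ hsq measurableSet_Ici]
      exact (setLIntegral_le_lintegral _ _).trans hθ.2.2) hε2
  -- On the left tail the densities decrease in `θ`; the parameter is reflected to make the family
  -- increasing.
  obtain ⟨M₂, h₂⟩ := exists_uniform_tail_of_monotone G.refMeasure {θ | -θ ∈ S} (fun θ => f (-θ))
    (fun θ => hfm _) (measurableSet_Iic (a := -C)) (D := ENNReal.ofReal C) (ε := ε / 2)
    (fun θ hθ θ' hθ' h y hy => by
      refine mul_le_mul_left (ENNReal.ofReal_le_ofReal (Real.exp_le_exp.2 ?_)) _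
      exact G.density_anti hθ'.1 hθ.1 (neg_le_neg h) (abs_le.1 hθ'.2.1).1 hy)
    ENNReal.ofReal_ne_top
    (fun θ hθ => by
      rw [← G.setLIntegral_law (-θ) hsq measurableSet_Iic]
      exact (setLIntegral_le_lintegral _ _).trans hθ.2.2) hε2
  refine ⟨max (max M₁ M₂) C, fun θ hθ hb hsqb => ?_⟩
  have hθS : θ ∈ S := ⟨hθ, hb, hsqb⟩
  set M := max (max M₁ M₂) C
  have hms : MeasurableSet {y : ℝ | M < |y|} := measurableSet_lt measurable_const (by fun_prop)
  have hsub : {y : ℝ | M < |y|} ⊆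
      (Set.Ici C ∩ {y | M < |y|}) ∪ (Set.Iic (-C) ∩ {y | M < |y|}) := by
    intro y hy
    have hCy : C < |y| := lt_of_le_of_lt (le_max_right _ _) hy
    rcases lt_abs.1 hCy with h | h
    · exact Or.inl ⟨h.le, hy⟩
    · exact Or.inr ⟨by simp only [Set.mem_Iic]; linarith, hy⟩
  calc ∫⁻ y in {y | M < |y|}, ENNReal.ofReal (y ^ 2) ∂(G.law θ)
      ≤ ∫⁻ y in Set.Ici C ∩ {y | M < |y|}, ENNReal.ofReal (y ^ 2) ∂(G.law θ)
        + ∫⁻ y in Set.Iic (-C) ∩ {y | M < |y|}, ENNReal.ofReal (y ^ 2) ∂(G.law θ) :=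
        (lintegral_mono_set hsub).trans (lintegral_union_le _ _ _)
    _ ≤ ε / 2 + ε / 2 := by
        refine add_le_add ?_ ?_
        · rw [G.setLIntegral_law θ hsq (measurableSet_Ici.inter hms)]
          exact h₁ M ((le_max_left _ _).trans (le_max_left _ _)) θ hθS
        · rw [G.setLIntegral_law θ hsq (measurableSet_Iic.inter hms)]
          have := h₂ M ((le_max_right _ _).trans (le_max_left _ _)) (-θ) (by simpa using hθS)
          simpa using this
    _ = ε := ENNReal.add_halves ε

end GLM

/-! ### Measurable selection of maximizers. -/

/-- A random nonempty compact set all of whose hitting events of closed sets are measurable. -/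
structure IsRandomCompact {Ω E : Type*} [MeasurableSpace Ω] [TopologicalSpace E]
    (A : Ω → Set E) : Prop where
  isCompact : ∀ ω, IsCompact (A ω)
  nonempty : ∀ ω, (A ω).Nonempty
  measurableSet_hit : ∀ C : Set E, IsClosed C → MeasurableSet {ω | (A ω ∩ C).Nonempty}

namespace IsRandomCompact

variable {Ω E : Type*} [MeasurableSpace Ω] [TopologicalSpace E]

/-- Minimizing a continuous function keeps a random compact set random compact, and makes the value
of the function measurable. This is the induction step of the selection theorem. -/
lemma argmin {A : Ω → Set E} (hA : IsRandomCompact A) {g : E → ℝ} (hg : Continuous g) :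
    IsRandomCompact (fun ω => {β | β ∈ A ω ∧ ∀ β' ∈ A ω, g β ≤ g β'}) ∧
    ∃ m : Ω → ℝ, Measurable m ∧
      ∀ ω, ∀ β ∈ {β | β ∈ A ω ∧ ∀ β' ∈ A ω, g β ≤ g β'}, g β = m ω := by
  have hex : ∀ ω, ∃ β ∈ A ω, ∀ β' ∈ A ω, g β ≤ g β' := fun ω =>
    (hA.isCompact ω).exists_isMinOn (hA.nonempty ω) hg.continuousOn
  choose s hsA hsm using hex
  have hclosed : ∀ q : ℝ, IsClosed {β | g β ≤ q} := fun q => isClosed_le hg continuous_const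
  refine ⟨⟨fun ω => ?_, fun ω => ⟨s ω, hsA ω, hsm ω⟩, fun C hC => ?_⟩,
    fun ω => g (s ω), measurable_of_Iic fun q => ?_, fun ω β hβ =>
      le_antisymm (hβ.2 _ (hsA ω)) (hsm ω _ hβ.1)⟩
  · have : {β | β ∈ A ω ∧ ∀ β' ∈ A ω, g β ≤ g β'} = A ω ∩ {β | g β ≤ g (s ω)} := by
      ext β
      exact ⟨fun h => ⟨h.1, h.2 _ (hsA ω)⟩, fun h => ⟨h.1, fun β' hβ' => h.2.trans (hsm ω _ hβ')⟩⟩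
    rw [this]
    exact (hA.isCompact ω).inter_right (hclosed _)
  · have : {ω | ({β | β ∈ A ω ∧ ∀ β' ∈ A ω, g β ≤ g β'} ∩ C).Nonempty} =
        {ω | (A ω ∩ C).Nonempty} ∩ ⋂ q : ℚ, ({ω | (A ω ∩ {β | g β ≤ q}).Nonempty}ᶜ ∪
          {ω | (A ω ∩ (C ∩ {β | g β ≤ q})).Nonempty}) := by
      ext ω
      simp only [Set.mem_inter_iff, Set.mem_iInter, Set.mem_union, Set.mem_compl_iff]
      constructor
      · rintro ⟨β, ⟨hβA, hβm⟩, hβC⟩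
        refine ⟨⟨β, hβA, hβC⟩, fun q => ?_⟩
        by_cases h : (A ω ∩ {β | g β ≤ q}).Nonempty
        · obtain ⟨β', hβ', hq⟩ := h
          exact Or.inr ⟨β, hβA, hβC, (hβm _ hβ').trans hq⟩
        · exact Or.inl h
      · rintro ⟨hne, hq⟩
        obtain ⟨β, hβ, hβm⟩ := ((hA.isCompact ω).inter_right hC).exists_isMinOn hne hg.continuousOn
        refine ⟨β, ⟨hβ.1, fun β' hβ' => ?_⟩, hβ.2⟩
        by_contra! hlt
        obtain ⟨q, hq1, hq2⟩ := exists_rat_btwn hlt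
        rcases hq q with h | ⟨β'', hA'', hC'', hq''⟩
        · exact h ⟨β', hβ', hq1.le⟩
        · have h1 : g β ≤ g β'' := hβm (Set.mem_inter hA'' hC'')
          have h2 : g β'' ≤ q := hq''
          linarith
    rw [this]
    refine (hA.measurableSet_hit C hC).inter (MeasurableSet.iInter fun q => ?_)
    exact (hA.measurableSet_hit _ (hclosed _)).compl.union
      (hA.measurableSet_hit _ (hC.inter (hclosed _)))
  · have : (fun ω => g (s ω)) ⁻¹' Set.Iic q = {ω | (A ω ∩ {β | g β ≤ q}).Nonempty} := by
      ext ω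
      exact ⟨fun h => ⟨s ω, hsA ω, h⟩, fun ⟨β, hβ, hq⟩ => (hsm ω β hβ).trans hq⟩
    rw [this]
    exact hA.measurableSet_hit _ (hclosed q)

/-- Minimizing the coordinates one after another leaves a set on which every coordinate is a
measurable function of `ω` alone, that is, a single measurable point. -/
lemma exists_measurable_selection {m : ℕ} {A : Ω → Set (EuclideanSpace ℝ (Fin m))}
    (hA : IsRandomCompact A) :
    ∃ s : Ω → EuclideanSpace ℝ (Fin m), Measurable s ∧ ∀ ω, s ω ∈ A ω := by
  have key : ∀ t : Finset (Fin m), ∃ A' : Ω → Set (EuclideanSpace ℝ (Fin m)),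
      IsRandomCompact A' ∧ (∀ ω, A' ω ⊆ A ω) ∧
      ∀ j ∈ t, ∃ g : Ω → ℝ, Measurable g ∧ ∀ ω, ∀ β ∈ A' ω, β j = g ω := by
    intro t
    induction t using Finset.induction_on with
    | empty => exact ⟨A, hA, fun ω => subset_rfl, by simp⟩
    | insert j t hj ih =>
      obtain ⟨A', hA', hsub, hcoord⟩ := ih
      obtain ⟨h1, h2⟩ := hA'.argmin (g := fun β => β j) (by fun_prop)
      refine ⟨_, h1, fun ω β hβ => hsub ω hβ.1, fun i hi => ?_⟩
      rcases Finset.mem_insert.1 hi with rfl | hi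
      · exact h2
      · obtain ⟨g, hg, hgA⟩ := hcoord i hi
        exact ⟨g, hg, fun ω β hβ => hgA ω β hβ.1⟩
  obtain ⟨A', hA', hsub, hcoord⟩ := key Finset.univ
  choose s hs using hA'.nonempty
  refine ⟨s, ?_, fun ω => hsub ω (hs ω)⟩
  have : Measurable fun ω => (s ω).ofLp := by
    refine measurable_pi_iff.2 fun j => ?_
    obtain ⟨g, hg, hgA⟩ := hcoord j (Finset.mem_univ j)
    have : (fun ω => s ω j) = g := funext fun ω => hgA ω _ (hs ω)
    rw [this]
    exact hg
  exact (WithLp.measurable_toLp 2 _).comp this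

end IsRandomCompact

lemma isRandomCompact_argmax {Ω E : Type*} [MeasurableSpace Ω] [PseudoMetricSpace E] [T2Space E]
    {B : Set E} (hB : IsCompact B) (hne : B.Nonempty) {f : Ω → E → ℝ}
    (hf : ∀ β ∈ B, Measurable fun ω => f ω β) (hc : ∀ ω, ContinuousOn (f ω) B) :
    IsRandomCompact (fun ω => {β | β ∈ B ∧ IsMaxOn (f ω) B β}) := by
  have hex : ∀ ω, ∃ β ∈ B, IsMaxOn (f ω) B β := fun ω => hB.exists_isMaxOn hne (hc ω)
  refine ⟨fun ω => ?_, fun ω => hex ω, fun C hC => ?_⟩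
  · obtain ⟨s, hs, hsm⟩ := hex ω
    have : {β | β ∈ B ∧ IsMaxOn (f ω) B β} = B ∩ f ω ⁻¹' Set.Ici (f ω s) := by
      ext β
      exact ⟨fun h => ⟨h.1, h.2 hs⟩, fun h => ⟨h.1, fun β' hβ' => le_trans (b := f ω s) (hsm hβ') h.2⟩⟩
    rw [this]
    obtain ⟨u, hu, he⟩ := continuousOn_iff_isClosed.1 (hc ω) _ isClosed_Ici
    rw [Set.inter_comm, he]
    exact hB.inter_left hu
  · obtain ⟨t, htB, htc, htd⟩ := hB.isSeparable.exists_countable_dense_subset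
    have hBC : IsCompact (B ∩ C) := hB.inter_right hC
    obtain ⟨r, hrB, hrc, hrd⟩ := hBC.isSeparable.exists_countable_dense_subset
    have happrox : ∀ ω, ∀ D ⊆ B, ∀ q ⊆ D, D ⊆ closure q → ∀ β ∈ D, ∀ ε > 0, ∃ β' ∈ q,
        |f ω β' - f ω β| < ε := by
      intro ω D hD q hq hqd β hβ ε hε
      have h1 : ContinuousWithinAt (f ω) q β := (hc ω β (hD hβ)).mono (hq.trans hD)
      have h2 : (𝓝[q] β).NeBot := mem_closure_iff_nhdsWithin_neBot.1 (hqd hβ)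
      obtain ⟨β', hβ', hmem⟩ := ((h1.eventually (Metric.ball_mem_nhds _ hε)).and
        self_mem_nhdsWithin).exists
      exact ⟨β', hmem, by rwa [Real.dist_eq] at hβ'⟩
    -- By compactness and continuity a maximizer lies in `C` exactly when values on `B ∩ C` come
    -- arbitrarily close to, or exceed, each value on `B`; countable dense subsets `r` and `t`
    -- suffice for both.
    have : {ω | ({β | β ∈ B ∧ IsMaxOn (f ω) B β} ∩ C).Nonempty} =
        ⋂ b ∈ t, ⋂ k : ℕ, ⋃ d ∈ r, {ω | f ω b - 1 / ((k : ℝ) + 1) < f ω d} := by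
      ext ω
      simp only [Set.mem_iInter, Set.mem_iUnion]
      constructor
      · rintro ⟨β, ⟨hβB, hβm⟩, hβC⟩ b hb k
        obtain ⟨d, hd, hlt⟩ := happrox ω (B ∩ C) Set.inter_subset_left r hrB hrd β
          ⟨hβB, hβC⟩ (1 / ((k : ℝ) + 1)) (by positivity)
        refine ⟨d, hd, ?_⟩
        have h1 : f ω b ≤ f ω β := hβm (htB hb)
        have h2 := (abs_lt.1 hlt).1
        change f ω b - 1 / ((k : ℝ) + 1) < f ω d
        linarith
      · intro h
        have hneC : (B ∩ C).Nonempty := by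
          obtain ⟨b, hb⟩ := hne
          obtain ⟨b', hb', -⟩ := happrox ω B subset_rfl t htB htd b hb 1 one_pos
          obtain ⟨d, hd, -⟩ := h b' hb' 0
          exact ⟨d, hrB hd⟩
        obtain ⟨β, hβ, hβm⟩ := hBC.exists_isMaxOn hneC ((hc ω).mono Set.inter_subset_left)
        refine ⟨β, ⟨hβ.1, fun β' hβ' => ?_⟩, hβ.2⟩
        change f ω β' ≤ f ω β
        by_contra! hlt
        obtain ⟨k, hk⟩ := exists_nat_one_div_lt (show 0 < (f ω β' - f ω β) / 2 by linarith)
        obtain ⟨b, hb, hbβ⟩ := happrox ω B subset_rfl t htB htd β' hβ' _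
          (show 0 < (f ω β' - f ω β) / 2 by linarith)
        obtain ⟨d, hd, hdb⟩ := h b hb k
        have h1 : f ω d ≤ f ω β := hβm (hrB hd)
        have h2 := (abs_lt.1 hbβ).1
        have h3 : f ω b - 1 / ((k : ℝ) + 1) < f ω d := hdb
        linarith
    rw [this]
    refine MeasurableSet.biInter htc fun b hb => MeasurableSet.iInter fun k =>
      MeasurableSet.biUnion hrc fun d hd => ?_
    exact measurableSet_lt ((hf b (htB hb)).sub_const _) (hf d (hrB hd).1)

/-- Measurable selection of a maximizer. -/
theorem exists_measurable_isMaxOn {Ω : Type*} [MeasurableSpace Ω] {m : ℕ}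
    {B : Set (EuclideanSpace ℝ (Fin m))} (hB : IsCompact B) (hne : B.Nonempty)
    {f : Ω → EuclideanSpace ℝ (Fin m) → ℝ} (hf : ∀ β ∈ B, Measurable fun ω => f ω β)
    (hc : ∀ ω, ContinuousOn (f ω) B) :
    ∃ s : Ω → EuclideanSpace ℝ (Fin m), Measurable s ∧ ∀ ω, s ω ∈ B ∧ IsMaxOn (f ω) B (s ω) :=
  (isRandomCompact_argmax hB hne hf hc).exists_measurable_selection

/-! ### Lindeberg's central limit theorem. -/

lemma norm_cexp_taylor_two_le (x : ℝ) :
    ‖Complex.exp (x * Complex.I) - (1 + x * Complex.I - x ^ 2 / 2)‖ ≤ 4 * |x| ^ 3 ∧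
    ‖Complex.exp (x * Complex.I) - (1 + x * Complex.I - x ^ 2 / 2)‖ ≤ 4 * x ^ 2 := by
  have hxI : ‖(x : ℂ) * Complex.I‖ = |x| := by simp
  rcases le_total |x| 1 with h | h
  · have h1 := Complex.exp_bound (x := x * Complex.I) (by rw [hxI]; exact h) (n := 3) (by norm_num)
    rw [hxI] at h1
    have h2 : ∑ m ∈ Finset.range 3, ((x : ℂ) * Complex.I) ^ m / (m.factorial : ℂ)
        = 1 + x * Complex.I - x ^ 2 / 2 := by
      simp only [Finset.sum_range_succ, Finset.sum_range_zero]
      simp [Nat.factorial, mul_pow]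
      ring
    rw [h2] at h1
    have h3 : 0 ≤ |x| := abs_nonneg x
    have h4 : |x| ^ 3 * ((3 : ℕ).succ * ((Nat.factorial 3 : ℕ) * (3 : ℕ) : ℝ)⁻¹) ≤ |x| ^ 3 := by
      norm_num [Nat.factorial]
      nlinarith [pow_nonneg h3 3]
    have h5 : |x| ^ 3 ≤ x ^ 2 := by
      rw [← sq_abs x]
      exact pow_le_pow_of_le_one h3 h (by norm_num)
    constructor <;> nlinarith [pow_nonneg h3 3, sq_nonneg x]
  · have h1 : ‖Complex.exp (x * Complex.I) - (1 + x * Complex.I - x ^ 2 / 2)‖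
        ≤ 1 + (1 + |x| + x ^ 2 / 2) := by
      refine (norm_sub_le _ _).trans (add_le_add ?_ ?_)
      · rw [Complex.norm_exp_ofReal_mul_I]
      · refine (norm_sub_le _ _).trans (add_le_add ((norm_add_le _ _).trans ?_) ?_)
        · simp
        · simp
    have h2 : |x| ≤ |x| ^ 2 := by nlinarith
    have h3 : |x| ^ 2 ≤ |x| ^ 3 := by nlinarith [sq_nonneg |x|]
    rw [← sq_abs x] at h1 ⊢
    constructor <;> linarith

lemma norm_prod_sub_prod_le_sum {ι : Type*} (s : Finset ι) (f g : ι → ℂ)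
    (hf : ∀ i ∈ s, ‖f i‖ ≤ 1) (hg : ∀ i ∈ s, ‖g i‖ ≤ 1) :
    ‖∏ i ∈ s, f i - ∏ i ∈ s, g i‖ ≤ ∑ i ∈ s, ‖f i - g i‖ := by
  classical
  induction s using Finset.induction_on with
  | empty => simp
  | insert a s ha ih =>
    rw [Finset.prod_insert ha, Finset.prod_insert ha, Finset.sum_insert ha]
    have h1 : f a * ∏ i ∈ s, f i - g a * ∏ i ∈ s, g i
        = (f a - g a) * ∏ i ∈ s, f i + g a * (∏ i ∈ s, f i - ∏ i ∈ s, g i) := by ring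
    rw [h1]
    refine (norm_add_le _ _).trans (add_le_add ?_ ?_)
    · rw [norm_mul]
      refine mul_le_of_le_one_right (norm_nonneg _) ?_
      rw [norm_prod]
      exact Finset.prod_le_one (fun _ _ => norm_nonneg _)
        fun i hi => hf i (Finset.mem_insert_of_mem hi)
    · rw [norm_mul]
      refine (mul_le_of_le_one_left (norm_nonneg _) (hg a (Finset.mem_insert_self _ _))).trans ?_
      exact ih (fun i hi => hf i (Finset.mem_insert_of_mem hi))
        (fun i hi => hg i (Finset.mem_insert_of_mem hi))

lemma norm_cexp_neg_sub_le {s : ℝ} (hs : 0 ≤ s) :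
    ‖Complex.exp (-(s : ℂ)) - (1 - s)‖ ≤ s ^ 2 := by
  have h : Complex.exp (-(s : ℂ)) - (1 - s) = ((Real.exp (-s) - (1 - s) : ℝ) : ℂ) := by
    push_cast; rfl
  rw [h, Complex.norm_real, Real.norm_eq_abs, abs_of_nonneg]
  · have h1 : Real.exp (-s) * (1 + s) ≤ 1 := by
      have := mul_le_mul_of_nonneg_left (Real.add_one_le_exp s) (Real.exp_pos (-s)).le
      rw [← Real.exp_add] at this
      simpa [add_comm] using this
    have h2 : (1 - s + s ^ 2) * (1 + s) ≥ 1 := by nlinarith [pow_nonneg hs 3]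
    by_contra! hcon
    nlinarith
  · linarith [Real.add_one_le_exp (-s)]

section CharFun

variable {Ω : Type*} [MeasurableSpace Ω] {P : Measure Ω} [IsProbabilityMeasure P]

/-- The exponential is replaced by its second-order Taylor polynomial. Where `|X| ≤ ε` the cubic
error bound gives a factor `ε` times the variance; elsewhere the quadratic bound gives the truncated
second moment. -/
lemma norm_charFun_sub_le {X : Ω → ℝ} (hX : Measurable X) (hX2 : MemLp X 2 P)
    (h0 : ∫ ω, X ω ∂P = 0) (t : ℝ) {ε : ℝ} (hε : 0 ≤ ε) :
    ‖charFun (P.map X) t - (1 - ((t ^ 2 * (∫ ω, X ω ^ 2 ∂P) / 2 : ℝ) : ℂ))‖ ≤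
      4 * ε * |t| ^ 3 * (∫ ω, X ω ^ 2 ∂P)
        + 4 * t ^ 2 * ∫ ω in {ω | ε < |X ω|}, X ω ^ 2 ∂P := by
  have hsq : Integrable (fun ω => X ω ^ 2) P := hX2.integrable_sq
  have hint : Integrable X P := hX2.integrable (by norm_num)
  have hms : MeasurableSet {ω | ε < |X ω|} := measurableSet_lt measurable_const hX.abs
  have hexp : Integrable (fun ω => Complex.exp ((t * X ω : ℝ) * Complex.I)) P := by
    refine Integrable.mono' (integrable_const (1 : ℝ)) (by fun_prop) (ae_of_all _ fun ω => ?_)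
    rw [Complex.norm_exp_ofReal_mul_I]
  have hlin : Integrable (fun ω => (1 : ℂ) + (t * X ω : ℝ) * Complex.I) P :=
    (integrable_const _).add ((hint.const_mul t).ofReal.mul_const _)
  have hquad : Integrable (fun ω => (((t * X ω : ℝ) : ℂ) ^ 2 / 2)) P := by
    have : Integrable (fun ω => (((t ^ 2 / 2 * X ω ^ 2 : ℝ)) : ℂ)) P := (hsq.const_mul _).ofReal
    refine this.congr (ae_of_all _ fun ω => ?_)
    push_cast
    ring
  have e1 : charFun (P.map X) t = ∫ ω, Complex.exp ((t * X ω : ℝ) * Complex.I) ∂P := by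
    rw [charFun_apply_real, integral_map hX.aemeasurable (by fun_prop)]
    simp
  have e2 : (1 - ((t ^ 2 * (∫ ω, X ω ^ 2 ∂P) / 2 : ℝ) : ℂ)) =
      ∫ ω, (1 + (t * X ω : ℝ) * Complex.I - ((t * X ω : ℝ) : ℂ) ^ 2 / 2) ∂P := by
    rw [integral_sub hlin hquad, integral_add (integrable_const _)
      ((hint.const_mul t).ofReal.mul_const _), integral_mul_const, integral_complex_ofReal,
      integral_const_mul, h0]
    have : ∫ ω, (((t * X ω : ℝ) : ℂ) ^ 2 / 2) ∂P = ((t ^ 2 * (∫ ω, X ω ^ 2 ∂P) / 2 : ℝ) : ℂ) := by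
      rw [← integral_const_mul, ← integral_div, ← integral_complex_ofReal]
      congr 1
      ext ω
      push_cast
      ring
    rw [this]
    simp
  have hlq : Integrable (fun ω => 1 + (t * X ω : ℝ) * Complex.I - ((t * X ω : ℝ) : ℂ) ^ 2 / 2) P :=
    hlin.sub hquad
  rw [e1, e2, ← integral_sub hexp hlq]
  have hb : Integrable (fun ω => 4 * ε * |t| ^ 3 * X ω ^ 2
      + {ω | ε < |X ω|}.indicator (fun ω => 4 * t ^ 2 * X ω ^ 2) ω) P :=
    (hsq.const_mul _).add ((hsq.const_mul _).indicator hms)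
  refine (norm_integral_le_of_norm_le hb (ae_of_all _ fun ω => ?_)).trans (le_of_eq ?_)
  · obtain ⟨h3, h2⟩ := norm_cexp_taylor_two_le (t * X ω)
    have hX2 : 0 ≤ X ω ^ 2 := sq_nonneg _
    by_cases hω : ω ∈ {ω | ε < |X ω|}
    · rw [Set.indicator_of_mem hω]
      refine h2.trans ?_
      have : 0 ≤ 4 * ε * |t| ^ 3 * X ω ^ 2 := by positivity
      nlinarith
    · rw [Set.indicator_of_notMem hω, add_zero]
      have hle : |X ω| ≤ ε := not_lt.1 hω
      refine h3.trans ?_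
      rw [abs_mul, mul_pow]
      have : |X ω| ^ 3 ≤ ε * X ω ^ 2 := by
        rw [← sq_abs (X ω), pow_succ' _ 2]
        exact mul_le_mul_of_nonneg_right hle (by positivity)
      have := mul_le_mul_of_nonneg_left this (show 0 ≤ 4 * |t| ^ 3 by positivity)
      linarith
  · rw [integral_add (hsq.const_mul _) ((hsq.const_mul _).indicator hms),
      integral_const_mul, integral_indicator hms, integral_const_mul]

end CharFun

/-- Lindeberg's central limit theorem for triangular arrays, in terms of characteristic
functions. -/
theorem tendsto_charFun_of_lindeberg {Ω : ℕ → Type*} [∀ n, MeasurableSpace (Ω n)]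
    {P : ∀ n, Measure (Ω n)} [∀ n, IsProbabilityMeasure (P n)] {X : ∀ n, Fin n → Ω n → ℝ}
    (hX : ∀ n i, Measurable (X n i)) (hX2 : ∀ n i, MemLp (X n i) 2 (P n))
    (h0 : ∀ n i, ∫ ω, X n i ω ∂(P n) = 0) (hind : ∀ n, iIndepFun (X n) (P n))
    (hvar : ∀ᶠ n in atTop, ∑ i, ∫ ω, X n i ω ^ 2 ∂(P n) = 1)
    (hL : ∀ ε > 0, Tendsto (fun n => ∑ i, ∫ ω in {ω | ε < |X n i ω|}, X n i ω ^ 2 ∂(P n))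
      atTop (𝓝 0)) (t : ℝ) :
    Tendsto (fun n => charFun ((P n).map fun ω => ∑ i, X n i ω) t) atTop
      (𝓝 (charFun (gaussianReal 0 1) t)) := by
  have hg : charFun (gaussianReal 0 1) t = Complex.exp (-((t ^ 2 / 2 : ℝ) : ℂ)) := by
    rw [charFun_gaussianReal]
    congr 1
    push_cast
    simp
  rw [hg, tendsto_iff_norm_sub_tendsto_zero]
  set L : ℝ → ℕ → ℝ := fun ε n => ∑ i, ∫ ω in {ω | ε < |X n i ω|}, X n i ω ^ 2 ∂(P n) with hLdef
  have hbound : ∀ ε > 0, ∀ᶠ n in atTop,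
      ‖charFun ((P n).map fun ω => ∑ i, X n i ω) t - Complex.exp (-((t ^ 2 / 2 : ℝ) : ℂ))‖ ≤
        4 * ε * |t| ^ 3 + 4 * t ^ 2 * L ε n + t ^ 4 * (ε ^ 2 + L ε n) := by
    intro ε hε
    filter_upwards [hvar] with n hn
    set v : Fin n → ℝ := fun i => ∫ ω, X n i ω ^ 2 ∂(P n) with hv
    have hv0 : ∀ i, 0 ≤ v i := fun i => integral_nonneg fun ω => sq_nonneg _
    have hl0 : ∀ i, 0 ≤ ∫ ω in {ω | ε < |X n i ω|}, X n i ω ^ 2 ∂(P n) :=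
      fun i => integral_nonneg fun ω => sq_nonneg _
    -- No single variance matters in the limit; this makes the sum of the squared variances small.
    have hvle : ∀ i, v i ≤ ε ^ 2 + L ε n := by
      intro i
      have hms : MeasurableSet {ω | ε < |X n i ω|} := measurableSet_lt measurable_const (hX n i).abs
      have hsq : Integrable (fun ω => X n i ω ^ 2) (P n) := (hX2 n i).integrable_sq
      have h1 : v i ≤ ε ^ 2 + ∫ ω in {ω | ε < |X n i ω|}, X n i ω ^ 2 ∂(P n) := by
        rw [← integral_indicator hms]
        have : ε ^ 2 = ∫ _, ε ^ 2 ∂(P n) := by simp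
        rw [this, ← integral_add (integrable_const _) (hsq.indicator hms)]
        refine integral_mono hsq ((integrable_const _).add (hsq.indicator hms)) fun ω => ?_
        by_cases hω : ω ∈ {ω | ε < |X n i ω|}
        · simp only [Set.indicator_of_mem hω]
          nlinarith
        · simp only [Set.indicator_of_notMem hω, add_zero]
          have hle : |X n i ω| ≤ ε := not_lt.1 hω
          rw [← sq_abs]
          exact pow_le_pow_left₀ (abs_nonneg _) hle 2
      refine h1.trans (add_le_add_right ?_ _)
      exact Finset.single_le_sum (f := fun i => ∫ ω in {ω | ε < |X n i ω|}, X n i ω ^ 2 ∂(P n))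
        (fun i _ => hl0 i) (Finset.mem_univ i)
    have hprod : Complex.exp (-((t ^ 2 / 2 : ℝ) : ℂ))
        = ∏ i, Complex.exp (-((t ^ 2 * v i / 2 : ℝ) : ℂ)) := by
      rw [← Complex.exp_sum]
      congr 1
      rw [Finset.sum_neg_distrib, ← Complex.ofReal_sum]
      congr 2
      rw [← Finset.sum_div, ← Finset.mul_sum, hn, mul_one]
    rw [(hind n).charFun_map_fun_sum_eq_prod (fun i => (hX n i).aemeasurable), Finset.prod_apply,
      hprod]
    have hprob : ∀ i, IsProbabilityMeasure ((P n).map (X n i)) := fun i =>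
      Measure.isProbabilityMeasure_map (hX n i).aemeasurable
    refine (norm_prod_sub_prod_le_sum _ _ _ (fun i _ => norm_charFun_le_one _) fun i _ => ?_).trans ?_
    · rw [← Complex.ofReal_neg, Complex.norm_exp_ofReal]
      have := hv0 i
      exact Real.exp_le_one_iff.2 (by have : 0 ≤ t ^ 2 * v i / 2 := by positivity
                                      linarith)
    have hterm : ∀ i, ‖charFun ((P n).map (X n i)) t - Complex.exp (-((t ^ 2 * v i / 2 : ℝ) : ℂ))‖
        ≤ 4 * ε * |t| ^ 3 * v i + 4 * t ^ 2 * (∫ ω in {ω | ε < |X n i ω|}, X n i ω ^ 2 ∂(P n))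
          + t ^ 4 * (ε ^ 2 + L ε n) * v i := by
      intro i
      have h1 := norm_charFun_sub_le (hX n i) (hX2 n i) (h0 n i) t hε.le
      have hs : 0 ≤ t ^ 2 * v i / 2 := by have := hv0 i; positivity
      have h2 := norm_cexp_neg_sub_le hs
      refine (norm_sub_le_norm_sub_add_norm_sub _
        (1 - ((t ^ 2 * v i / 2 : ℝ) : ℂ)) _).trans (add_le_add h1 ?_)
      rw [norm_sub_rev]
      refine h2.trans ?_
      have h3 : (t ^ 2 * v i / 2) ^ 2 = t ^ 4 / 4 * (v i * v i) := by ring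
      rw [h3]
      have h4 : v i * v i ≤ (ε ^ 2 + L ε n) * v i := mul_le_mul_of_nonneg_right (hvle i) (hv0 i)
      have h5 : 0 ≤ t ^ 4 := by positivity
      have h6 : 0 ≤ v i * v i := mul_self_nonneg _
      nlinarith [mul_le_mul_of_nonneg_left h4 h5, mul_nonneg h5 h6]
    refine (Finset.sum_le_sum fun i _ => hterm i).trans (le_of_eq ?_)
    rw [Finset.sum_add_distrib, Finset.sum_add_distrib, ← Finset.mul_sum, ← Finset.mul_sum,
      ← Finset.mul_sum, hn, mul_one, mul_one]
  rw [Metric.tendsto_nhds]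
  intro δ hδ
  -- First `ε` is chosen to make the terms without `L` less than `δ / 2`, then `n` to make the terms
  -- with `L ε n` less than `δ / 2`.
  have hcont : Tendsto (fun ε : ℝ => 4 * ε * |t| ^ 3 + t ^ 4 * ε ^ 2) (𝓝 0) (𝓝 0) := by
    have : Continuous fun ε : ℝ => 4 * ε * |t| ^ 3 + t ^ 4 * ε ^ 2 := by fun_prop
    simpa using this.tendsto 0
  obtain ⟨ε, hε, hεδ⟩ := (((hcont.mono_left nhdsWithin_le_nhds).eventually
    (gt_mem_nhds (half_pos hδ))).and (self_mem_nhdsWithin (s := Set.Ioi (0 : ℝ)))).exists.imp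
      fun _ h => And.intro h.2 h.1
  have hLε : Tendsto (fun n => 4 * t ^ 2 * L ε n + t ^ 4 * L ε n) atTop (𝓝 0) := by
    simpa using ((hL ε hε).const_mul (4 * t ^ 2)).add ((hL ε hε).const_mul (t ^ 4))
  filter_upwards [hbound ε hε, hLε.eventually (gt_mem_nhds (half_pos hδ))] with n h1 h2
  rw [Real.dist_eq, sub_zero, abs_of_nonneg (norm_nonneg _)]
  refine h1.trans_lt ?_
  linarith

/-- A sequence that differs negligibly from one whose characteristic functions converge to the
standard Gaussian one converges in distribution. -/
theorem tendstoInDistribution_gaussian_of_charFun {Ω : ℕ → Type*} [∀ n, MeasurableSpace (Ω n)]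
    {P : ∀ n, Measure (Ω n)} [∀ n, IsProbabilityMeasure (P n)] {X T : ∀ n, Ω n → ℝ}
    (hX : ∀ n, Measurable (X n)) (hT : ∀ n, Measurable (T n))
    (hlim : ∀ t, Tendsto (fun n => charFun ((P n).map (X n)) t) atTop
      (𝓝 (charFun (gaussianReal 0 1) t)))
    (hdiff : ∀ ε > 0, Tendsto (fun n => (P n).real {ω | ε < |T n ω - X n ω|}) atTop (𝓝 0)) :
    TendstoInDistribution T atTop (id : ℝ → ℝ) P (gaussianReal 0 1) := by
  refine ⟨fun n => (hT n).aemeasurable, aemeasurable_id, ?_⟩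
  refine ProbabilityMeasure.tendsto_iff_tendsto_charFun.2 fun t => ?_
  simp only [ProbabilityMeasure.coe_mk, Measure.map_id]
  have hd : Tendsto (fun n => charFun ((P n).map (T n)) t - charFun ((P n).map (X n)) t) atTop
      (𝓝 0) := by
    rw [Metric.tendsto_nhds]
    intro δ hδ
    -- Where the two variables differ by at most `ε` the integrand is at most `|t| ε ≤ δ / 2`;
    -- elsewhere it is at most 2, on an event of probability less than `δ / 4`.
    set ε := δ / (2 * (|t| + 1)) with hε
    have hεpos : 0 < ε := by positivity
    filter_upwards [(hdiff ε hεpos).eventually (gt_mem_nhds (show 0 < δ / 4 by linarith))]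
      with n hn
    have hms : MeasurableSet {ω | ε < |T n ω - X n ω|} :=
      measurableSet_lt measurable_const ((hT n).sub (hX n)).abs
    have hi : ∀ Z : Ω n → ℝ, Measurable Z →
        Integrable (fun ω => Complex.exp ((t * Z ω : ℝ) * Complex.I)) (P n) := fun Z hZ =>
      Integrable.mono' (integrable_const (1 : ℝ)) (by fun_prop) (ae_of_all _ fun ω => by
        rw [Complex.norm_exp_ofReal_mul_I])
    have hc : ∀ Z : Ω n → ℝ, Measurable Z → charFun ((P n).map Z) t =
        ∫ ω, Complex.exp ((t * Z ω : ℝ) * Complex.I) ∂(P n) := fun Z hZ => by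
      rw [charFun_apply_real, integral_map hZ.aemeasurable (by fun_prop)]
      simp
    rw [dist_zero_right, hc _ (hT n), hc _ (hX n), ← integral_sub (hi _ (hT n)) (hi _ (hX n))]
    have hb : Integrable (fun ω => |t| * ε + {ω | ε < |T n ω - X n ω|}.indicator
        (fun _ => (2 : ℝ)) ω) (P n) :=
      (integrable_const _).add ((integrable_const _).indicator hms)
    refine (norm_integral_le_of_norm_le hb (ae_of_all _ fun ω => ?_)).trans_lt ?_
    · by_cases hω : ω ∈ {ω | ε < |T n ω - X n ω|}
      · rw [Set.indicator_of_mem hω]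
        refine (norm_sub_le _ _).trans ?_
        rw [Complex.norm_exp_ofReal_mul_I, Complex.norm_exp_ofReal_mul_I]
        have : 0 ≤ |t| * ε := by positivity
        linarith
      · rw [Set.indicator_of_notMem hω, add_zero]
        have hle : |T n ω - X n ω| ≤ ε := not_lt.1 hω
        have hfac : Complex.exp ((t * T n ω : ℝ) * Complex.I)
            - Complex.exp ((t * X n ω : ℝ) * Complex.I)
            = Complex.exp ((t * X n ω : ℝ) * Complex.I) *
              (Complex.exp (Complex.I * (t * (T n ω - X n ω) : ℝ)) - 1) := by
          rw [mul_sub, mul_one, ← Complex.exp_add]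
          congr 2
          push_cast
          ring
        rw [hfac, norm_mul, Complex.norm_exp_ofReal_mul_I, one_mul]
        refine (Real.norm_exp_I_mul_ofReal_sub_one_le).trans ?_
        rw [Real.norm_eq_abs, abs_mul]
        exact mul_le_mul_of_nonneg_left hle (abs_nonneg _)
    · rw [integral_add (integrable_const _) ((integrable_const _).indicator hms),
        integral_indicator hms]
      simp only [integral_const, smul_eq_mul, probReal_univ,
        measureReal_restrict_apply_univ, one_mul]
      have h1 : |t| * ε ≤ δ / 2 := by
        rw [hε, mul_div_assoc', div_le_div_iff₀ (by positivity) (by norm_num)]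
        nlinarith [abs_nonneg t]
      linarith
  simpa using hd.add (hlim t)

/-! ### The contraction principle for Rademacher sums. -/

lemma sq_add_sq_le_of_majorized {a b p q : ℝ} (ha : 0 ≤ a) (hb : 0 ≤ b)
    (hsum : a + b ≤ p + q) (hap : a ≤ max p q) (hbp : b ≤ max p q) :
    a ^ 2 + b ^ 2 ≤ p ^ 2 + q ^ 2 := by
  wlog hpq : q ≤ p generalizing p q
  · rw [add_comm (p ^ 2)]
    exact this (by linarith) (by rwa [max_comm]) (by rwa [max_comm]) (le_of_not_ge hpq)
  wlog hab : b ≤ a generalizing a b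
  · rw [add_comm (a ^ 2)]
    exact this hb ha (by linarith) hbp hap (le_of_not_ge hab)
  rw [max_eq_left hpq] at hap hbp
  -- If `a` lies between `q` and `p`, then `b ≤ p + q - a` and `(p - a) (a - q) ≥ 0` is the required
  -- inequality; otherwise `b ≤ a ≤ q ≤ p`.
  rcases le_total q a with h | h
  · have h1 : b ^ 2 ≤ (p + q - a) ^ 2 := by
      refine pow_le_pow_left₀ hb (by linarith) 2
    nlinarith [mul_nonneg (sub_nonneg.2 hap) (sub_nonneg.2 h)]
  · have h1 : a ^ 2 ≤ p ^ 2 := pow_le_pow_left₀ ha hap 2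
    have h2 : b ^ 2 ≤ q ^ 2 := pow_le_pow_left₀ hb (hab.trans h) 2
    linarith

section Contraction

variable {ι T : Type*} [DecidableEq ι]

/-- The sign of `i` in the sign pattern that is positive exactly on `U`. -/
noncomputable def setSign (U : Finset ι) (i : ι) : ℝ := if i ∈ U then 1 else -1

lemma abs_setSign (U : Finset ι) (i : ι) : |setSign U i| = 1 := by
  unfold setSign
  split <;> simp

lemma bddAbove_range_of_abs_le {A : T → ℝ} (h : ∃ C, ∀ t, |A t| ≤ C) :
    BddAbove (Set.range A) := by
  obtain ⟨C, hC⟩ := h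
  exact ⟨C, by rintro _ ⟨t, rfl⟩; exact (le_abs_self _).trans (hC t)⟩

lemma exists_abs_add_le {A B : T → ℝ} (hA : ∃ C, ∀ t, |A t| ≤ C) (hB : ∃ C, ∀ t, |B t| ≤ C) :
    ∃ C, ∀ t, |A t + B t| ≤ C := by
  obtain ⟨C, hC⟩ := hA
  obtain ⟨D, hD⟩ := hB
  exact ⟨C + D, fun t => (abs_add_le _ _).trans (add_le_add (hC t) (hD t))⟩

lemma exists_abs_neg_le {A : T → ℝ} (hA : ∃ C, ∀ t, |A t| ≤ C) : ∃ C, ∀ t, |-A t| ≤ C := by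
  simpa only [abs_neg] using hA

variable [Nonempty T]

/-- The suprema for `φ` are weakly majorized by those for `τ`: the Lipschitz condition controls
their sum, and `|φ| ≤ |τ|`, its special case at `o`, controls their maximum. The value at `o` makes
them nonnegative, so squaring preserves the comparison. -/
lemma sq_iSup_add_sq_iSup_le {A φ τ : T → ℝ} (hA : ∃ C, ∀ t, |A t| ≤ C)
    (hτ : ∃ C, ∀ t, |τ t| ≤ C) (o : T) (hAo : 0 ≤ A o) (hτo : τ o = 0) (hφo : φ o = 0)
    (hφ : ∀ s t, |φ s - φ t| ≤ |τ s - τ t|) :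
    (⨆ t, (A t - φ t)) ^ 2 + (⨆ t, (A t + φ t)) ^ 2 ≤
      (⨆ t, (A t - τ t)) ^ 2 + (⨆ t, (A t + τ t)) ^ 2 := by
  have hφτ : ∀ t, |φ t| ≤ |τ t| := fun t => by simpa [hφo, hτo] using hφ t o
  have hφb : ∃ C, ∀ t, |φ t| ≤ C := hτ.imp fun C hC t => (hφτ t).trans (hC t)
  have b1 : BddAbove (Set.range fun t => A t - φ t) := by
    simpa only [sub_eq_add_neg] using
      bddAbove_range_of_abs_le (exists_abs_add_le hA (exists_abs_neg_le hφb))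
  have b2 : BddAbove (Set.range fun t => A t + φ t) :=
    bddAbove_range_of_abs_le (exists_abs_add_le hA hφb)
  have b3 : BddAbove (Set.range fun t => A t - τ t) := by
    simpa only [sub_eq_add_neg] using
      bddAbove_range_of_abs_le (exists_abs_add_le hA (exists_abs_neg_le hτ))
  have b4 : BddAbove (Set.range fun t => A t + τ t) :=
    bddAbove_range_of_abs_le (exists_abs_add_le hA hτ)
  have l3 := fun t => le_ciSup b3 t
  have l4 := fun t => le_ciSup b4 t
  have hmax : ∀ t, A t + |τ t| ≤ max (⨆ t, (A t - τ t)) (⨆ t, (A t + τ t)) := by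
    intro t
    rcases abs_cases (τ t) with ⟨h, -⟩ | ⟨h, -⟩ <;> rw [h]
    · exact (l4 t).trans (le_max_right _ _)
    · exact (le_of_eq (by ring)).trans ((l3 t).trans (le_max_left _ _))
  have hsum : ∀ s t, (A s - φ s) + (A t + φ t) ≤ (⨆ t, (A t - τ t)) + ⨆ t, (A t + τ t) := by
    intro s t
    have h1 := (le_abs_self _).trans (hφ t s)
    rcases abs_cases (τ t - τ s) with ⟨h, -⟩ | ⟨h, -⟩ <;> rw [h] at h1
    · have := l3 s; have := l4 t; linarith
    · have := l3 t; have := l4 s; linarith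
  refine sq_add_sq_le_of_majorized ?_ ?_ ?_ ?_ ?_
  · exact (by simpa [hφo] using hAo : 0 ≤ A o - φ o).trans (le_ciSup b1 o)
  · exact (by simpa [hφo] using hAo : 0 ≤ A o + φ o).trans (le_ciSup b2 o)
  · rw [← le_sub_iff_add_le]
    refine ciSup_le fun s => ?_
    rw [le_sub_comm]
    refine ciSup_le fun t => ?_
    have := hsum s t
    linarith
  · refine ciSup_le fun t => le_trans ?_ (hmax t)
    have := neg_le_of_abs_le (hφτ t)
    linarith
  · refine ciSup_le fun t => le_trans ?_ (hmax t)
    have := (le_abs_self _).trans (hφτ t)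
    linarith

/-- The contraction principle for squares of suprema of Rademacher sums. -/
lemma sum_sq_iSup_le_of_contraction (s : Finset ι) {φ τ : ι → T → ℝ}
    (hτ : ∀ i, ∃ C, ∀ t, |τ i t| ≤ C) (o : T) (hτo : ∀ i, τ i o = 0) (hφo : ∀ i, φ i o = 0)
    (hφ : ∀ i s t, |φ i s - φ i t| ≤ |τ i s - τ i t|)
    {A : T → ℝ} (hA : ∃ C, ∀ t, |A t| ≤ C) (hAo : 0 ≤ A o) :
    ∑ U ∈ s.powerset, (⨆ t, (A t + ∑ i ∈ s, setSign U i * φ i t)) ^ 2 ≤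
      ∑ U ∈ s.powerset, (⨆ t, (A t + ∑ i ∈ s, setSign U i * τ i t)) ^ 2 := by
  induction s using Finset.induction_on generalizing A with
  | empty => simp
  | insert j s hj ih =>
    have hsplit : ∀ (ψ : ι → T → ℝ), ∑ U ∈ (insert j s).powerset,
        (⨆ t, (A t + ∑ i ∈ insert j s, setSign U i * ψ i t)) ^ 2 =
        ∑ U ∈ s.powerset, ((⨆ t, ((A t + ∑ i ∈ s, setSign U i * ψ i t) - ψ j t)) ^ 2 +
          (⨆ t, ((A t + ∑ i ∈ s, setSign U i * ψ i t) + ψ j t)) ^ 2) := by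
      intro ψ
      rw [Finset.sum_powerset_insert hj, Finset.sum_add_distrib]
      congr 1
      · refine Finset.sum_congr rfl fun U hU => ?_
        have hjU : j ∉ U := fun h => hj (Finset.mem_powerset.1 hU h)
        congr 1
        refine iSup_congr fun t => ?_
        rw [Finset.sum_insert hj]
        simp only [setSign, hjU, if_false]
        ring
      · refine Finset.sum_congr rfl fun U hU => ?_
        congr 1
        refine iSup_congr fun t => ?_
        rw [Finset.sum_insert hj]
        have : ∀ i ∈ s, setSign (insert j U) i * ψ i t = setSign U i * ψ i t := by
          intro i hi
          have hij : i ≠ j := fun h => hj (h ▸ hi)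
          simp [setSign, hij]
        rw [Finset.sum_congr rfl this]
        simp only [setSign, Finset.mem_insert_self, if_true]
        ring
    rw [hsplit, hsplit]
    have hφb : ∀ i, ∃ C, ∀ t, |φ i t| ≤ C := fun i => (hτ i).imp fun C hC t =>
      le_trans (by simpa [hφo i, hτo i] using hφ i t o) (hC t)
    have hsumb : ∀ U : Finset ι, ∃ C, ∀ t, |∑ i ∈ s, setSign U i * φ i t| ≤ C := by
      intro U
      choose C hC using hφb
      refine ⟨∑ i ∈ s, C i, fun t => (Finset.abs_sum_le_sum_abs _ _).trans
        (Finset.sum_le_sum fun i _ => ?_)⟩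
      rw [abs_mul, abs_setSign, one_mul]
      exact hC i t
    -- For each sign pattern on `s` the coordinate `j` is contracted with the rest frozen. Then `± τ
    -- j` is absorbed into the offset `A`, and the induction hypothesis contracts the remaining
    -- coordinates.
    calc ∑ U ∈ s.powerset, ((⨆ t, ((A t + ∑ i ∈ s, setSign U i * φ i t) - φ j t)) ^ 2 +
          (⨆ t, ((A t + ∑ i ∈ s, setSign U i * φ i t) + φ j t)) ^ 2)
        ≤ ∑ U ∈ s.powerset, ((⨆ t, ((A t + ∑ i ∈ s, setSign U i * φ i t) - τ j t)) ^ 2 +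
          (⨆ t, ((A t + ∑ i ∈ s, setSign U i * φ i t) + τ j t)) ^ 2) := by
          refine Finset.sum_le_sum fun U _ => sq_iSup_add_sq_iSup_le
            (exists_abs_add_le hA (hsumb U)) (hτ j) o ?_ (hτo j) (hφo j) (hφ j)
          simpa [hφo] using hAo
      _ ≤ _ := by
          rw [Finset.sum_add_distrib, Finset.sum_add_distrib]
          have h1 := ih (A := fun t => A t - τ j t)
            (by simpa only [sub_eq_add_neg] using
              exists_abs_add_le hA (exists_abs_neg_le (hτ j))) (by simpa [hτo] using hAo)
          have h2 := ih (A := fun t => A t + τ j t) (exists_abs_add_le hA (hτ j))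
            (by simpa [hτo] using hAo)
          have e1 : ∀ ψ : ι → T → ℝ,
              ∑ U ∈ s.powerset, (⨆ t, (A t + ∑ i ∈ s, setSign U i * ψ i t - τ j t)) ^ 2 =
              ∑ U ∈ s.powerset, (⨆ t, (A t - τ j t + ∑ i ∈ s, setSign U i * ψ i t)) ^ 2 :=
            fun ψ => Finset.sum_congr rfl fun U _ => by
              congr 1
              exact iSup_congr fun t => by ring
          have e2 : ∀ ψ : ι → T → ℝ,
              ∑ U ∈ s.powerset, (⨆ t, (A t + ∑ i ∈ s, setSign U i * ψ i t + τ j t)) ^ 2 =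
              ∑ U ∈ s.powerset, (⨆ t, (A t + τ j t + ∑ i ∈ s, setSign U i * ψ i t)) ^ 2 :=
            fun ψ => Finset.sum_congr rfl fun U _ => by
              congr 1
              exact iSup_congr fun t => by ring
          rw [e1, e1, e2, e2]
          exact add_le_add h1 h2

/-- The parallelogram law for each added vector: averaged over the signs, the cross terms cancel. -/
lemma sum_norm_sq_setSign {E : Type*} [NormedAddCommGroup E] [InnerProductSpace ℝ E]
    (s : Finset ι) (v : ι → E) (x : E) :
    ∑ U ∈ s.powerset, ‖x + ∑ i ∈ s, setSign U i • v i‖ ^ 2 =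
      2 ^ s.card * (‖x‖ ^ 2 + ∑ i ∈ s, ‖v i‖ ^ 2) := by
  induction s using Finset.induction_on generalizing x with
  | empty => simp
  | insert j s hj ih =>
    rw [Finset.sum_powerset_insert hj]
    have h1 : ∀ U ∈ s.powerset, ‖x + ∑ i ∈ insert j s, setSign U i • v i‖ ^ 2
        = ‖(x - v j) + ∑ i ∈ s, setSign U i • v i‖ ^ 2 := by
      intro U hU
      have hjU : j ∉ U := fun h => hj (Finset.mem_powerset.1 hU h)
      rw [Finset.sum_insert hj]
      simp only [setSign, hjU, if_false]
      congr 2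
      simp only [neg_smul, one_smul]
      abel
    have h2 : ∀ U ∈ s.powerset, ‖x + ∑ i ∈ insert j s, setSign (insert j U) i • v i‖ ^ 2
        = ‖(x + v j) + ∑ i ∈ s, setSign U i • v i‖ ^ 2 := by
      intro U hU
      rw [Finset.sum_insert hj]
      have : ∀ i ∈ s, setSign (insert j U) i • v i = setSign U i • v i := by
        intro i hi
        have hij : i ≠ j := fun h => hj (h ▸ hi)
        simp [setSign, hij]
      rw [Finset.sum_congr rfl this]
      simp only [setSign, Finset.mem_insert_self, if_true, one_smul]
      congr 2
      abel
    rw [Finset.sum_congr rfl h1, Finset.sum_congr rfl h2, ih, ih, Finset.card_insert_of_notMem hj,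
      Finset.sum_insert hj]
    have := parallelogram_law_with_norm ℝ x (v j)
    rw [pow_succ]
    linear_combination 2 ^ s.card * this

/-- The contraction principle for linear forms that are evaluated at points of a ball. -/
lemma sum_sq_iSup_le_of_lipschitz {E : Type*} [NormedAddCommGroup E] [InnerProductSpace ℝ E]
    (s : Finset ι) (z : ι → E) (γ : T → E) {ρ L : ℝ} (hL : 0 ≤ L) (hγ : ∀ t, ‖γ t‖ ≤ ρ)
    {φ : ι → T → ℝ} (o : T) (hγo : γ o = 0) (hφo : ∀ i, φ i o = 0)
    (hφ : ∀ i s t, |φ i s - φ i t| ≤ L * |inner ℝ (z i) (γ s) - inner ℝ (z i) (γ t)|)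
    (d : ι → ℝ) :
    ∑ U ∈ s.powerset, (⨆ t, ∑ i ∈ s, setSign U i * (d i * φ i t)) ^ 2 ≤
      2 ^ s.card * (L ^ 2 * ρ ^ 2 * ∑ i ∈ s, d i ^ 2 * ‖z i‖ ^ 2) := by
  have hρ : 0 ≤ ρ := (norm_nonneg _).trans (hγ o)
  have hb : ∀ (i : ι), ∃ C, ∀ t, |L * d i * inner ℝ (z i) (γ t)| ≤ C := by
    intro i
    refine ⟨|L * d i| * (‖z i‖ * ρ), fun t => ?_⟩
    rw [abs_mul]
    refine mul_le_mul_of_nonneg_left ((abs_real_inner_le_norm _ _).trans ?_) (abs_nonneg _)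
    exact mul_le_mul_of_nonneg_left (hγ t) (norm_nonneg _)
  have h := sum_sq_iSup_le_of_contraction s (φ := fun i t => d i * φ i t)
    (τ := fun i t => L * d i * inner ℝ (z i) (γ t)) hb o (fun i => by simp [hγo])
    (fun i => by simp [hφo]) (fun i s t => by
      rw [← mul_sub, ← mul_sub, abs_mul, abs_mul, abs_mul, abs_of_nonneg hL, mul_assoc,
        mul_left_comm]
      exact mul_le_mul_of_nonneg_left (hφ i s t) (abs_nonneg _))
    (A := fun _ => 0) ⟨0, by simp⟩ le_rfl
  simp only [zero_add] at h
  refine h.trans ?_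
  have h2 := sum_norm_sq_setSign s (fun i => d i • z i) 0
  simp only [zero_add, norm_zero, norm_smul, mul_pow, Real.norm_eq_abs, sq_abs, ne_eq,
    OfNat.ofNat_ne_zero, not_false_eq_true, zero_pow] at h2
  calc ∑ U ∈ s.powerset, (⨆ t, ∑ i ∈ s, setSign U i * (L * d i * inner ℝ (z i) (γ t))) ^ 2
      ≤ ∑ U ∈ s.powerset, (L ^ 2 * ρ ^ 2) * ‖∑ i ∈ s, setSign U i • d i • z i‖ ^ 2 := by
        refine Finset.sum_le_sum fun U _ => ?_
        have he : ∀ t, ∑ i ∈ s, setSign U i * (L * d i * inner ℝ (z i) (γ t))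
            = L * inner ℝ (∑ i ∈ s, setSign U i • d i • z i) (γ t) := by
          intro t
          rw [sum_inner, Finset.mul_sum]
          refine Finset.sum_congr rfl fun i _ => ?_
          rw [inner_smul_left, inner_smul_left]
          simp
          ring
        have hle : ∀ t, |∑ i ∈ s, setSign U i * (L * d i * inner ℝ (z i) (γ t))|
            ≤ L * (‖∑ i ∈ s, setSign U i • d i • z i‖ * ρ) := by
          intro t
          rw [he, abs_mul, abs_of_nonneg hL]
          refine mul_le_mul_of_nonneg_left ((abs_real_inner_le_norm _ _).trans ?_) hL
          exact mul_le_mul_of_nonneg_left (hγ t) (norm_nonneg _)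
        have hbd := bddAbove_range_of_abs_le ⟨_, hle⟩
        have h0 : 0 ≤ ⨆ t, ∑ i ∈ s, setSign U i * (L * d i * inner ℝ (z i) (γ t)) := by
          refine le_trans (le_of_eq ?_) (le_ciSup hbd o)
          simp [hγo]
        refine (pow_le_pow_left₀ h0 (ciSup_le fun t => (le_abs_self _).trans (hle t)) 2).trans
          (le_of_eq (by ring))
    _ = _ := by
        rw [← Finset.mul_sum, h2]
        ring

end Contraction

/-! ### Symmetrization and the supremum of the empirical process. -/

section Symmetrization

variable {ι T : Type*} [Fintype ι]

/-- The supremum of the linear functionals `e ↦ ∑ i, e i * φ i t`. -/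
noncomputable def supForm (φ : ι → T → ℝ) (e : ι → ℝ) : ℝ := ⨆ t, ∑ i, e i * φ i t

variable {φ : ι → T → ℝ} {Φ : ι → ℝ}

lemma abs_sum_mul_le (hΦ : ∀ i t, |φ i t| ≤ Φ i) (e : ι → ℝ) (t : T) :
    |∑ i, e i * φ i t| ≤ ∑ i, |e i| * Φ i := by
  refine (Finset.abs_sum_le_sum_abs _ _).trans (Finset.sum_le_sum fun i _ => ?_)
  rw [abs_mul]
  exact mul_le_mul_of_nonneg_left (hΦ i t) (abs_nonneg _)

lemma le_supForm (hΦ : ∀ i t, |φ i t| ≤ Φ i) (e : ι → ℝ) (t : T) :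
    ∑ i, e i * φ i t ≤ supForm φ e :=
  le_ciSup (f := fun t => ∑ i, e i * φ i t)
    (bddAbove_range_of_abs_le ⟨_, abs_sum_mul_le hΦ e⟩) t

lemma supForm_nonneg (hΦ : ∀ i t, |φ i t| ≤ Φ i) (o : T) (ho : ∀ i, φ i o = 0) (e : ι → ℝ) :
    0 ≤ supForm φ e := by
  simpa [ho] using le_supForm hΦ e o

variable [Nonempty T]

lemma supForm_le (hΦ : ∀ i t, |φ i t| ≤ Φ i) (e : ι → ℝ) :
    supForm φ e ≤ ∑ i, |e i| * Φ i :=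
  ciSup_le fun t => (le_abs_self _).trans (abs_sum_mul_le hΦ e t)

lemma supForm_sub_le (hΦ : ∀ i t, |φ i t| ≤ Φ i) (e e' : ι → ℝ) :
    supForm φ e - supForm φ e' ≤ ∑ i, |e i - e' i| * Φ i := by
  rw [sub_le_iff_le_add]
  refine ciSup_le fun t => ?_
  have h1 := (le_abs_self _).trans (abs_sum_mul_le hΦ (fun i => e i - e' i) t)
  have h2 := le_supForm hΦ e' t
  have h3 : ∑ i, e i * φ i t = ∑ i, (e i - e' i) * φ i t + ∑ i, e' i * φ i t := by
    rw [← Finset.sum_add_distrib]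
    exact Finset.sum_congr rfl fun i _ => by ring
  linarith

lemma continuous_supForm (hΦ : ∀ i t, |φ i t| ≤ Φ i) : Continuous (supForm φ) := by
  rw [continuous_iff_continuousAt]
  intro e
  have h0 : Tendsto (fun e' : ι → ℝ => ∑ i, |e' i - e i| * Φ i) (𝓝 e) (𝓝 0) := by
    have : Continuous fun e' : ι → ℝ => ∑ i, |e' i - e i| * Φ i := by fun_prop
    simpa using this.tendsto e
  rw [ContinuousAt, tendsto_iff_dist_tendsto_zero]
  refine squeeze_zero (fun _ => dist_nonneg) (fun e' => ?_) h0
  rw [Real.dist_eq, abs_le]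
  have h1 := supForm_sub_le hΦ e e'
  have h2 := supForm_sub_le hΦ e' e
  simp_rw [abs_sub_comm (e _) (e' _)] at h1
  constructor <;> linarith

variable [DecidableEq ι] (μ : ι → Measure ℝ) [∀ i, IsProbabilityMeasure (μ i)]

/-- Exchanges the coordinates in `U` of two vectors. -/
def swapOn (U : Finset ι) (q : (ι → ℝ) × (ι → ℝ)) : (ι → ℝ) × (ι → ℝ) :=
  (fun i => if i ∈ U then q.1 i else q.2 i, fun i => if i ∈ U then q.2 i else q.1 i)

/-- A pair of vectors is a vector of pairs with law `μ i ⊗ μ i` in coordinate `i`, and each of these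
laws is invariant under exchange. -/
lemma measurePreserving_swapOn (U : Finset ι) :
    MeasurePreserving (swapOn U) ((Measure.pi μ).prod (Measure.pi μ))
      ((Measure.pi μ).prod (Measure.pi μ)) := by
  have h1 := measurePreserving_arrowProdEquivProdArrow ℝ ℝ ι μ μ
  have h2 : MeasurePreserving (fun (q : ι → ℝ × ℝ) i => if i ∈ U then q i else (q i).swap)
      (Measure.pi fun i => (μ i).prod (μ i)) (Measure.pi fun i => (μ i).prod (μ i)) := by
    refine measurePreserving_pi (f := fun i (q : ℝ × ℝ) => if i ∈ U then q else q.swap) _ _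
      fun i => ?_
    by_cases hi : i ∈ U
    · simp only [hi, if_true]
      exact MeasurePreserving.id _
    · simpa [hi] using Measure.measurePreserving_swap (μ := μ i) (ν := μ i)
  have h3 := (h1.comp h2).comp (h1.symm _)
  convert h3 using 1
  ext q i
  · by_cases hi : i ∈ U <;>
      simp [swapOn, hi, MeasurableEquiv.arrowProdEquivProdArrow, Equiv.arrowProdEquivProdArrow]
  · by_cases hi : i ∈ U <;>
      simp [swapOn, hi, MeasurableEquiv.arrowProdEquivProdArrow, Equiv.arrowProdEquivProdArrow]

/-- Symmetrization and contraction: the second moment of the supremum of an empirical process that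
is indexed by Lipschitz transforms of linear forms on a ball. -/
theorem integral_sq_supForm_le {E : Type*} [NormedAddCommGroup E] [InnerProductSpace ℝ E]
    (h2 : ∀ i, MemLp id 2 (μ i)) (h0 : ∀ i, ∫ x, x ∂(μ i) = 0) {V : ℝ}
    (hV : ∀ i, ∫ x, x ^ 2 ∂(μ i) ≤ V) (z : ι → E) (γ : T → E) {ρ L : ℝ} (hL : 0 ≤ L)
    (hγ : ∀ t, ‖γ t‖ ≤ ρ) (o : T) (hγo : γ o = 0) (hφo : ∀ i, φ i o = 0)
    (hφ : ∀ i s t, |φ i s - φ i t| ≤ L * |inner ℝ (z i) (γ s) - inner ℝ (z i) (γ t)|) :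
    Integrable (fun e => supForm φ e ^ 2) (Measure.pi μ) ∧
    ∫ e, supForm φ e ^ 2 ∂(Measure.pi μ) ≤ 2 * L ^ 2 * ρ ^ 2 * V * ∑ i, ‖z i‖ ^ 2 := by
  set m := Measure.pi μ with hm
  set Φ : ι → ℝ := fun i => L * (‖z i‖ * ρ) with hΦdef
  have hΦ : ∀ i t, |φ i t| ≤ Φ i := by
    intro i t
    have h := hφ i t o
    rw [hφo, hγo, inner_zero_right, sub_zero, sub_zero] at h
    refine h.trans (mul_le_mul_of_nonneg_left ((abs_real_inner_le_norm _ _).trans ?_) hL)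
    exact mul_le_mul_of_nonneg_left (hγ t) (norm_nonneg _)
  have hcont := continuous_supForm hΦ
  have hnn := supForm_nonneg hΦ o hφo
  have hcoord : ∀ i, MemLp (fun e : ι → ℝ => e i) 2 m := fun i =>
    (h2 i).comp_measurePreserving (measurePreserving_eval μ i)
  have hmem : MemLp (supForm φ) 2 m := by
    have hdom : MemLp (fun e : ι → ℝ => ∑ i, |e i| * Φ i) 2 m :=
      memLp_finsetSum _ fun i _ => (hcoord i).norm.mul_const _
    refine hdom.mono hcont.aestronglyMeasurable (ae_of_all _ fun e => ?_)
    rw [Real.norm_of_nonneg (hnn e)]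
    exact (supForm_le hΦ e).trans (le_abs_self _)
  have hint : Integrable (fun e => supForm φ e ^ 2) m := hmem.integrable_sq
  refine ⟨hint, ?_⟩
  have hcoordl : ∀ i, MemLp (fun q : (ι → ℝ) × (ι → ℝ) => q.1 i) 2 (m.prod m) := fun i =>
    (hcoord i).comp_measurePreserving measurePreserving_fst
  have hcoordr : ∀ i, MemLp (fun q : (ι → ℝ) × (ι → ℝ) => q.2 i) 2 (m.prod m) := fun i =>
    (hcoord i).comp_measurePreserving measurePreserving_snd
  have hmem2 : MemLp (fun q : (ι → ℝ) × (ι → ℝ) => supForm φ (q.1 - q.2)) 2 (m.prod m) := by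
    have hdom : MemLp (fun q : (ι → ℝ) × (ι → ℝ) => ∑ i, |q.1 i - q.2 i| * Φ i) 2 (m.prod m) :=
      memLp_finsetSum _ fun i _ => ((hcoordl i).sub (hcoordr i)).norm.mul_const _
    refine hdom.mono (hcont.comp (continuous_fst.sub continuous_snd)).aestronglyMeasurable
      (ae_of_all _ fun q => ?_)
    rw [Real.norm_of_nonneg (hnn _)]
    exact (supForm_le hΦ _).trans (le_abs_self _)
  have hint2 : Integrable (fun q : (ι → ℝ) × (ι → ℝ) => supForm φ (q.1 - q.2) ^ 2) (m.prod m) :=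
    hmem2.integrable_sq
  have hcoord0 : ∀ i, ∫ e, e i ∂m = 0 := fun i => by
    have := (measurePreserving_eval μ i).map_eq
    rw [← h0 i, ← this, integral_map (measurable_pi_apply i).aemeasurable (by fun_prop)]
  have hcoordsq : ∀ i, ∫ e, e i ^ 2 ∂m ≤ V := fun i => by
    refine le_trans (le_of_eq ?_) (hV i)
    rw [← (measurePreserving_eval μ i).map_eq,
      integral_map (measurable_pi_apply i).aemeasurable (by fun_prop)]
  -- Subtracting an independent centered copy does not change the mean of a linear functional, so
  -- the supremum is at most the mean of the suprema. Nonnegativity of the variance passes this to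
  -- squares.
  have hjensen : ∀ e, supForm φ e ^ 2 ≤ ∫ e', supForm φ (e - e') ^ 2 ∂m := by
    intro e
    have hce : Continuous fun e' : ι → ℝ => supForm φ (e - e') :=
      hcont.comp (continuous_const.sub continuous_id)
    have hme : MemLp (fun e' => supForm φ (e - e')) 2 m := by
      have hdom : MemLp (fun e' : ι → ℝ => ∑ i, |e i - e' i| * Φ i) 2 m :=
        memLp_finsetSum _ fun i _ => ((memLp_const (e i)).sub (hcoord i)).norm.mul_const _
      refine hdom.mono hce.aestronglyMeasurable (ae_of_all _ fun q => ?_)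
      rw [Real.norm_of_nonneg (hnn _)]
      exact (supForm_le hΦ _).trans (le_abs_self _)
    have hie : Integrable (fun e' => supForm φ (e - e')) m := hme.integrable (by norm_num)
    have h1 : supForm φ e ≤ ∫ e', supForm φ (e - e') ∂m := by
      refine ciSup_le fun t => ?_
      have hlini : ∀ i ∈ Finset.univ, Integrable (fun e' : ι → ℝ => (e i - e' i) * φ i t) m :=
        fun i _ => (((memLp_const (e i)).sub (hcoord i)).integrable (by norm_num)).mul_const _
      have hlin : Integrable (fun e' : ι → ℝ => ∑ i, (e i - e' i) * φ i t) m :=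
        integrable_finsetSum _ hlini
      calc ∑ i, e i * φ i t = ∫ e', ∑ i, (e i - e' i) * φ i t ∂m := by
            rw [integral_finsetSum _ hlini]
            refine Finset.sum_congr rfl fun i _ => ?_
            rw [integral_mul_const, integral_sub (integrable_const _)
              ((hcoord i).integrable (by norm_num)), hcoord0]
            simp
        _ ≤ ∫ e', supForm φ (e - e') ∂m :=
            integral_mono hlin hie fun e' => le_supForm hΦ (e - e') t
    have hvar := variance_nonneg (fun e' => supForm φ (e - e')) m
    rw [variance_eq_sub hme] at hvar
    simp only [Pi.pow_apply] at hvar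
    have := pow_le_pow_left₀ (hnn e) h1 2
    linarith
  have hsymm : ∫ e, supForm φ e ^ 2 ∂m ≤ ∫ q, supForm φ (q.1 - q.2) ^ 2 ∂(m.prod m) := by
    rw [integral_prod _ hint2]
    exact integral_mono hint hint2.integral_prod_left hjensen
  -- Exchanging the two copies outside `U` changes the sign of exactly those differences, so any
  -- sign pattern may be inserted without changing the integral.
  have hswap : ∀ U : Finset ι, ∫ q, supForm φ (q.1 - q.2) ^ 2 ∂(m.prod m) =
      ∫ q, (⨆ t, ∑ i, setSign U i * ((q.1 i - q.2 i) * φ i t)) ^ 2 ∂(m.prod m) := by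
    intro U
    have hp := measurePreserving_swapOn μ U
    have hc2 : Continuous fun q : (ι → ℝ) × (ι → ℝ) => supForm φ (q.1 - q.2) ^ 2 :=
      (hcont.comp (continuous_fst.sub continuous_snd)).pow 2
    conv_lhs => rw [← hp.map_eq]
    rw [integral_map hp.measurable.aemeasurable hc2.aestronglyMeasurable]
    congr 1
    ext q
    unfold supForm
    congr 1
    refine iSup_congr fun t => Finset.sum_congr rfl fun i _ => ?_
    by_cases hi : i ∈ U
    · simp [swapOn, setSign, hi]
    · simp [swapOn, setSign, hi]
      ring
  have hcard : (0 : ℝ) < 2 ^ Fintype.card ι := by positivity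
  have hsqi : ∀ i ∈ Finset.univ, Integrable (fun q : (ι → ℝ) × (ι → ℝ) =>
      (q.1 i - q.2 i) ^ 2 * ‖z i‖ ^ 2) (m.prod m) :=
    fun i _ => ((hcoordl i).sub (hcoordr i)).integrable_sq.mul_const _
  have hsqint : Integrable (fun q : (ι → ℝ) × (ι → ℝ) =>
      L ^ 2 * ρ ^ 2 * ∑ i, (q.1 i - q.2 i) ^ 2 * ‖z i‖ ^ 2) (m.prod m) :=
    (integrable_finsetSum _ hsqi).const_mul _
  have haverage : ∫ q, supForm φ (q.1 - q.2) ^ 2 ∂(m.prod m) ≤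
      ∫ q, L ^ 2 * ρ ^ 2 * ∑ i, (q.1 i - q.2 i) ^ 2 * ‖z i‖ ^ 2 ∂(m.prod m) := by
    have hUint : ∀ U : Finset ι, Integrable (fun q : (ι → ℝ) × (ι → ℝ) =>
        (⨆ t, ∑ i, setSign U i * ((q.1 i - q.2 i) * φ i t)) ^ 2) (m.prod m) := by
      intro U
      have := (measurePreserving_swapOn μ U).integrable_comp_of_integrable hint2
      refine this.congr (ae_of_all _ fun q => ?_)
      simp only [Function.comp, supForm]
      congr 1
      refine iSup_congr fun t => Finset.sum_congr rfl fun i _ => ?_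
      by_cases hi : i ∈ U
      · simp [swapOn, setSign, hi]
      · simp [swapOn, setSign, hi]
        ring
    -- The integral is the same for every sign pattern; summing over all patterns under the integral
    -- allows the contraction principle to be applied pointwise.
    have h1 : 2 ^ Fintype.card ι * ∫ q, supForm φ (q.1 - q.2) ^ 2 ∂(m.prod m) =
        ∫ q, ∑ U ∈ (Finset.univ : Finset ι).powerset,
          (⨆ t, ∑ i, setSign U i * ((q.1 i - q.2 i) * φ i t)) ^ 2 ∂(m.prod m) := by
      rw [integral_finsetSum _ fun U _ => hUint U,
        Finset.sum_congr rfl fun U _ => (hswap U).symm, Finset.sum_const, Finset.card_powerset,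
        Finset.card_univ, nsmul_eq_mul]
      push_cast
      rfl
    have h2 : ∫ q, ∑ U ∈ (Finset.univ : Finset ι).powerset,
          (⨆ t, ∑ i, setSign U i * ((q.1 i - q.2 i) * φ i t)) ^ 2 ∂(m.prod m) ≤
        ∫ q, 2 ^ Fintype.card ι * (L ^ 2 * ρ ^ 2 * ∑ i, (q.1 i - q.2 i) ^ 2 * ‖z i‖ ^ 2)
          ∂(m.prod m) := by
      refine integral_mono (integrable_finsetSum _ fun U _ => hUint U) (hsqint.const_mul _)
        fun q => ?_
      exact sum_sq_iSup_le_of_lipschitz Finset.univ z γ hL hγ o hγo hφo hφ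
        fun i => q.1 i - q.2 i
    rw [integral_const_mul] at h2
    rw [← h1] at h2
    exact le_of_mul_le_mul_left h2 hcard
  refine hsymm.trans (haverage.trans ?_)
  rw [integral_const_mul, integral_finsetSum _ hsqi]
  have hterm : ∀ i, ∫ q : (ι → ℝ) × (ι → ℝ), (q.1 i - q.2 i) ^ 2 * ‖z i‖ ^ 2 ∂(m.prod m) ≤
      2 * V * ‖z i‖ ^ 2 := by
    intro i
    rw [integral_mul_const]
    refine mul_le_mul_of_nonneg_right ?_ (sq_nonneg _)
    have hs1 : Integrable (fun q : (ι → ℝ) × (ι → ℝ) => q.1 i ^ 2) (m.prod m) :=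
      (hcoordl i).integrable_sq
    have hs2 : Integrable (fun q : (ι → ℝ) × (ι → ℝ) => q.2 i ^ 2) (m.prod m) :=
      (hcoordr i).integrable_sq
    have hs3 : Integrable (fun q : (ι → ℝ) × (ι → ℝ) => q.1 i * q.2 i) (m.prod m) :=
      (hcoordl i).integrable_mul (hcoordr i)
    have he : ∀ q : (ι → ℝ) × (ι → ℝ),
        (q.1 i - q.2 i) ^ 2 = q.1 i ^ 2 + q.2 i ^ 2 - 2 * (q.1 i * q.2 i) := fun q => by ring
    simp_rw [he]
    have hs12 : Integrable (fun q : (ι → ℝ) × (ι → ℝ) => q.1 i ^ 2 + q.2 i ^ 2) (m.prod m) :=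
      hs1.add hs2
    rw [integral_sub hs12 (hs3.const_mul 2), integral_add hs1 hs2,
      integral_const_mul]
    have e1 : ∫ q : (ι → ℝ) × (ι → ℝ), q.1 i ^ 2 ∂(m.prod m) = ∫ e, e i ^ 2 ∂m := by
      have := integral_fun_fst (μ := m) (ν := m) (fun e : ι → ℝ => e i ^ 2)
      simpa using this
    have e2 : ∫ q : (ι → ℝ) × (ι → ℝ), q.2 i ^ 2 ∂(m.prod m) = ∫ e, e i ^ 2 ∂m := by
      have := integral_fun_snd (μ := m) (ν := m) (fun e : ι → ℝ => e i ^ 2)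
      simpa using this
    have e3 : ∫ q : (ι → ℝ) × (ι → ℝ), q.1 i * q.2 i ∂(m.prod m) = 0 := by
      have := integral_prod_mul (μ := m) (ν := m) (fun e : ι → ℝ => e i) (fun e => e i)
      rw [this, hcoord0, zero_mul]
    rw [e1, e2, e3]
    have := hcoordsq i
    linarith
  have hLρ : 0 ≤ L ^ 2 * ρ ^ 2 := by positivity
  refine (mul_le_mul_of_nonneg_left (Finset.sum_le_sum fun i _ => hterm i) hLρ).trans
    (le_of_eq ?_)
  rw [← Finset.mul_sum]
  ring

end Symmetrization

/-! ### Second moments of weighted sums of errors, and Frobenius norms. -/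

section VectorSums

variable {Ω ι E : Type*} [MeasurableSpace Ω] {P : Measure Ω} [NormedAddCommGroup E]
  [InnerProductSpace ℝ E] {ξ : ι → Ω → ℝ}

lemma norm_sq_sum_smul (s : Finset ι) (x : ι → ℝ) (v : ι → E) :
    ‖∑ i ∈ s, x i • v i‖ ^ 2 = ∑ i ∈ s, ∑ j ∈ s, x i * x j * inner ℝ (v i) (v j) := by
  rw [← real_inner_self_eq_norm_sq, sum_inner]
  refine Finset.sum_congr rfl fun i _ => ?_
  rw [inner_sum]
  refine Finset.sum_congr rfl fun j _ => ?_
  rw [inner_smul_left, inner_smul_right]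
  simp
  ring

lemma integrable_norm_sq_sum_smul (h2 : ∀ i, MemLp (ξ i) 2 P) (s : Finset ι) (v : ι → E) :
    Integrable (fun ω => ‖∑ i ∈ s, ξ i ω • v i‖ ^ 2) P := by
  simp_rw [norm_sq_sum_smul]
  exact integrable_finsetSum _ fun i _ => integrable_finsetSum _ fun j _ =>
    ((h2 i).integrable_mul (h2 j)).mul_const _

lemma integral_norm_sq_sum_smul (h2 : ∀ i, MemLp (ξ i) 2 P) (h0 : ∀ i, ∫ ω, ξ i ω ∂P = 0)
    (hind : iIndepFun ξ P) (s : Finset ι) (v : ι → E) :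
    ∫ ω, ‖∑ i ∈ s, ξ i ω • v i‖ ^ 2 ∂P = ∑ i ∈ s, (∫ ω, ξ i ω ^ 2 ∂P) * ‖v i‖ ^ 2 := by
  classical
  simp_rw [norm_sq_sum_smul]
  have hij : ∀ i j, Integrable (fun ω => ξ i ω * ξ j ω * inner ℝ (v i) (v j)) P := fun i j =>
    ((h2 i).integrable_mul (h2 j)).mul_const _
  rw [integral_finsetSum _ fun i _ => integrable_finsetSum _ fun j _ => hij i j]
  refine Finset.sum_congr rfl fun i hi => ?_
  rw [integral_finsetSum _ fun j _ => hij i j, Finset.sum_eq_single_of_mem i hi]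
  · rw [integral_mul_const, real_inner_self_eq_norm_sq]
    simp_rw [← sq]
  · intro j _ hji
    rw [integral_mul_const, (hind.indepFun hji.symm).integral_fun_mul_eq_mul_integral
      (h2 i).aestronglyMeasurable (h2 j).aestronglyMeasurable, h0 i]
    simp

lemma integral_norm_sq_sum_smul_le (h2 : ∀ i, MemLp (ξ i) 2 P) (h0 : ∀ i, ∫ ω, ξ i ω ∂P = 0)
    (hind : iIndepFun ξ P) (s : Finset ι) (v : ι → E) {V : ℝ} {W : ι → ℝ}
    (hV : ∀ i, ∫ ω, ξ i ω ^ 2 ∂P ≤ V) (hV0 : 0 ≤ V) (hW : ∀ i ∈ s, ‖v i‖ ^ 2 ≤ W i) :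
    ∫ ω, ‖∑ i ∈ s, ξ i ω • v i‖ ^ 2 ∂P ≤ V * ∑ i ∈ s, W i := by
  rw [integral_norm_sq_sum_smul h2 h0 hind, Finset.mul_sum]
  exact Finset.sum_le_sum fun i hi => mul_le_mul (hV i) (hW i hi) (sq_nonneg _) hV0

/-- Chebyshev's inequality in terms of a bound on the second moment. -/
lemma measureReal_le_of_integral_sq_le [IsFiniteMeasure P] {X : Ω → ℝ}
    (hX : Integrable (fun ω => X ω ^ 2) P) {D τ : ℝ} (hτ : 0 < τ)
    (hD : ∫ ω, X ω ^ 2 ∂P ≤ D) : P.real {ω | τ < |X ω|} ≤ D / τ ^ 2 := by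
  have h := mul_meas_ge_le_integral_of_nonneg (μ := P) (ae_of_all _ fun ω => sq_nonneg (X ω)) hX
    (τ ^ 2)
  rw [le_div_iff₀ (by positivity), mul_comm]
  refine (mul_le_mul_of_nonneg_left (measureReal_mono fun ω hω => ?_) (by positivity)).trans
    (h.trans hD)
  have hω' : τ < |X ω| := hω
  change τ ^ 2 ≤ X ω ^ 2
  rw [← sq_abs (X ω)]
  exact pow_le_pow_left₀ hτ.le hω'.le 2

end VectorSums

section Outer

variable {κ : Type*} [Fintype κ]

/-- The outer product of two vectors, as a vector with the Frobenius norm. -/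
noncomputable def outer (a b : EuclideanSpace ℝ κ) : EuclideanSpace ℝ (κ × κ) :=
  WithLp.toLp 2 fun q => a q.1 * b q.2

lemma inner_outer (a b c d : EuclideanSpace ℝ κ) :
    inner ℝ (outer a b) (outer c d) = inner ℝ a c * inner ℝ b d := by
  simp only [outer, PiLp.inner_apply, Fintype.sum_prod_type, Finset.sum_mul_sum]
  refine Finset.sum_congr rfl fun i _ => Finset.sum_congr rfl fun j _ => ?_
  simp
  ring

lemma norm_outer (a b : EuclideanSpace ℝ κ) : ‖outer a b‖ = ‖a‖ * ‖b‖ := by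
  have h : ‖outer a b‖ ^ 2 = (‖a‖ * ‖b‖) ^ 2 := by
    rw [← real_inner_self_eq_norm_sq, inner_outer, real_inner_self_eq_norm_sq,
      real_inner_self_eq_norm_sq, mul_pow]
  exact (pow_left_inj₀ (norm_nonneg _) (by positivity) two_ne_zero).1 h

/-- The quadratic form is the Frobenius inner product of the matrix with `outer a b`. Through this a
random quadratic form is bounded uniformly in its arguments by a norm whose second moment is
explicit. -/
lemma abs_sum_mul_inner_mul_inner_le {ι : Type*} (s : Finset ι) (x : ι → ℝ)
    (z : ι → EuclideanSpace ℝ κ) (a b : EuclideanSpace ℝ κ) :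
    |∑ i ∈ s, x i * (inner ℝ (z i) a * inner ℝ (z i) b)| ≤
      ‖∑ i ∈ s, x i • outer (z i) (z i)‖ * (‖a‖ * ‖b‖) := by
  rw [← norm_outer]
  refine le_trans (le_of_eq ?_) (abs_real_inner_le_norm _ _)
  rw [sum_inner]
  congr 1
  refine Finset.sum_congr rfl fun i _ => ?_
  rw [inner_smul_left, inner_outer]
  rfl

end Outer

/-! ### Growth and mean value estimates on an interval. -/

lemma abs_sub_le_of_hasDerivAt_le {f f' : ℝ → ℝ} {x₀ x D : ℝ}
    (hf : ∀ s ∈ Set.uIcc x₀ x, HasDerivAt f (f' s) s) (hD : ∀ s ∈ Set.uIcc x₀ x, |f' s| ≤ D) :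
    |f x - f x₀| ≤ D * |x - x₀| :=
  (convex_uIcc x₀ x).norm_image_sub_le_of_norm_hasDerivWithin_le
    (fun s hs => (hf s hs).hasDerivWithinAt) hD Set.left_mem_uIcc Set.right_mem_uIcc

lemma abs_sub_le_of_mem_uIcc {x₀ x s : ℝ} (hs : s ∈ Set.uIcc x₀ x) : |s - x₀| ≤ |x - x₀| := by
  rcases Set.mem_uIcc.1 hs with h | h
  · rw [abs_of_nonneg (by linarith), abs_of_nonneg (by linarith)]; linarith
  · rw [abs_of_nonpos (by linarith), abs_of_nonpos (by linarith)]; linarith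

lemma abs_sub_le_of_mem_uIcc' {x₀ x s : ℝ} (hs : s ∈ Set.uIcc x₀ x) : |x - s| ≤ |x - x₀| := by
  rcases Set.mem_uIcc.1 hs with h | h
  · rw [abs_of_nonneg (by linarith), abs_of_nonneg (by linarith)]; linarith
  · rw [abs_of_nonpos (by linarith), abs_of_nonpos (by linarith)]; linarith

/-- A function that grows away from `x₀`, at least quadratically near `x₀`. -/
lemma le_of_hasDerivAt_of_growth {D g : ℝ → ℝ} {x₀ x κ δ : ℝ} (hδ : 0 ≤ δ) (hD0 : D x₀ = 0)
    (hD : ∀ s ∈ Set.uIcc x₀ x, HasDerivAt D (g s) s)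
    (h0 : ∀ s ∈ Set.uIcc x₀ x, 0 ≤ (s - x₀) * g s)
    (h1 : ∀ s ∈ Set.uIcc x₀ x, |s - x₀| ≤ δ → κ * (s - x₀) ^ 2 ≤ (s - x₀) * g s) :
    κ / 2 * min ((x - x₀) ^ 2) (δ ^ 2) ≤ D x := by
  wlog hx : x₀ ≤ x generalizing x₀ x D g
  · have hx : x ≤ x₀ := le_of_not_ge hx
    have := this (x₀ := -x₀) (x := -x) (D := fun s => D (-s)) (g := fun s => -g (-s))
      (by simpa using hD0) ?_ ?_ ?_ (by linarith)
    · have e : (-x - -x₀) ^ 2 = (x - x₀) ^ 2 := by ring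
      rw [e] at this
      simpa only [neg_neg] using this
    · intro s hs
      have hs' : -s ∈ Set.uIcc x₀ x := by
        rw [Set.uIcc_of_ge hx]
        rw [Set.uIcc_of_le (by linarith)] at hs
        exact ⟨by linarith [hs.2], by linarith [hs.1]⟩
      have h2 : HasDerivAt (fun s => D (-s)) (g (-s) * -1) s :=
        (hD _ hs').comp s (hasDerivAt_neg s)
      simpa using h2
    · intro s hs
      have hs' : -s ∈ Set.uIcc x₀ x := by
        rw [Set.uIcc_of_ge hx]
        rw [Set.uIcc_of_le (by linarith)] at hs
        exact ⟨by linarith [hs.2], by linarith [hs.1]⟩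
      have := h0 _ hs'
      nlinarith
    · intro s hs hsδ
      have hs' : -s ∈ Set.uIcc x₀ x := by
        rw [Set.uIcc_of_ge hx]
        rw [Set.uIcc_of_le (by linarith)] at hs
        exact ⟨by linarith [hs.2], by linarith [hs.1]⟩
      have := h1 _ hs' (by rwa [show -s - x₀ = -(s - -x₀) by ring, abs_neg])
      nlinarith
  rw [Set.uIcc_of_le hx] at hD h0 h1
  -- Up to `y` the function grows at least like `κ / 2 * (s - x₀) ^ 2`; from `y` to `x` it only has
  -- to be monotone.
  set y := min x (x₀ + δ) with hy
  have hyx : y ≤ x := min_le_left _ _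
  have hxy : x₀ ≤ y := le_min hx (by linarith)
  have hyδ : y ≤ x₀ + δ := min_le_right _ _
  have hgnn : ∀ s ∈ Set.Icc x₀ x, x₀ < s → 0 ≤ g s := fun s hs hlt =>
    nonneg_of_mul_nonneg_right (h0 s hs) (sub_pos.2 hlt)
  have hmono1 : MonotoneOn (fun s => D s - κ / 2 * (s - x₀) ^ 2) (Set.Icc x₀ y) := by
    have hder : ∀ s ∈ Set.Icc x₀ y, HasDerivAt (fun s => D s - κ / 2 * (s - x₀) ^ 2)
        (g s - κ * (s - x₀)) s := by
      intro s hs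
      have h2 := (((hasDerivAt_id' s).sub_const x₀).fun_pow 2).const_mul (κ / 2)
      have h3 := (hD s ⟨hs.1, hs.2.trans hyx⟩).fun_sub h2
      refine h3.congr_deriv ?_
      norm_num
      ring
    refine monotoneOn_of_deriv_nonneg (convex_Icc _ _)
      (fun s hs => (hder s hs).continuousAt.continuousWithinAt)
      (fun s hs => (hder s (interior_subset hs)).differentiableAt.differentiableWithinAt) ?_
    intro s hs
    rw [interior_Icc] at hs
    have hs' : s ∈ Set.Icc x₀ y := Set.Ioo_subset_Icc_self hs
    rw [(hder s hs').deriv]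
    have h4 := h1 s ⟨hs'.1, hs'.2.trans hyx⟩
      (by rw [abs_of_nonneg (by linarith [hs'.1])]; linarith [hs'.2])
    have h5 : 0 < s - x₀ := sub_pos.2 hs.1
    have h6 : 0 ≤ (s - x₀) * (g s - κ * (s - x₀)) := by nlinarith
    exact nonneg_of_mul_nonneg_right h6 h5
  have hmono2 : MonotoneOn D (Set.Icc y x) := by
    have hder : ∀ s ∈ Set.Icc y x, HasDerivAt D (g s) s := fun s hs => hD s ⟨hxy.trans hs.1, hs.2⟩
    refine monotoneOn_of_deriv_nonneg (convex_Icc _ _)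
      (fun s hs => (hder s hs).continuousAt.continuousWithinAt)
      (fun s hs => (hder s (interior_subset hs)).differentiableAt.differentiableWithinAt) ?_
    intro s hs
    rw [interior_Icc] at hs
    rw [(hder s (Set.Ioo_subset_Icc_self hs)).deriv]
    exact hgnn s ⟨hxy.trans hs.1.le, hs.2.le⟩ (lt_of_le_of_lt hxy hs.1)
  have h2 := hmono1 ⟨le_rfl, hxy⟩ ⟨hxy, le_rfl⟩ hxy
  have h3 := hmono2 ⟨le_rfl, hyx⟩ ⟨hyx, le_rfl⟩ hyx
  simp only [hD0, sub_self] at h2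
  have h4 : min ((x - x₀) ^ 2) (δ ^ 2) = (y - x₀) ^ 2 := by
    rcases le_total x (x₀ + δ) with h | h
    · rw [hy, min_eq_left h, min_eq_left]
      exact pow_le_pow_left₀ (by linarith) (by linarith) 2
    · rw [hy, min_eq_right h, min_eq_right]
      · ring
      · exact pow_le_pow_left₀ hδ (by linarith) 2
  rw [h4]
  linarith

/-! ### Local expansions of the link, weight and divergence functions. -/

namespace GLM

/-- The bounds on the functions of the model at the linear predictor `x`. -/
def BoundedAt (G : GLM) (C x : ℝ) : Prop :=
  |G.h x| ≤ C ∧ |deriv G.h x| ≤ C ∧ |deriv G.u x| ≤ C ∧ |iteratedDeriv 2 G.u x| ≤ C ∧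
    |iteratedDeriv 3 G.u x| ≤ C ∧ |G.w x| ≤ C ∧ |deriv G.w x| ≤ C

/-- The Kullback-Leibler divergence between the laws with linear predictors `x₀` and `x`, times the
dispersion. -/
noncomputable def divergence (G : GLM) (x₀ x : ℝ) : ℝ :=
  G.b (G.u x) - G.b (G.u x₀) - G.h x₀ * (G.u x - G.u x₀)

variable {G : GLM} (hu : ContDiff ℝ 3 G.u) (hw : ContDiff ℝ 1 G.w)

lemma deriv_deriv_b_pos (G : GLM) (x : ℝ) : 0 < deriv (deriv G.b) (G.u x) :=
  (pos_iff_pos_of_mul_pos (G.variance_pos x)).1 G.disp_pos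

include hu in
lemma hasDerivAt_u (x : ℝ) : HasDerivAt G.u (deriv G.u x) x :=
  (hu.differentiable (by norm_num)).differentiableAt.hasDerivAt

include hu in
lemma hasDerivAt_deriv_u (x : ℝ) : HasDerivAt (deriv G.u) (iteratedDeriv 2 G.u x) x := by
  have h := (hu.differentiable_iteratedDeriv 1 (by norm_num)).differentiableAt (x := x)
  rw [iteratedDeriv_one] at h
  rw [iteratedDeriv_succ, iteratedDeriv_one]
  exact h.hasDerivAt

include hu in
lemma hasDerivAt_iteratedDeriv_two_u (x : ℝ) :
    HasDerivAt (iteratedDeriv 2 G.u) (iteratedDeriv 3 G.u x) x := by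
  have h := (hu.differentiable_iteratedDeriv 2 (by norm_num)).differentiableAt (x := x)
  rw [iteratedDeriv_succ (n := 2)]
  exact h.hasDerivAt

include hw in
lemma hasDerivAt_w (x : ℝ) : HasDerivAt G.w (deriv G.w x) x :=
  (hw.differentiable (by norm_num)).differentiableAt.hasDerivAt

lemma h_eq (G : GLM) : G.h = fun x => deriv G.b (G.u x) := funext fun x => (G.mean_u x).symm

include hu in
lemma deriv_h_aux (x : ℝ) :
    HasDerivAt G.h (deriv (deriv G.b) (G.u x) * deriv G.u x) x := by
  rw [h_eq]
  exact (G.hasDerivAt_deriv_b (G.u_mem x)).comp x (hasDerivAt_u hu x)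

include hu in
lemma hasDerivAt_h (x : ℝ) : HasDerivAt G.h (deriv G.h x) x :=
  (deriv_h_aux hu x).differentiableAt.hasDerivAt

include hu in
lemma deriv_h_mul_deriv_u (x : ℝ) : deriv G.h x * deriv G.u x = G.disp * G.w x := by
  have h1 := (G.deriv_deriv_b_pos x).ne'
  have h2 := G.disp_pos.ne'
  rw [w, v, (deriv_h_aux hu x).deriv]
  field_simp

lemma w_nonneg (G : GLM) (x : ℝ) : 0 ≤ G.w x :=
  mul_nonneg (sq_nonneg _) (inv_nonneg.2 (G.variance_pos x).le)

include hu in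
lemma deriv_u_sq_mul_v (x : ℝ) : deriv G.u x ^ 2 * G.v x = G.disp ^ 2 * G.w x := by
  have h1 := (G.deriv_deriv_b_pos x).ne'
  have h2 := G.disp_pos.ne'
  rw [w, v, (deriv_h_aux hu x).deriv]
  field_simp

-- Since `h' = b''(u) u'` with `b'' > 0`, the signs of `h'` and `u'` agree at each point, and
-- monotonicity of `h` fixes the weak sign at all points together. This makes the divergence
-- monotone away from `x₀` also where `w` has no lower bound.
include hu in
lemma deriv_h_mul_deriv_u_nonneg (x y : ℝ) : 0 ≤ deriv G.h x * deriv G.u y := by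
  have hy := (deriv_h_aux hu y).deriv
  have hpos := G.deriv_deriv_b_pos y
  rcases G.h_strict with h | h
  · have h1 : 0 ≤ deriv G.h x := h.monotone.deriv_nonneg
    have h2 : 0 ≤ deriv G.h y := h.monotone.deriv_nonneg
    rw [hy] at h2
    exact mul_nonneg h1 (nonneg_of_mul_nonneg_right h2 hpos)
  · have h1 : deriv G.h x ≤ 0 := h.antitone.deriv_nonpos
    have h2 : deriv G.h y ≤ 0 := h.antitone.deriv_nonpos
    rw [hy] at h2
    exact mul_nonneg_of_nonpos_of_nonpos h1 (by nlinarith)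

include hu in
lemma hasDerivAt_divergence (x₀ x : ℝ) :
    HasDerivAt (G.divergence x₀) ((G.h x - G.h x₀) * deriv G.u x) x := by
  unfold divergence
  have h1 := (G.hasDerivAt_b (G.u_mem x)).comp x (hasDerivAt_u hu x)
  have h2 := ((hasDerivAt_u hu x).sub_const (G.u x₀)).const_mul (G.h x₀)
  have h3 := (h1.sub_const (G.b (G.u x₀))).fun_sub h2
  rw [G.mean_u x, ← sub_mul] at h3
  exact h3

lemma divergence_self (x : ℝ) : G.divergence x x = 0 := by simp [divergence]

section Local

variable {c C x₀ x : ℝ} (hc : 0 < c) (hC : 0 < C) (hwx : c ≤ G.w x₀)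
  (hB : ∀ s ∈ Set.uIcc x₀ x, G.BoundedAt C s)

include hw hB in
lemma abs_w_sub_le : |G.w x - G.w x₀| ≤ C * |x - x₀| :=
  abs_sub_le_of_hasDerivAt_le (fun s _ => hasDerivAt_w hw s) fun s hs => (hB s hs).2.2.2.2.2.2

include hu hB in
lemma abs_u_sub_le : |G.u x - G.u x₀| ≤ C * |x - x₀| :=
  abs_sub_le_of_hasDerivAt_le (fun s _ => hasDerivAt_u hu s) fun s hs => (hB s hs).2.2.1

include hu hB in
lemma abs_deriv_u_sub_le : |deriv G.u x - deriv G.u x₀| ≤ C * |x - x₀| :=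
  abs_sub_le_of_hasDerivAt_le (fun s _ => hasDerivAt_deriv_u hu s) fun s hs => (hB s hs).2.2.2.1

lemma bounded_sub_interval {s : ℝ} (hB : ∀ s ∈ Set.uIcc x₀ x, G.BoundedAt C s)
    (hs : s ∈ Set.uIcc x₀ x) : ∀ s' ∈ Set.uIcc x₀ s, G.BoundedAt C s' := fun s' hs' =>
  hB s' (Set.uIcc_subset_uIcc Set.left_mem_uIcc hs hs')

include hu hC hB in
lemma abs_deriv_u_taylor_le :
    |deriv G.u x - deriv G.u x₀ - iteratedDeriv 2 G.u x₀ * (x - x₀)| ≤ C * (x - x₀) ^ 2 := by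
  have h := abs_sub_le_of_hasDerivAt_le (x₀ := x₀) (x := x) (D := C * |x - x₀|)
    (f := fun s => deriv G.u s - iteratedDeriv 2 G.u x₀ * (s - x₀))
    (f' := fun s => iteratedDeriv 2 G.u s - iteratedDeriv 2 G.u x₀)
    (fun s _ => by
      have := (hasDerivAt_deriv_u hu s).fun_sub
        (((hasDerivAt_id' s).sub_const x₀).const_mul (iteratedDeriv 2 G.u x₀))
      simpa using this)
    (fun s hs => (abs_sub_le_of_hasDerivAt_le (fun s _ => hasDerivAt_iteratedDeriv_two_u hu s)
      fun s' hs' => (bounded_sub_interval hB hs s' hs').2.2.2.2.1).trans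
      (mul_le_mul_of_nonneg_left (abs_sub_le_of_mem_uIcc hs) hC.le))
  rw [mul_assoc, ← sq, sq_abs] at h
  refine le_trans (le_of_eq ?_) h
  congr 1
  ring

include hu hC hB in
lemma abs_u_taylor_le_cube :
    |G.u x - G.u x₀ - deriv G.u x₀ * (x - x₀) - iteratedDeriv 2 G.u x₀ / 2 * (x - x₀) ^ 2|
      ≤ C * |x - x₀| ^ 3 := by
  have h := abs_sub_le_of_hasDerivAt_le (x₀ := x₀) (x := x) (D := C * |x - x₀| ^ 2)
    (f := fun s => G.u s - deriv G.u x₀ * (s - x₀) - iteratedDeriv 2 G.u x₀ / 2 * (s - x₀) ^ 2)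
    (f' := fun s => deriv G.u s - deriv G.u x₀ - iteratedDeriv 2 G.u x₀ * (s - x₀))
    (fun s _ => by
      have := ((hasDerivAt_u hu s).fun_sub
        (((hasDerivAt_id' s).sub_const x₀).const_mul (deriv G.u x₀))).fun_sub
        ((((hasDerivAt_id' s).sub_const x₀).fun_pow 2).const_mul (iteratedDeriv 2 G.u x₀ / 2))
      refine this.congr_deriv ?_
      norm_num
      ring)
    (fun s hs => (abs_deriv_u_taylor_le hu hC (bounded_sub_interval hB hs)).trans
      (mul_le_mul_of_nonneg_left
        (by rw [← sq_abs]; exact pow_le_pow_left₀ (abs_nonneg _) (abs_sub_le_of_mem_uIcc hs) 2)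
        hC.le))
  rw [mul_assoc, ← pow_succ] at h
  refine le_trans (le_of_eq ?_) h
  congr 1
  simp
  ring

-- This weaker order is kept for the large errors: as a quadratic form in `β - β₀`, such a remainder
-- can be controlled by a matrix norm, which a cubic one cannot.
include hu hC hB in
lemma abs_u_taylor_le_sq :
    |G.u x - G.u x₀ - deriv G.u x₀ * (x - x₀) - iteratedDeriv 2 G.u x₀ / 2 * (x - x₀) ^ 2|
      ≤ 2 * C * (x - x₀) ^ 2 := by
  have h := abs_sub_le_of_hasDerivAt_le (x₀ := x₀) (x := x) (D := C * |x - x₀|)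
    (f := fun s => G.u s - deriv G.u x₀ * (s - x₀))
    (f' := fun s => deriv G.u s - deriv G.u x₀)
    (fun s _ => by
      have := (hasDerivAt_u hu s).fun_sub (((hasDerivAt_id' s).sub_const x₀).const_mul (deriv G.u x₀))
      simpa using this)
    (fun s hs => (abs_deriv_u_sub_le hu (bounded_sub_interval hB hs)).trans
      (mul_le_mul_of_nonneg_left (abs_sub_le_of_mem_uIcc hs) hC.le))
  rw [mul_assoc, ← sq, sq_abs] at h
  have h2 : |iteratedDeriv 2 G.u x₀ / 2 * (x - x₀) ^ 2| ≤ C * (x - x₀) ^ 2 := by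
    rw [abs_mul, abs_of_nonneg (sq_nonneg (x - x₀))]
    refine mul_le_mul_of_nonneg_right ?_ (sq_nonneg _)
    have := (hB x₀ Set.left_mem_uIcc).2.2.2.1
    rw [abs_div, abs_two]
    linarith
  have h3 : G.u x - G.u x₀ - deriv G.u x₀ * (x - x₀) - iteratedDeriv 2 G.u x₀ / 2 * (x - x₀) ^ 2 =
      (G.u x - deriv G.u x₀ * (x - x₀) - (G.u x₀ - deriv G.u x₀ * (x₀ - x₀))) -
        iteratedDeriv 2 G.u x₀ / 2 * (x - x₀) ^ 2 := by ring
  rw [h3]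
  refine (abs_sub _ _).trans ?_
  linarith

include hw hc hC hwx hB in
lemma half_le_w (hx : |x - x₀| ≤ c / (2 * C)) : c / 2 ≤ G.w x := by
  have h1 := abs_w_sub_le hw hB
  have h2 : C * |x - x₀| ≤ c / 2 := by
    have := mul_le_mul_of_nonneg_left hx hC.le
    rwa [show C * (c / (2 * C)) = c / 2 by field_simp] at this
  have := (abs_le.1 (h1.trans h2)).1
  linarith

-- The product `h' u' = disp * w` is at least `disp * c / 2` here, and each factor is at most `C`.
include hu hw hc hC hwx hB in
lemma le_abs_deriv_u (hx : |x - x₀| ≤ c / (2 * C)) :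
    c * G.disp / (2 * C) ≤ |deriv G.u x| ∧ c * G.disp / (2 * C) ≤ |deriv G.h x| := by
  have h1 := half_le_w hw hc hC hwx hB hx
  have h2 := deriv_h_mul_deriv_u hu x
  have h3 : c / 2 * G.disp ≤ |deriv G.h x| * |deriv G.u x| := by
    rw [← abs_mul, h2]
    refine le_trans ?_ (le_abs_self _)
    rw [mul_comm G.disp]
    exact mul_le_mul_of_nonneg_right h1 G.disp_pos.le
  have hb := hB x Set.right_mem_uIcc
  constructor
  · rw [div_le_iff₀ (by positivity)]
    nlinarith [mul_le_mul_of_nonneg_right hb.2.1 (abs_nonneg (deriv G.u x))]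
  · rw [div_le_iff₀ (by positivity)]
    nlinarith [mul_le_mul_of_nonneg_left hb.2.2.1 (abs_nonneg (deriv G.h x))]

include hu in
lemma exists_h_sub_eq (x₀ x : ℝ) :
    ∃ ξ ∈ Set.uIcc x₀ x, G.h x - G.h x₀ = deriv G.h ξ * (x - x₀) := by
  rcases lt_trichotomy x₀ x with h | h | h
  · obtain ⟨ξ, hξ, he⟩ := exists_deriv_eq_slope G.h h
      (fun s _ => (hasDerivAt_h hu s).continuousAt.continuousWithinAt)
      (fun s _ => (hasDerivAt_h hu s).differentiableAt.differentiableWithinAt)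
    refine ⟨ξ, Set.Icc_subset_uIcc (Set.Ioo_subset_Icc_self hξ), ?_⟩
    rw [he, div_mul_cancel₀ _ (sub_ne_zero.2 h.ne')]
  · exact ⟨x, by simp [h], by simp [h]⟩
  · obtain ⟨ξ, hξ, he⟩ := exists_deriv_eq_slope G.h h
      (fun s _ => (hasDerivAt_h hu s).continuousAt.continuousWithinAt)
      (fun s _ => (hasDerivAt_h hu s).differentiableAt.differentiableWithinAt)
    refine ⟨ξ, Set.Icc_subset_uIcc' (Set.Ioo_subset_Icc_self hξ), ?_⟩
    rw [he]
    have := sub_ne_zero.2 h.ne'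
    field_simp
    ring

include hu hw hc hC hwx hB in
/-- The divergence is quadratic near `x₀` and bounded away from zero elsewhere. -/
lemma le_divergence : (c * G.disp / (2 * C)) ^ 2 / 2 *
    min ((x - x₀) ^ 2) ((c / (2 * C)) ^ 2) ≤ G.divergence x₀ x := by
  have hq : 0 < c * G.disp / (2 * C) := by have := G.disp_pos; positivity
  refine le_of_hasDerivAt_of_growth (by positivity) (divergence_self _)
    (fun s _ => hasDerivAt_divergence hu x₀ s) (fun s hs => ?_) (fun s hs hsδ => ?_)
  · obtain ⟨ξ, hξ, he⟩ := exists_h_sub_eq hu x₀ s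
    rw [he, show (s - x₀) * (deriv G.h ξ * (s - x₀) * deriv G.u s)
      = (s - x₀) ^ 2 * (deriv G.h ξ * deriv G.u s) by ring]
    exact mul_nonneg (sq_nonneg _) (deriv_h_mul_deriv_u_nonneg hu ξ s)
  · obtain ⟨ξ, hξ, he⟩ := exists_h_sub_eq hu x₀ s
    rw [he, show (s - x₀) * (deriv G.h ξ * (s - x₀) * deriv G.u s)
      = (deriv G.h ξ * deriv G.u s) * (s - x₀) ^ 2 by ring]
    refine mul_le_mul_of_nonneg_right ?_ (sq_nonneg _)
    rw [← abs_of_nonneg (deriv_h_mul_deriv_u_nonneg hu ξ s), abs_mul, sq]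
    have hs1 := (le_abs_deriv_u hu hw hc hC hwx (bounded_sub_interval hB hs) hsδ).1
    have hs2 := (le_abs_deriv_u hu hw hc hC hwx
      (bounded_sub_interval (bounded_sub_interval hB hs) hξ)
      ((abs_sub_le_of_mem_uIcc hξ).trans hsδ)).2
    exact mul_le_mul hs2 hs1 hq.le (abs_nonneg _)

include hu hw hc hC hwx hB in
/-- The linearization error of the mean part of the score. -/
lemma abs_w_mul_sub_le (hx : |x - x₀| ≤ c / (2 * C)) :
    |G.w x * (x - x₀) - (G.h x - G.h x₀) * deriv G.u x / G.disp| ≤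
      (C + C * (C / (c * G.disp / (2 * C)))) * (x - x₀) ^ 2 := by
  obtain ⟨ξ, hξ, he⟩ := exists_h_sub_eq hu x₀ x
  have hd := G.disp_pos
  have hq : 0 < c * G.disp / (2 * C) := by positivity
  set q := c * G.disp / (2 * C) with hqdef
  have hξB := bounded_sub_interval hB hξ
  have h1 := (le_abs_deriv_u hu hw hc hC hwx hξB ((abs_sub_le_of_mem_uIcc hξ).trans hx)).1
  have hne : deriv G.u ξ ≠ 0 := fun h0 => by
    rw [h0, abs_zero] at h1
    linarith
  have h2 := deriv_h_mul_deriv_u hu ξ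
  have hξx : ∀ s ∈ Set.uIcc ξ x, G.BoundedAt C s := fun s hs =>
    hB s (Set.uIcc_subset_uIcc hξ Set.right_mem_uIcc hs)
  have h3 := abs_w_sub_le hw hξx
  have h4 := abs_deriv_u_sub_le hu hξx
  have h5 : |x - ξ| ≤ |x - x₀| := abs_sub_le_of_mem_uIcc' hξ
  -- Writing `h'(ξ) = disp * w(ξ) / u'(ξ)` reduces the error to increments of `w` and `u'`, so that
  -- no second derivative of `h` is needed.
  have h6 : G.w x * (x - x₀) - (G.h x - G.h x₀) * deriv G.u x / G.disp =
      ((G.w x - G.w ξ) - G.w ξ * ((deriv G.u x - deriv G.u ξ) / deriv G.u ξ)) * (x - x₀) := by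
    rw [he]
    have : deriv G.h ξ = G.disp * G.w ξ / deriv G.u ξ := by rw [← h2]; field_simp
    rw [this]
    field_simp
    ring
  rw [h6, abs_mul]
  have h7 : |(G.w x - G.w ξ) - G.w ξ * ((deriv G.u x - deriv G.u ξ) / deriv G.u ξ)| ≤
      (C + C * (C / q)) * |x - x₀| := by
    refine (abs_sub _ _).trans ?_
    rw [add_mul]
    refine add_le_add (h3.trans (mul_le_mul_of_nonneg_left h5 hC.le)) ?_
    rw [abs_mul, mul_assoc]
    refine mul_le_mul (hB ξ hξ).2.2.2.2.2.1 ?_ (abs_nonneg _) hC.le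
    rw [abs_div, div_mul_eq_mul_div]
    exact div_le_div₀ (by positivity) (h4.trans (mul_le_mul_of_nonneg_left h5 hC.le)) hq h1
  refine (mul_le_mul_of_nonneg_right h7 (abs_nonneg _)).trans (le_of_eq ?_)
  rw [mul_assoc, ← sq, sq_abs]

end Local

end GLM

/-! ### Deterministic analysis of one client. -/

/-- The quantitative conditions on the observations of one client that are used below. -/
structure ClientSetting (G : GLM) {ι : Type*} {p : ℕ} (s : Finset ι)
    (z : ι → EuclideanSpace ℝ (Fin p)) (β₀ : EuclideanSpace ℝ (Fin p))
    (B : Set (EuclideanSpace ℝ (Fin p))) (c C : ℝ) : Prop where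
  c_pos : 0 < c
  C_pos : 0 < C
  p_pos : 0 < p
  card_pos : 0 < s.card
  gram_lower : ∀ a, c * s.card * ‖a‖ ^ 2 ≤ ∑ i ∈ s, (inner ℝ (z i) a) ^ 2
  gram_upper : ∀ a, ∑ i ∈ s, (inner ℝ (z i) a) ^ 2 ≤ C * s.card * ‖a‖ ^ 2
  fourth : ∀ a b, ∑ i ∈ s, (inner ℝ (z i) a) ^ 2 * (inner ℝ (z i) b) ^ 2 ≤
    C * s.card * (‖a‖ ^ 2 * ‖b‖ ^ 2)
  norm_sq_le : ∀ i ∈ s, ‖z i‖ ^ 2 ≤ C * p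
  bdd : ∀ i ∈ s, ∀ β ∈ convexHull ℝ B, G.BoundedAt C (inner ℝ (z i) β)
  w_min : ∀ i ∈ s, c ≤ G.w (inner ℝ (z i) β₀)
  ball_sub : Metric.closedBall β₀ (c / √p) ⊆ B
  sub_ball : B ⊆ Metric.closedBall β₀ (C * √p)

namespace ClientSetting

variable {G : GLM} {ι : Type*} {p : ℕ} {s : Finset ι} {z : ι → EuclideanSpace ℝ (Fin p)}
  {β₀ β : EuclideanSpace ℝ (Fin p)} {B : Set (EuclideanSpace ℝ (Fin p))} {c C : ℝ}
  (hS : ClientSetting G s z β₀ B c C)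

include hS

lemma β₀_mem : β₀ ∈ B :=
  hS.ball_sub (Metric.mem_closedBall_self (div_nonneg hS.c_pos.le (Real.sqrt_nonneg _)))

lemma card_pos' : (0 : ℝ) < s.card := Nat.cast_pos.2 hS.card_pos

lemma sqrt_p_pos : 0 < √(p : ℝ) := Real.sqrt_pos.2 (Nat.cast_pos.2 hS.p_pos)

lemma boundedAt_uIcc {i : ι} (hi : i ∈ s) (hβ : β ∈ B) :
    ∀ x ∈ Set.uIcc (inner ℝ (z i) β₀ : ℝ) (inner ℝ (z i) β), G.BoundedAt C x := by
  intro x hx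
  have hconv : Convex ℝ ((innerSL ℝ (z i)) '' convexHull ℝ B) :=
    (convex_convexHull ℝ B).linear_image (innerSL ℝ (z i)).toLinearMap
  have hsub := hconv.ordConnected.uIcc_subset
    (Set.mem_image_of_mem _ (subset_convexHull ℝ B hS.β₀_mem))
    (Set.mem_image_of_mem _ (subset_convexHull ℝ B hβ))
  obtain ⟨b, hb, rfl⟩ := hsub hx
  exact hS.bdd i hi b hb

lemma abs_inner_le {i : ι} (hi : i ∈ s) (γ : EuclideanSpace ℝ (Fin p)) :
    |inner ℝ (z i) γ| ≤ √C * (√p * ‖γ‖) := by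
  refine (abs_real_inner_le_norm _ _).trans ?_
  rw [← mul_assoc, ← Real.sqrt_mul hS.C_pos.le]
  exact mul_le_mul_of_nonneg_right (Real.le_sqrt_of_sq_le (hS.norm_sq_le i hi)) (norm_nonneg _)

/-- Cauchy–Schwarz with the fourth-moment condition for two factors and the Gram bound for the
third. Bounding one factor through `‖z i‖` would instead lose `√p`. -/
lemma sum_abs_mul_abs_mul_abs_le (a b d : EuclideanSpace ℝ (Fin p)) :
    ∑ i ∈ s, |inner ℝ (z i) a| * |inner ℝ (z i) b| * |inner ℝ (z i) d| ≤
      C * s.card * (‖a‖ * ‖b‖ * ‖d‖) := by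
  have hN := hS.card_pos'
  have hC := hS.C_pos
  have h := Finset.sum_mul_sq_le_sq_mul_sq s (fun i => |inner ℝ (z i) a| * |inner ℝ (z i) b|)
    (fun i => |inner ℝ (z i) d|)
  simp only [mul_pow, sq_abs] at h
  have h2 := h.trans (mul_le_mul (hS.fourth a b) (hS.gram_upper d)
    (Finset.sum_nonneg fun i _ => sq_nonneg _) (by positivity))
  refine (le_abs_self _).trans (abs_le_of_sq_le_sq ?_ (by positivity))
  refine h2.trans (le_of_eq (by ring))

lemma sum_abs_mul_abs_le (a b : EuclideanSpace ℝ (Fin p)) :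
    ∑ i ∈ s, |inner ℝ (z i) a| * |inner ℝ (z i) b| ≤ C * s.card * (‖a‖ * ‖b‖) := by
  have hN := hS.card_pos'
  have hC := hS.C_pos
  have h := Finset.sum_mul_sq_le_sq_mul_sq s (fun i => |inner ℝ (z i) a|)
    (fun i => |inner ℝ (z i) b|)
  simp only [sq_abs] at h
  have h2 := h.trans (mul_le_mul (hS.gram_upper a) (hS.gram_upper b)
    (Finset.sum_nonneg fun i _ => sq_nonneg _) (by positivity))
  refine (le_abs_self _).trans (abs_le_of_sq_le_sq ?_ (by positivity))
  refine h2.trans (le_of_eq (by ring))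

/-- A Paley–Zygmund argument: truncating at `δ ^ 2` costs at most `x ^ 2 / (4 * δ ^ 2)` with `x` the
squared inner product. While `‖γ‖ ^ 2 ≤ 2 * c * δ ^ 2 / C`, the fourth moments keep this cost below
half of the Gram form. -/
lemma le_sum_min (γ : EuclideanSpace ℝ (Fin p)) {δ : ℝ} (hδ : 0 < δ) :
    c / 2 * s.card * min (‖γ‖ ^ 2) (2 * c * δ ^ 2 / C) ≤
      ∑ i ∈ s, min ((inner ℝ (z i) γ) ^ 2) (δ ^ 2) := by
  have hN := hS.card_pos'
  have hC := hS.C_pos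
  have hc := hS.c_pos
  have key : ∀ a : EuclideanSpace ℝ (Fin p), ‖a‖ ^ 2 ≤ 2 * c * δ ^ 2 / C →
      c / 2 * s.card * ‖a‖ ^ 2 ≤ ∑ i ∈ s, min ((inner ℝ (z i) a) ^ 2) (δ ^ 2) := by
    intro a ha
    have h1 : ∀ x : ℝ, x - x ^ 2 / (4 * δ ^ 2) ≤ min x (δ ^ 2) := by
      intro x
      refine le_min ?_ ?_
      · have : 0 ≤ x ^ 2 / (4 * δ ^ 2) := by positivity
        linarith
      · have : x - x ^ 2 / (4 * δ ^ 2) = δ ^ 2 - (x - 2 * δ ^ 2) ^ 2 / (4 * δ ^ 2) := by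
          field_simp
          ring
        rw [this]
        have : 0 ≤ (x - 2 * δ ^ 2) ^ 2 / (4 * δ ^ 2) := by positivity
        linarith
    refine le_trans ?_ (Finset.sum_le_sum fun i _ => h1 ((inner ℝ (z i) a) ^ 2))
    rw [Finset.sum_sub_distrib, ← Finset.sum_div]
    have h2 := hS.gram_lower a
    have h3 := hS.fourth a a
    have h4 : ∑ i ∈ s, ((inner ℝ (z i) a : ℝ) ^ 2) ^ 2 ≤ C * s.card * (‖a‖ ^ 2 * ‖a‖ ^ 2) := by
      simpa only [← sq] using h3
    have h5 : (∑ i ∈ s, ((inner ℝ (z i) a : ℝ) ^ 2) ^ 2) / (4 * δ ^ 2) ≤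
        c / 2 * s.card * ‖a‖ ^ 2 := by
      rw [div_le_iff₀ (by positivity)]
      refine h4.trans ?_
      rw [le_div_iff₀ hC] at ha
      have := mul_le_mul_of_nonneg_left ha (show 0 ≤ s.card * ‖a‖ ^ 2 by positivity)
      nlinarith
    linarith
  rcases le_total (‖γ‖ ^ 2) (2 * c * δ ^ 2 / C) with h | h
  · rw [min_eq_left h]
    exact key γ h
  · rw [min_eq_right h]
    have hR : 0 < 2 * c * δ ^ 2 / C := by positivity
    have hγ : 0 < ‖γ‖ ^ 2 := hR.trans_le h
    -- Beyond the critical radius `γ` is shrunk onto the sphere of that radius, which can only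
    -- decrease the truncated sum.
    set τ := √(2 * c * δ ^ 2 / C / ‖γ‖ ^ 2) with hτ
    have hτ2 : τ ^ 2 = 2 * c * δ ^ 2 / C / ‖γ‖ ^ 2 := Real.sq_sqrt (by positivity)
    have hτ1 : τ ^ 2 ≤ 1 := by rw [hτ2]; exact div_le_one_of_le₀ h hγ.le
    have hn : ‖τ • γ‖ ^ 2 = 2 * c * δ ^ 2 / C := by
      rw [norm_smul, mul_pow, Real.norm_eq_abs, sq_abs, hτ2, div_mul_cancel₀ _ hγ.ne']
    have := key (τ • γ) hn.le
    rw [hn] at this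
    refine this.trans (Finset.sum_le_sum fun i _ => min_le_min_right _ ?_)
    rw [inner_smul_right, mul_pow]
    exact mul_le_of_le_one_left (sq_nonneg _) hτ1

lemma le_sum_divergence (hu : ContDiff ℝ 3 G.u) (hw : ContDiff ℝ 1 G.w) (hβ : β ∈ B) :
    (c * G.disp / (2 * C)) ^ 2 / 2 * (c / 2) * s.card *
        min (‖β - β₀‖ ^ 2) (2 * c * (c / (2 * C)) ^ 2 / C) ≤
      ∑ i ∈ s, G.divergence (inner ℝ (z i) β₀) (inner ℝ (z i) β) := by
  have hC := hS.C_pos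
  have hc := hS.c_pos
  have h1 := hS.le_sum_min (β - β₀) (δ := c / (2 * C)) (by positivity)
  have h2 := mul_le_mul_of_nonneg_left h1
    (show 0 ≤ (c * G.disp / (2 * C)) ^ 2 / 2 by positivity)
  rw [Finset.mul_sum] at h2
  refine le_trans (le_of_eq (by ring)) (h2.trans (Finset.sum_le_sum fun i hi => ?_))
  rw [inner_sub_right]
  exact GLM.le_divergence hu hw hc hC (hS.w_min i hi) (hS.boundedAt_uIcc hi hβ)

/-- The truth is itself in `B`, so the log-likelihood ratio of `β` to `β₀` is nonnegative. Times the
dispersion it equals the noise sum minus the sum of divergences. -/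
lemma sum_divergence_le_of_isMaxOn {y : ι → ℝ}
    (hβ : IsMaxOn (fun β => ∑ i ∈ s, G.logDensity (y i) (inner ℝ (z i) β)) B β) :
    ∑ i ∈ s, G.divergence (inner ℝ (z i) β₀) (inner ℝ (z i) β) ≤
      ∑ i ∈ s, (y i - G.h (inner ℝ (z i) β₀)) *
        (G.u (inner ℝ (z i) β) - G.u (inner ℝ (z i) β₀)) := by
  have hd := G.disp_pos
  have h : ∑ i ∈ s, G.logDensity (y i) (inner ℝ (z i) β₀) ≤
      ∑ i ∈ s, G.logDensity (y i) (inner ℝ (z i) β) := hβ hS.β₀_mem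
  rw [← sub_nonneg, ← Finset.sum_sub_distrib] at h ⊢
  have h2 := mul_nonneg hd.le h
  rw [Finset.mul_sum] at h2
  refine h2.trans (le_of_eq (Finset.sum_congr rfl fun i _ => ?_))
  simp only [GLM.logDensity, GLM.divergence]
  field_simp
  ring

omit hS in
/-- The weighted sum of errors that drives a local estimator to first order. -/
lemma inner_sum_smul_smul (e x : ι → ℝ) (a : EuclideanSpace ℝ (Fin p)) :
    inner ℝ (∑ i ∈ s, e i • x i • z i) a = ∑ i ∈ s, e i * x i * inner ℝ (z i) a := by
  rw [sum_inner]
  refine Finset.sum_congr rfl fun i _ => ?_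
  rw [inner_smul_left, inner_smul_left]
  simp
  ring

/-- An estimate near the truth that is at least as likely as the truth has an error of the order of
the score. -/
lemma norm_le_of_local (hu : ContDiff ℝ 3 G.u) (hβ : β ∈ B) {e q : ι → ℝ} {κ M m η ε : ℝ}
    (hM : 0 ≤ M) (hm : 0 ≤ m)
    (hlik : κ * s.card * ‖β - β₀‖ ^ 2 ≤
      ∑ i ∈ s, e i * (G.u (inner ℝ (z i) β) - G.u (inner ℝ (z i) β₀)))
    (hε : ‖β - β₀‖ ≤ ε) (hq0 : ∀ i ∈ s, 0 ≤ m + q i) (hq : ∀ i ∈ s, |e i| ≤ M + (m + q i))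
    (hA : ‖∑ i ∈ s, e i • iteratedDeriv 2 G.u (inner ℝ (z i) β₀) • outer (z i) (z i)‖ ≤ η * s.card)
    (hQ : ‖∑ i ∈ s, q i • outer (z i) (z i)‖ ≤ η * s.card)
    (hη : η / 2 + 2 * C * (M * C * ε + m * C + η) ≤ κ / 2) :
    κ / 2 * s.card * ‖β - β₀‖ ≤ ‖∑ i ∈ s, e i • deriv G.u (inner ℝ (z i) β₀) • z i‖ := by
  have hN := hS.card_pos'
  have hC := hS.C_pos
  set γ := β - β₀ with hγ
  rcases eq_or_ne γ 0 with h0 | h0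
  · rw [h0]
    simp
  have hγpos : 0 < ‖γ‖ := norm_pos_iff.2 h0
  set t : ι → ℝ := fun i => inner ℝ (z i) γ with ht
  have htx : ∀ i, (inner ℝ (z i) β : ℝ) - inner ℝ (z i) β₀ = t i := fun i =>
    (inner_sub_right _ _ _).symm
  set x₀ : ι → ℝ := fun i => inner ℝ (z i) β₀
  -- The remainder of the second-order expansion of `u` is estimated both to cubic and to quadratic
  -- order in `t i`.
  set r : ι → ℝ := fun i => G.u (inner ℝ (z i) β) - G.u (x₀ i) - deriv G.u (x₀ i) * t i
    - iteratedDeriv 2 G.u (x₀ i) / 2 * t i ^ 2 with hr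
  have hr3 : ∀ i ∈ s, |r i| ≤ 2 * C * |t i| ^ 3 := fun i hi => by
    have := GLM.abs_u_taylor_le_cube hu hC (hS.boundedAt_uIcc hi hβ)
    rw [htx] at this
    have h3 : 0 ≤ C * |t i| ^ 3 := by positivity
    exact this.trans (by linarith)
  have hr2 : ∀ i ∈ s, |r i| ≤ 2 * C * t i ^ 2 := fun i hi => by
    have := GLM.abs_u_taylor_le_sq hu hC (hS.boundedAt_uIcc hi hβ)
    rwa [htx] at this
  have hsplit : ∑ i ∈ s, e i * (G.u (inner ℝ (z i) β) - G.u (x₀ i)) =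
      ∑ i ∈ s, e i * deriv G.u (x₀ i) * t i +
      (1 / 2) * ∑ i ∈ s, e i * iteratedDeriv 2 G.u (x₀ i) * (t i * t i) +
      ∑ i ∈ s, e i * r i := by
    rw [Finset.mul_sum, ← Finset.sum_add_distrib, ← Finset.sum_add_distrib]
    refine Finset.sum_congr rfl fun i _ => ?_
    rw [hr]
    ring
  have h1 : ∑ i ∈ s, e i * deriv G.u (x₀ i) * t i ≤
      ‖∑ i ∈ s, e i • deriv G.u (x₀ i) • z i‖ * ‖γ‖ := by
    rw [← inner_sum_smul_smul]
    exact real_inner_le_norm _ _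
  have h2 : ∑ i ∈ s, e i * iteratedDeriv 2 G.u (x₀ i) * (t i * t i) ≤
      η * s.card * (‖γ‖ * ‖γ‖) := by
    have := abs_sum_mul_inner_mul_inner_le s (fun i => e i * iteratedDeriv 2 G.u (x₀ i)) z γ γ
    simp only [mul_smul] at this
    exact (le_abs_self _).trans (this.trans (mul_le_mul_of_nonneg_right hA (by positivity)))
  have hcube : ∑ i ∈ s, |t i| ^ 3 ≤ C * s.card * (‖γ‖ * ‖γ‖ * ‖γ‖) := by
    refine le_trans (le_of_eq (Finset.sum_congr rfl fun i _ => ?_))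
      (hS.sum_abs_mul_abs_mul_abs_le γ γ γ)
    rw [ht]
    ring
  have h3 : ∑ i ∈ s, e i * r i ≤ 2 * C * (M * (C * s.card * (‖γ‖ * ‖γ‖ * ‖γ‖)) +
      (m * (C * s.card * ‖γ‖ ^ 2) + η * s.card * (‖γ‖ * ‖γ‖))) := by
    -- The part of `|e i|` up to `M` takes the cubic bound, small because `β` is within `ε` of the
    -- truth. The rest, with small mean part `m` and fluctuation `q i`, takes the quadratic bound.
    have hle : ∀ i ∈ s, e i * r i ≤
        2 * C * (M * |t i| ^ 3 + (m * t i ^ 2 + q i * (t i * t i))) := by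
      intro i hi
      refine (le_abs_self _).trans ?_
      rw [abs_mul]
      refine (mul_le_mul_of_nonneg_right (hq i hi) (abs_nonneg _)).trans ?_
      have e1 := mul_le_mul_of_nonneg_left (hr3 i hi) hM
      have e2 := mul_le_mul_of_nonneg_left (hr2 i hi) (hq0 i hi)
      linarith
    refine (Finset.sum_le_sum hle).trans ?_
    rw [← Finset.mul_sum, Finset.sum_add_distrib, Finset.sum_add_distrib, ← Finset.mul_sum,
      ← Finset.mul_sum]
    refine mul_le_mul_of_nonneg_left ?_ (by positivity)
    refine add_le_add (mul_le_mul_of_nonneg_left hcube hM)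
      (add_le_add (mul_le_mul_of_nonneg_left (hS.gram_upper γ) hm) ?_)
    exact (le_abs_self _).trans ((abs_sum_mul_inner_mul_inner_le s q z γ γ).trans
      (mul_le_mul_of_nonneg_right hQ (by positivity)))
  rw [hsplit] at hlik
  have h4 : M * (C * s.card * (‖γ‖ * ‖γ‖ * ‖γ‖)) ≤ M * (C * s.card * (‖γ‖ * ‖γ‖ * ε)) := by
    gcongr
  have h5 : κ * s.card * ‖γ‖ ^ 2 ≤ ‖∑ i ∈ s, e i • deriv G.u (x₀ i) • z i‖ * ‖γ‖ +
      (s.card * ‖γ‖ ^ 2) * (η / 2 + 2 * C * (M * C * ε + m * C + η)) := by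
    have := mul_le_mul_of_nonneg_left h4 (show 0 ≤ 2 * C by positivity)
    nlinarith
  have h6 := mul_le_mul_of_nonneg_left hη (show 0 ≤ s.card * ‖γ‖ ^ 2 by positivity)
  have h7 : (κ / 2 * s.card * ‖γ‖) * ‖γ‖ ≤
      ‖∑ i ∈ s, e i • deriv G.u (x₀ i) • z i‖ * ‖γ‖ := by nlinarith
  exact le_of_mul_le_mul_right h7 hγpos

/-- The score equation at an interior maximizer. -/
lemma score_eq_zero (hu : ContDiff ℝ 3 G.u) {y : ι → ℝ}
    (hβ : IsMaxOn (fun β => ∑ i ∈ s, G.logDensity (y i) (inner ℝ (z i) β)) B β)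
    (hγ : √p * ‖β - β₀‖ < c) (a : EuclideanSpace ℝ (Fin p)) :
    ∑ i ∈ s, (y i - G.h (inner ℝ (z i) β)) * deriv G.u (inner ℝ (z i) β) * inner ℝ (z i) a
      = 0 := by
  have hd := G.disp_pos
  -- `β` lies in the open ball of radius `c / √p`, which `B` contains, so the constrained maximum is
  -- a local maximum.
  have hnhds : B ∈ 𝓝 β := by
    have hmem : β ∈ Metric.ball β₀ (c / √p) := by
      rw [mem_ball_iff_norm, lt_div_iff₀ hS.sqrt_p_pos, mul_comm]
      exact hγ
    exact mem_of_superset (Metric.isOpen_ball.mem_nhds hmem)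
      (Metric.ball_subset_closedBall.trans hS.ball_sub)
  have hmax := hβ.isLocalMax hnhds
  have hline : IsLocalMax (fun τ : ℝ =>
      ∑ i ∈ s, G.logDensity (y i) (inner ℝ (z i) (β + τ • a))) 0 := by
    have hc : ContinuousAt (fun τ : ℝ => β + τ • a) 0 := by fun_prop
    have h := hc.tendsto
    simp only [zero_smul, add_zero] at h
    have := h.eventually hmax
    simpa [IsLocalMax, IsMaxFilter] using this
  have hder : HasDerivAt (fun τ : ℝ => ∑ i ∈ s, G.logDensity (y i) (inner ℝ (z i) (β + τ • a)))
      (∑ i ∈ s, (y i - G.h (inner ℝ (z i) β)) * deriv G.u (inner ℝ (z i) β) *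
        inner ℝ (z i) a / G.disp) 0 := by
    refine HasDerivAt.fun_sum fun i _ => ?_
    have hx : HasDerivAt (fun τ : ℝ => (inner ℝ (z i) (β + τ • a) : ℝ)) (inner ℝ (z i) a) 0 := by
      simp only [inner_add_right, inner_smul_right]
      simpa using ((hasDerivAt_id (0 : ℝ)).mul_const (inner ℝ (z i) a)).const_add
        (inner ℝ (z i) β)
    have hu0 : HasDerivAt (fun τ : ℝ => G.u (inner ℝ (z i) (β + τ • a)))
        (deriv G.u (inner ℝ (z i) β) * inner ℝ (z i) a) 0 := by
      refine HasDerivAt.comp (h₂ := G.u) 0 ?_ hx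
      simpa using GLM.hasDerivAt_u hu (inner ℝ (z i) β)
    have hb0 : HasDerivAt (fun τ : ℝ => G.b (G.u (inner ℝ (z i) (β + τ • a))))
        (G.h (inner ℝ (z i) β) * (deriv G.u (inner ℝ (z i) β) * inner ℝ (z i) a)) 0 := by
      refine HasDerivAt.comp (h₂ := G.b) 0 ?_ hu0
      have := G.hasDerivAt_b (G.u_mem (inner ℝ (z i) β))
      rw [G.mean_u] at this
      simpa using this
    have h := (((hu0.const_mul (y i)).fun_sub hb0).div_const G.disp).add_const
      (Real.log (G.c (y i) G.disp))
    refine h.congr_deriv ?_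
    ring
  have h0 := hline.hasDerivAt_eq_zero hder
  rw [← Finset.sum_div, div_eq_zero_iff] at h0
  exact h0.resolve_right hd.ne'

/-- The error of a client's linearized estimating equation. -/
lemma abs_linearization_le (hu : ContDiff ℝ 3 G.u) (hw : ContDiff ℝ 1 G.w) (hβ : β ∈ B)
    {e ξ : ι → ℝ} {m : ℝ} (hm : 0 ≤ m) (a : EuclideanSpace ℝ (Fin p))
    (hscore : ∑ i ∈ s, (e i + G.h (inner ℝ (z i) β₀) - G.h (inner ℝ (z i) β)) *
      deriv G.u (inner ℝ (z i) β) * inner ℝ (z i) a = 0)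
    (hγ : √C * (√p * ‖β - β₀‖) ≤ c / (2 * C)) (hξ : ∀ i ∈ s, |e i| ≤ m + ξ i) :
    |∑ i ∈ s, G.w (inner ℝ (z i) β) * inner ℝ (z i) (β - β₀) * inner ℝ (z i) a
        - G.disp⁻¹ * inner ℝ (∑ i ∈ s, e i • deriv G.u (inner ℝ (z i) β₀) • z i) a| ≤
      ((C + C * (C / (c * G.disp / (2 * C)))) + G.disp⁻¹ * C * m) *
          (C * s.card * (‖β - β₀‖ * ‖β - β₀‖ * ‖a‖)) +
        G.disp⁻¹ * (‖∑ i ∈ s, e i • (iteratedDeriv 2 G.u (inner ℝ (z i) β₀) * inner ℝ (z i) a) •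
          z i‖ * ‖β - β₀‖) +
        G.disp⁻¹ * C * (‖∑ i ∈ s, ξ i • |inner ℝ (z i) a| • outer (z i) (z i)‖ *
          (‖β - β₀‖ * ‖β - β₀‖)) := by
  have hC := hS.C_pos
  have hc := hS.c_pos
  have hd := G.disp_pos
  set γ := β - β₀ with hγdef
  set t : ι → ℝ := fun i => inner ℝ (z i) γ with ht
  have htx : ∀ i, (inner ℝ (z i) β : ℝ) - inner ℝ (z i) β₀ = t i := fun i =>
    (inner_sub_right _ _ _).symm
  set x₀ : ι → ℝ := fun i => inner ℝ (z i) β₀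
  set x : ι → ℝ := fun i => inner ℝ (z i) β
  set A : ι → ℝ := fun i => inner ℝ (z i) a
  set C' := C + C * (C / (c * G.disp / (2 * C))) with hC'
  have hlin : ∀ i ∈ s, |G.w (x i) * t i - (G.h (x i) - G.h (x₀ i)) * deriv G.u (x i) / G.disp| ≤
      C' * t i ^ 2 := by
    intro i hi
    have := GLM.abs_w_mul_sub_le hu hw hc hC (hS.w_min i hi) (hS.boundedAt_uIcc hi hβ)
      (by rw [htx]; exact (hS.abs_inner_le hi γ).trans hγ)
    rwa [htx] at this
  set ρ : ι → ℝ := fun i => deriv G.u (x i) - deriv G.u (x₀ i) -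
    iteratedDeriv 2 G.u (x₀ i) * t i with hρ
  have hρle : ∀ i ∈ s, |ρ i| ≤ C * t i ^ 2 := by
    intro i hi
    have := GLM.abs_deriv_u_taylor_le hu hC (hS.boundedAt_uIcc hi hβ)
    rwa [htx] at this
  have hid : ∑ i ∈ s, G.w (x i) * t i * A i
        - G.disp⁻¹ * inner ℝ (∑ i ∈ s, e i • deriv G.u (x₀ i) • z i) a =
      ∑ i ∈ s, (G.w (x i) * t i - (G.h (x i) - G.h (x₀ i)) * deriv G.u (x i) / G.disp) * A i +
      G.disp⁻¹ * ∑ i ∈ s, e i * (iteratedDeriv 2 G.u (x₀ i) * A i) * t i +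
      G.disp⁻¹ * ∑ i ∈ s, e i * ρ i * A i := by
    rw [inner_sum_smul_smul]
    have h0 : G.disp⁻¹ * ∑ i ∈ s, (e i + G.h (x₀ i) - G.h (x i)) * deriv G.u (x i) * A i = 0 := by
      rw [hscore, mul_zero]
    rw [← add_zero (∑ i ∈ s, G.w (x i) * t i * A i - _), ← h0]
    simp only [Finset.mul_sum]
    rw [← Finset.sum_sub_distrib, ← Finset.sum_add_distrib, ← Finset.sum_add_distrib,
      ← Finset.sum_add_distrib]
    refine Finset.sum_congr rfl fun i _ => ?_
    rw [hρ]
    ring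
  have hquad : ∑ i ∈ s, t i ^ 2 * |A i| ≤ C * s.card * (‖γ‖ * ‖γ‖ * ‖a‖) := by
    refine le_trans (le_of_eq (Finset.sum_congr rfl fun i _ => ?_))
      (hS.sum_abs_mul_abs_mul_abs_le γ γ a)
    rw [← abs_mul, ← sq, abs_sq]
  have hC'0 : 0 ≤ C' := by positivity
  have b1 : |∑ i ∈ s, (G.w (x i) * t i - (G.h (x i) - G.h (x₀ i)) * deriv G.u (x i) / G.disp)
      * A i| ≤ C' * (C * s.card * (‖γ‖ * ‖γ‖ * ‖a‖)) := by
    refine (Finset.abs_sum_le_sum_abs _ _).trans ?_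
    have h := mul_le_mul_of_nonneg_left hquad hC'0
    rw [Finset.mul_sum] at h
    refine le_trans (Finset.sum_le_sum fun i hi => ?_) h
    rw [abs_mul, ← mul_assoc]
    exact mul_le_mul_of_nonneg_right (hlin i hi) (abs_nonneg _)
  have b2 : |∑ i ∈ s, e i * (iteratedDeriv 2 G.u (x₀ i) * A i) * t i| ≤
      ‖∑ i ∈ s, e i • (iteratedDeriv 2 G.u (x₀ i) * A i) • z i‖ * ‖γ‖ := by
    rw [← inner_sum_smul_smul]
    exact abs_real_inner_le_norm _ _
  have b3 : |∑ i ∈ s, e i * ρ i * A i| ≤ C * (m * (C * s.card * (‖γ‖ * ‖γ‖ * ‖a‖)) +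
      ‖∑ i ∈ s, ξ i • |A i| • outer (z i) (z i)‖ * (‖γ‖ * ‖γ‖)) := by
    refine (Finset.abs_sum_le_sum_abs _ _).trans ?_
    have hle : ∀ i ∈ s, |e i * ρ i * A i| ≤
        C * (m * (t i ^ 2 * |A i|) + ξ i * |A i| * (t i * t i)) := by
      intro i hi
      rw [abs_mul, abs_mul]
      have e1 : |e i| * |ρ i| ≤ (m + ξ i) * (C * t i ^ 2) :=
        mul_le_mul (hξ i hi) (hρle i hi) (abs_nonneg _) ((abs_nonneg _).trans (hξ i hi))
      refine (mul_le_mul_of_nonneg_right e1 (abs_nonneg _)).trans (le_of_eq (by ring))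
    refine (Finset.sum_le_sum hle).trans ?_
    rw [← Finset.mul_sum, Finset.sum_add_distrib, ← Finset.mul_sum]
    refine mul_le_mul_of_nonneg_left (add_le_add (mul_le_mul_of_nonneg_left hquad hm) ?_) hC.le
    have := abs_sum_mul_inner_mul_inner_le s (fun i => ξ i * |A i|) z γ γ
    simp only [mul_smul] at this
    exact (le_abs_self _).trans this
  rw [hid]
  have hdi : 0 ≤ G.disp⁻¹ := inv_nonneg.2 hd.le
  refine (abs_add_le _ _).trans ?_
  have c1 := (abs_add_le (∑ i ∈ s, (G.w (x i) * t i -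
    (G.h (x i) - G.h (x₀ i)) * deriv G.u (x i) / G.disp) * A i)
    (G.disp⁻¹ * ∑ i ∈ s, e i * (iteratedDeriv 2 G.u (x₀ i) * A i) * t i))
  have c2 : |G.disp⁻¹ * ∑ i ∈ s, e i * (iteratedDeriv 2 G.u (x₀ i) * A i) * t i| ≤
      G.disp⁻¹ * (‖∑ i ∈ s, e i • (iteratedDeriv 2 G.u (x₀ i) * A i) • z i‖ * ‖γ‖) := by
    rw [abs_mul, abs_of_nonneg hdi]
    exact mul_le_mul_of_nonneg_left b2 hdi
  have c3 : |G.disp⁻¹ * ∑ i ∈ s, e i * ρ i * A i| ≤ G.disp⁻¹ *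
      (C * (m * (C * s.card * (‖γ‖ * ‖γ‖ * ‖a‖)) +
      ‖∑ i ∈ s, ξ i • |A i| • outer (z i) (z i)‖ * (‖γ‖ * ‖γ‖))) := by
    rw [abs_mul, abs_of_nonneg hdi]
    exact mul_le_mul_of_nonneg_left b3 hdi
  refine (add_le_add (c1.trans (add_le_add b1 c2)) c3).trans (le_of_eq ?_)
  ring

/-- The Fisher information is Lipschitz in the parameter. -/
lemma abs_sum_w_sub_le (hw : ContDiff ℝ 1 G.w) (hβ : β ∈ B) (a b : EuclideanSpace ℝ (Fin p)) :
    |∑ i ∈ s, (G.w (inner ℝ (z i) β) - G.w (inner ℝ (z i) β₀)) * inner ℝ (z i) a *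
      inner ℝ (z i) b| ≤ C * (C * s.card * (‖β - β₀‖ * ‖a‖ * ‖b‖)) := by
  refine (Finset.abs_sum_le_sum_abs _ _).trans ?_
  have h := mul_le_mul_of_nonneg_left (hS.sum_abs_mul_abs_mul_abs_le (β - β₀) a b) hS.C_pos.le
  rw [Finset.mul_sum] at h
  refine le_trans (Finset.sum_le_sum fun i hi => ?_) h
  rw [abs_mul, abs_mul, ← mul_assoc, ← mul_assoc]
  have := GLM.abs_w_sub_le hw (hS.boundedAt_uIcc hi hβ)
  rw [← inner_sub_right] at this
  gcongr

lemma abs_sum_w_mul_le (hβ : β ∈ B) (a b : EuclideanSpace ℝ (Fin p)) :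
    |∑ i ∈ s, G.w (inner ℝ (z i) β) * inner ℝ (z i) a * inner ℝ (z i) b| ≤
      C * (C * s.card * (‖a‖ * ‖b‖)) := by
  refine (Finset.abs_sum_le_sum_abs _ _).trans ?_
  have h := mul_le_mul_of_nonneg_left (hS.sum_abs_mul_abs_le a b) hS.C_pos.le
  rw [Finset.mul_sum] at h
  refine le_trans (Finset.sum_le_sum fun i hi => ?_) h
  rw [abs_mul, abs_mul, ← mul_assoc]
  have := (hS.boundedAt_uIcc hi hβ _ Set.right_mem_uIcc).2.2.2.2.2.1
  gcongr

/-- The Fisher information is nondegenerate near the truth. -/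
lemma le_sum_w_mul_sq (hw : ContDiff ℝ 1 G.w) (hβ : β ∈ B)
    (hγ : √C * (√p * ‖β - β₀‖) ≤ c / (2 * C)) (a : EuclideanSpace ℝ (Fin p)) :
    c / 2 * (c * s.card * ‖a‖ ^ 2) ≤ ∑ i ∈ s, G.w (inner ℝ (z i) β) * inner ℝ (z i) a ^ 2 := by
  have hc := hS.c_pos
  refine (mul_le_mul_of_nonneg_left (hS.gram_lower a) (by positivity)).trans ?_
  rw [Finset.mul_sum]
  refine Finset.sum_le_sum fun i hi => mul_le_mul_of_nonneg_right ?_ (sq_nonneg _)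
  refine GLM.half_le_w hw hc hS.C_pos (hS.w_min i hi) (hS.boundedAt_uIcc hi hβ) ?_
  rw [← inner_sub_right]
  exact (hS.abs_inner_le hi _).trans hγ

end ClientSetting

/-! ### Probability bounds for the noise and the bad event of one client. -/

/-- Independent centered square integrable errors with variances bounded by `V`. -/
structure IsNoise {Ω ι : Type*} [MeasurableSpace Ω] (P : Measure Ω) (e : ι → Ω → ℝ) (V : ℝ) :
    Prop where
  measurable : ∀ i, Measurable (e i)
  indep : iIndepFun e P
  memLp : ∀ i, MemLp (e i) 2 P
  integral_eq_zero : ∀ i, ∫ ω, e i ω ∂P = 0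
  integral_sq_le : ∀ i, ∫ ω, e i ω ^ 2 ∂P ≤ V

namespace IsNoise

variable {Ω ι : Type*} [MeasurableSpace Ω] {P : Measure Ω} [IsProbabilityMeasure P]
  {e : ι → Ω → ℝ} {V : ℝ} (he : IsNoise P e V)

include he

omit [IsProbabilityMeasure P] in
lemma memLp_comp {g : ℝ → ℝ} (hg : Measurable g) (hgle : ∀ x, |g x| ≤ |x|) (i : ι) :
    MemLp (fun ω => g (e i ω)) 2 P :=
  (he.memLp i).mono (hg.comp (he.measurable i)).aestronglyMeasurable
    (ae_of_all _ fun ω => hgle (e i ω))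

omit [IsProbabilityMeasure P] in
lemma integral_comp_sq_le {g : ℝ → ℝ} (hg : Measurable g) (hgle : ∀ x, |g x| ≤ |x|) (i : ι) :
    ∫ ω, g (e i ω) ^ 2 ∂P ≤ V :=
  (integral_mono (he.memLp_comp hg hgle i).integrable_sq (he.memLp i).integrable_sq
    fun ω => sq_le_sq.2 (hgle (e i ω))).trans (he.integral_sq_le i)

lemma centered {g : ℝ → ℝ} (hg : Measurable g) (hgle : ∀ x, |g x| ≤ |x|) :
    IsNoise P (fun i ω => g (e i ω) - ∫ ω', g (e i ω') ∂P) V := by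
  have hmem := he.memLp_comp hg hgle
  refine ⟨fun i => (hg.comp (he.measurable i)).sub_const _,
    he.indep.comp (fun i x => g x - ∫ ω', g (e i ω') ∂P) fun i => hg.sub_const _,
    fun i => (hmem i).sub (memLp_const _), fun i => ?_, fun i => ?_⟩
  · rw [integral_sub ((hmem i).integrable (by norm_num)) (integrable_const _)]
    simp
  · have h1 := variance_eq_sub (hmem i)
    rw [variance_eq_integral (hmem i).aestronglyMeasurable.aemeasurable] at h1
    rw [h1]
    have := he.integral_comp_sq_le hg hgle i
    simp only [Pi.pow_apply]
    have h2 := sq_nonneg (∫ ω', g (e i ω') ∂P)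
    linarith

omit [IsProbabilityMeasure P] in
lemma integral_norm_sq_le {E : Type*} [NormedAddCommGroup E] [InnerProductSpace ℝ E]
    (s : Finset ι) (v : ι → E) {W : ℝ} (hV : 0 ≤ V) (hW : ∀ i ∈ s, ‖v i‖ ^ 2 ≤ W) :
    ∫ ω, ‖∑ i ∈ s, e i ω • v i‖ ^ 2 ∂P ≤ V * (s.card * W) := by
  have := integral_norm_sq_sum_smul_le he.memLp he.integral_eq_zero he.indep s v
    (W := fun _ => W) he.integral_sq_le hV hW
  simpa using this

lemma measureReal_norm_le {E : Type*} [NormedAddCommGroup E] [InnerProductSpace ℝ E]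
    (s : Finset ι) (v : ι → E) {W τ : ℝ} (hV : 0 ≤ V) (hW : ∀ i ∈ s, ‖v i‖ ^ 2 ≤ W)
    (hτ : 0 < τ) :
    P.real {ω | τ < ‖∑ i ∈ s, e i ω • v i‖} ≤ V * (s.card * W) / τ ^ 2 := by
  have := measureReal_le_of_integral_sq_le (integrable_norm_sq_sum_smul he.memLp s v) hτ
    (he.integral_norm_sq_le s v hV hW)
  simpa only [abs_norm] using this

/-- The second moment of the supremum of the empirical process over the parameter set. -/
lemma integral_sq_supForm_le [Fintype ι] [DecidableEq ι] {T E : Type*} [Nonempty T]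
    [NormedAddCommGroup E] [InnerProductSpace ℝ E] {φ : ι → T → ℝ} (z : ι → E) (γ : T → E)
    {ρ L : ℝ} (hL : 0 ≤ L) (hγ : ∀ t, ‖γ t‖ ≤ ρ) (o : T) (hγo : γ o = 0) (hφo : ∀ i, φ i o = 0)
    (hφ : ∀ i s t, |φ i s - φ i t| ≤ L * |inner ℝ (z i) (γ s) - inner ℝ (z i) (γ t)|) :
    Integrable (fun ω => supForm φ (fun i => e i ω) ^ 2) P ∧
    ∫ ω, supForm φ (fun i => e i ω) ^ 2 ∂P ≤ 2 * L ^ 2 * ρ ^ 2 * V * ∑ i, ‖z i‖ ^ 2 := by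
  have hprob : ∀ i, IsProbabilityMeasure (P.map (e i)) := fun i =>
    Measure.isProbabilityMeasure_map (he.measurable i).aemeasurable
  have hmap := he.indep.map_fun_eq_pi_map fun i => (he.measurable i).aemeasurable
  have hm : Measurable fun ω i => e i ω := measurable_pi_iff.2 he.measurable
  obtain ⟨h1, h2⟩ := _root_.integral_sq_supForm_le (φ := φ) (fun i => P.map (e i)) (V := V)
    (fun i => (memLp_map_measure_iff (by fun_prop) (he.measurable i).aemeasurable).2 (he.memLp i))
    (fun i => by
      rw [integral_map (he.measurable i).aemeasurable (by fun_prop)]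
      exact he.integral_eq_zero i)
    (fun i => by
      rw [integral_map (he.measurable i).aemeasurable (by fun_prop)]
      exact he.integral_sq_le i) z γ hL hγ o hγo hφo hφ
  rw [← hmap] at h1 h2
  refine ⟨(integrable_map_measure h1.aestronglyMeasurable hm.aemeasurable).1 h1, ?_⟩
  rwa [integral_map hm.aemeasurable h1.aestronglyMeasurable] at h2

end IsNoise

lemma abs_max_sub_zero_le {M : ℝ} (hM : 0 ≤ M) (x : ℝ) : |max (|x| - M) 0| ≤ |x| := by
  rw [abs_of_nonneg (le_max_right _ _)]
  exact max_le (by linarith) (abs_nonneg _)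

set_option maxHeartbeats 1000000 in
/-- Outside an event of probability `O(p² / n_k)`, the maximizer of the likelihood of a client is
close to the truth, with an error of the order of the score. -/
theorem exists_bad_event (G : GLM) (hu : ContDiff ℝ 3 G.u) (hw : ContDiff ℝ 1 G.w) {c C : ℝ}
    (hc : 0 < c) (hC : 0 < C) :
    ∃ D > 0, ∀ τ > 0, ∃ D' ≥ 0, ∀ {Ω : Type*} [MeasurableSpace Ω] (P : Measure Ω)
      [IsProbabilityMeasure P] {ι : Type*} [Fintype ι] {p : ℕ} {s : Finset ι}
      {z : ι → EuclideanSpace ℝ (Fin p)} {β₀ : EuclideanSpace ℝ (Fin p)}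
      {B : Set (EuclideanSpace ℝ (Fin p))} {e : ι → Ω → ℝ},
      ClientSetting G s z β₀ B c C → IsNoise P e C →
      ∃ bad : Set Ω, P.real bad ≤ D' * ((p : ℝ) ^ 2 / s.card) ∧
        ∀ ω ∉ bad, ∀ β ∈ B, IsMaxOn (fun β => ∑ i ∈ s,
            G.logDensity (e i ω + G.h (inner ℝ (z i) β₀)) (inner ℝ (z i) β)) B β →
          ‖β - β₀‖ ≤ D * (‖∑ i ∈ s, e i ω • deriv G.u (inner ℝ (z i) β₀) • z i‖ / s.card) ∧
          √p * ‖β - β₀‖ ≤ τ := by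
  classical
  have hd := G.disp_pos
  set κ := (c * G.disp / (2 * C)) ^ 2 / 2 * (c / 2) with hκ
  have hκpos : 0 < κ := by positivity
  set R := 2 * c * (c / (2 * C)) ^ 2 / C with hR
  have hRpos : 0 < R := by positivity
  -- The constants make the contributions of `m`, `η` and `ε` in `hbudget` at most `κ / 8` each. `M`
  -- is chosen so that the mean excess of an error over `M`, at most `C / (4 * M)`, is at most `m`;
  -- the second bound in `ε` keeps `ε ^ 2 ≤ R`.
  set m := κ / (16 * C ^ 2) with hm
  have hmpos : 0 < m := by positivity
  set M := C / (4 * m) with hM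
  have hMpos : 0 < M := by positivity
  set η := κ / (8 * (1 / 2 + 2 * C)) with hη
  have hηpos : 0 < η := by positivity
  set ε := min (κ / (16 * C ^ 2 * M)) (√R) with hε
  have hεpos : 0 < ε := lt_min (by positivity) (Real.sqrt_pos.2 hRpos)
  have hεR : ε ^ 2 ≤ R := by
    have := pow_le_pow_left₀ hεpos.le (min_le_right (κ / (16 * C ^ 2 * M)) (√R)) 2
    rwa [Real.sq_sqrt hRpos.le] at this
  have hbudget : η / 2 + 2 * C * (M * C * ε + m * C + η) ≤ κ / 2 := by
    have h1 : 2 * C ^ 2 * M * ε ≤ κ / 8 := by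
      have := mul_le_mul_of_nonneg_left (min_le_left (κ / (16 * C ^ 2 * M)) (√R))
        (show 0 ≤ 2 * C ^ 2 * M by positivity)
      refine this.trans (le_of_eq ?_)
      field_simp
      norm_num
    have h2 : 2 * C ^ 2 * m = κ / 8 := by rw [hm]; field_simp; norm_num
    have h3 : η * (1 / 2 + 2 * C) = κ / 8 := by rw [hη]; field_simp
    nlinarith
  refine ⟨2 / κ, by positivity, fun τ hτ => ?_⟩
  -- One Chebyshev constant for each of four events: a large empirical process, a large matrix of
  -- second derivatives, a large fluctuation of the excesses, a large score. Each has probability of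
  -- order `p ^ 2 / s.card`.
  set D' := 2 * C ^ 2 * C ^ 2 * C * C / (κ / 2 * ε ^ 2) ^ 2 + C * (C ^ 2 * C ^ 2) / η ^ 2 +
    C * C ^ 2 / η ^ 2 + C * (C ^ 2 * C) / (κ / 2 * τ) ^ 2 with hD'
  refine ⟨D', by positivity, ?_⟩
  intro Ω _ P _ ι _ p s z β₀ B e hS he
  have hN := hS.card_pos'
  have hp : (0 : ℝ) < p := Nat.cast_pos.2 hS.p_pos
  have hsp := hS.sqrt_p_pos
  have hCp : 0 ≤ C * p := by positivity
  set N : ℝ := (s.card : ℝ) with hNdef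
  set x₀ : ι → ℝ := fun i => inner ℝ (z i) β₀ with hx₀
  have hB0 : ∀ i ∈ s, G.BoundedAt C (x₀ i) := fun i hi =>
    hS.bdd i hi β₀ (subset_convexHull ℝ B hS.β₀_mem)
  -- the empirical process
  have : Nonempty B := ⟨⟨β₀, hS.β₀_mem⟩⟩
  -- The symmetrization bound runs over the whole index type, so both the functions and the
  -- covariates are set to zero outside `s`.
  set φ : ι → B → ℝ := fun i t => if i ∈ s then G.u (inner ℝ (z i) t) - G.u (x₀ i) else 0 with hφ
  obtain ⟨hZi, hZ⟩ := he.integral_sq_supForm_le (φ := φ) (T := B)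
    (fun i => if i ∈ s then z i else 0) (fun t => (t : EuclideanSpace ℝ (Fin p)) - β₀)
    (ρ := C * √p) (L := C) hC.le (fun t => mem_closedBall_iff_norm.1 (hS.sub_ball t.2))
    ⟨β₀, hS.β₀_mem⟩ (sub_self _) (fun i => by simp [hφ, hx₀]) (fun i b t => by
      by_cases hi : i ∈ s
      · simp only [hφ, hi, if_true]
        rw [sub_sub_sub_cancel_right, ← inner_sub_right, sub_sub_sub_cancel_right, inner_sub_right]
        have hconv : Convex ℝ ((innerSL ℝ (z i)) '' convexHull ℝ B) :=
          (convex_convexHull ℝ B).linear_image (innerSL ℝ (z i)).toLinearMap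
        have hsub := hconv.ordConnected.uIcc_subset
          (Set.mem_image_of_mem _ (subset_convexHull ℝ B t.2))
          (Set.mem_image_of_mem _ (subset_convexHull ℝ B b.2))
        refine GLM.abs_u_sub_le hu fun x hx => ?_
        obtain ⟨b', hb', rfl⟩ := hsub hx
        exact hS.bdd i hi b' hb'
      · simp [hφ, hi])
  have hφΦ : ∃ Φ : ι → ℝ, ∀ i t, |φ i t| ≤ Φ i := by
    refine ⟨fun i => C * (√C * (√p * (C * √p))), fun i t => ?_⟩
    by_cases hi : i ∈ s
    · simp only [hφ, hi, if_true]
      refine (GLM.abs_u_sub_le hu (hS.boundedAt_uIcc hi t.2)).trans ?_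
      rw [← inner_sub_right]
      refine mul_le_mul_of_nonneg_left ((hS.abs_inner_le hi _).trans ?_) hC.le
      have := mem_closedBall_iff_norm.1 (hS.sub_ball t.2)
      gcongr
    · simp only [hφ, hi, if_false, abs_zero]
      positivity
  obtain ⟨Φ, hΦ⟩ := hφΦ
  have hZ' : ∫ ω, supForm φ (fun i => e i ω) ^ 2 ∂P ≤
      2 * C ^ 2 * (C * √p) ^ 2 * C * (N * (C * p)) := by
    refine hZ.trans (mul_le_mul_of_nonneg_left ?_ (by positivity))
    have h1 : ∑ i, ‖(if i ∈ s then z i else 0)‖ ^ 2 = ∑ i ∈ s, ‖z i‖ ^ 2 := by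
      rw [← Finset.sum_filter_add_sum_filter_not Finset.univ (· ∈ s)]
      have e1 : ∑ i ∈ Finset.univ.filter (· ∉ s), ‖(if i ∈ s then z i else 0)‖ ^ 2 = 0 :=
        Finset.sum_eq_zero fun i hi => by simp [(Finset.mem_filter.1 hi).2]
      rw [e1, add_zero, Finset.filter_mem_eq_inter, Finset.univ_inter]
      exact Finset.sum_congr rfl fun i hi => by simp [hi]
    rw [h1]
    refine (Finset.sum_le_sum hS.norm_sq_le).trans (le_of_eq ?_)
    simp [hNdef]
  have hbad1 := measureReal_le_of_integral_sq_le hZi (τ := κ / 2 * N * ε ^ 2) (by positivity) hZ'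
  -- the matrix of second derivatives
  have hbad2 := he.measureReal_norm_le s
    (fun i => iteratedDeriv 2 G.u (x₀ i) • outer (z i) (z i)) (W := C ^ 2 * (C * p) ^ 2)
    (τ := η * N) hC.le (fun i hi => by
      rw [norm_smul, norm_outer, ← sq, mul_pow, Real.norm_eq_abs]
      have h1 := pow_le_pow_left₀ (abs_nonneg _) (hB0 i hi).2.2.2.1 2
      have h2 := pow_le_pow_left₀ (sq_nonneg _) (hS.norm_sq_le i hi) 2
      exact mul_le_mul h1 h2 (by positivity) (by positivity)) (by positivity)
  -- the excesses of the errors over `M`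
  set g : ℝ → ℝ := fun x => max (|x| - M) 0 with hg
  have hgm : Measurable g := by fun_prop
  have hgle : ∀ x, |g x| ≤ |x| := abs_max_sub_zero_le hMpos.le
  set q : ι → Ω → ℝ := fun i ω => g (e i ω) - ∫ ω', g (e i ω') ∂P with hq
  have hqn : IsNoise P q C := he.centered hgm hgle
  have hbad3 := hqn.measureReal_norm_le s (fun i => outer (z i) (z i)) (W := (C * p) ^ 2)
    (τ := η * N) hC.le (fun i hi => by
      rw [norm_outer, ← sq]
      exact pow_le_pow_left₀ (sq_nonneg _) (hS.norm_sq_le i hi) 2) (by positivity)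
  have hgmean : ∀ i, ∫ ω, g (e i ω) ∂P ≤ m := by
    intro i
    have hle : ∀ x : ℝ, g x ≤ x ^ 2 / (4 * M) := by
      intro x
      refine max_le ?_ (by positivity)
      rw [le_div_iff₀ (by positivity), ← sq_abs]
      nlinarith [sq_nonneg (|x| - 2 * M)]
    calc ∫ ω, g (e i ω) ∂P ≤ ∫ ω, e i ω ^ 2 / (4 * M) ∂P :=
          integral_mono ((he.memLp_comp hgm hgle i).integrable (by norm_num))
            ((he.memLp i).integrable_sq.div_const _) fun ω => hle _
      _ ≤ C / (4 * M) := by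
          rw [integral_div]
          exact div_le_div_of_nonneg_right (he.integral_sq_le i) (by positivity)
      _ = m := by rw [hM]; field_simp
  -- the score
  have hbad4 := he.measureReal_norm_le s (fun i => deriv G.u (x₀ i) • z i) (W := C ^ 2 * (C * p))
    (τ := κ / 2 * N * (τ / √p)) hC.le (fun i hi => by
      rw [norm_smul, mul_pow, Real.norm_eq_abs]
      have h1 := pow_le_pow_left₀ (abs_nonneg _) (hB0 i hi).2.2.1 2
      exact mul_le_mul h1 (hS.norm_sq_le i hi) (by positivity) (by positivity)) (by positivity)
  refine ⟨{ω | κ / 2 * N * ε ^ 2 < |supForm φ (fun i => e i ω)|} ∪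
    {ω | η * N < ‖∑ i ∈ s, e i ω • iteratedDeriv 2 G.u (x₀ i) • outer (z i) (z i)‖} ∪
    {ω | η * N < ‖∑ i ∈ s, q i ω • outer (z i) (z i)‖} ∪
    {ω | κ / 2 * N * (τ / √p) < ‖∑ i ∈ s, e i ω • deriv G.u (x₀ i) • z i‖}, ?_, ?_⟩
  · have hsq : √(p : ℝ) ^ 2 = p := Real.sq_sqrt hp.le
    refine (measureReal_union_le _ _).trans ((add_le_add ((measureReal_union_le _ _).trans
      (add_le_add ((measureReal_union_le _ _).trans (add_le_add hbad1 hbad2)) hbad3))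
      hbad4).trans (le_of_eq ?_))
    have e1 : 2 * C ^ 2 * (C * √p) ^ 2 * C * (N * (C * p)) / (κ / 2 * N * ε ^ 2) ^ 2 =
        2 * C ^ 2 * C ^ 2 * C * C / (κ / 2 * ε ^ 2) ^ 2 * ((p : ℝ) ^ 2 / N) := by
      rw [mul_pow C (√(p : ℝ)), hsq]
      field_simp
    have e2 : C * (N * (C ^ 2 * (C * p) ^ 2)) / (η * N) ^ 2 =
        C * (C ^ 2 * C ^ 2) / η ^ 2 * ((p : ℝ) ^ 2 / N) := by
      field_simp
    have e3 : C * (N * ((C * p) ^ 2)) / (η * N) ^ 2 = C * C ^ 2 / η ^ 2 * ((p : ℝ) ^ 2 / N) := by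
      field_simp
    have e4 : C * (N * (C ^ 2 * (C * p))) / (κ / 2 * N * (τ / √p)) ^ 2 =
        C * (C ^ 2 * C) / (κ / 2 * τ) ^ 2 * ((p : ℝ) ^ 2 / N) := by
      rw [mul_pow _ (τ / √(p : ℝ)), div_pow, hsq]
      field_simp
    rw [e1, e2, e3, e4, hD']
    ring
  · intro ω hω β hβ hmax
    simp only [Set.mem_union, not_or, Set.mem_ofPred_eq, not_lt] at hω
    obtain ⟨⟨⟨h1, h2⟩, h3⟩, h4⟩ := hω
    have hlik := (hS.le_sum_divergence hu hw hβ).trans (hS.sum_divergence_le_of_isMaxOn hmax)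
    simp only [add_sub_cancel_right] at hlik
    have hsup : ∑ i ∈ s, e i ω * (G.u (inner ℝ (z i) β) - G.u (x₀ i)) ≤ κ / 2 * N * ε ^ 2 := by
      refine le_trans (le_of_eq ?_) ((le_supForm hΦ (fun i => e i ω) ⟨β, hβ⟩).trans
        ((le_abs_self _).trans h1))
      rw [← Finset.sum_filter_add_sum_filter_not Finset.univ (· ∈ s)]
      have e1 : ∑ i ∈ Finset.univ.filter (· ∉ s), e i ω * φ i ⟨β, hβ⟩ = 0 :=
        Finset.sum_eq_zero fun i hi => by simp [hφ, (Finset.mem_filter.1 hi).2]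
      rw [e1, add_zero, Finset.filter_mem_eq_inter, Finset.univ_inter]
      exact Finset.sum_congr rfl fun i hi => by simp [hφ, hi]
    -- The divergence grows at rate `κ` but the noise is at most half of `κ * N * ε ^ 2`. As `ε ^ 2
    -- ≤ R`, the minimum can then only be the squared distance, which localizes `β`.
    have hmin : min (‖β - β₀‖ ^ 2) R < ε ^ 2 := by
      have hle : κ * N * min (‖β - β₀‖ ^ 2) R ≤ κ / 2 * N * ε ^ 2 := hlik.trans hsup
      by_contra! hcon
      have := mul_le_mul_of_nonneg_left hcon (show 0 ≤ κ * N by positivity)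
      have h5 : 0 < κ * N * ε ^ 2 := by positivity
      nlinarith
    have hγε2 : ‖β - β₀‖ ^ 2 < ε ^ 2 := by
      rcases min_lt_iff.1 hmin with h | h
      · exact h
      · exact absurd h (not_lt.2 hεR)
    have hγε : ‖β - β₀‖ ≤ ε := (abs_lt_of_sq_lt_sq hγε2 hεpos.le).le.trans' (le_abs_self _)
    have hlik2 : κ * N * ‖β - β₀‖ ^ 2 ≤
        ∑ i ∈ s, e i ω * (G.u (inner ℝ (z i) β) - G.u (x₀ i)) := by
      rwa [min_eq_left (hγε2.le.trans hεR)] at hlik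
    have hloc := hS.norm_le_of_local hu hβ (e := fun i => e i ω) (q := fun i => q i ω)
      (κ := κ) (M := M) (m := m) (η := η) (ε := ε) hMpos.le hmpos.le hlik2 hγε
      (fun i _ => by
        have h5 := hgmean i
        have h6 : 0 ≤ g (e i ω) := le_max_right _ _
        simp only [hq]
        linarith)
      (fun i _ => by
        have h5 := hgmean i
        have h6 : |e i ω| - M ≤ g (e i ω) := le_max_left _ _
        simp only [hq]
        linarith) h2 h3 hbudget
    have hle : ‖β - β₀‖ ≤ 2 / κ * (‖∑ i ∈ s, e i ω • deriv G.u (x₀ i) • z i‖ / N) := by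
      rw [div_mul_div_comm, le_div_iff₀ (by positivity)]
      linarith
    refine ⟨hle, ?_⟩
    have h5 : κ / 2 * N * ‖β - β₀‖ ≤ κ / 2 * N * (τ / √p) := hloc.trans h4
    have h6 := le_of_mul_le_mul_left h5 (by positivity)
    rw [le_div_iff₀ hsp] at h6
    linarith

/-! ### Uniform constants and existence of local estimators. -/

namespace DistModel

variable {G : GLM} {Ω : ℕ → Type*} [∀ n, MeasurableSpace (Ω n)] {P : ∀ n, Measure (Ω n)}

/-- The deviations of the responses from their means. -/
noncomputable def error (M : DistModel G P) (n : ℕ) (i : Fin n) (ω : Ω n) : ℝ :=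
  M.y n i ω - G.h (inner ℝ (M.z n i) (M.β₀ n))

/-- The regularity conditions at the sample size `n`, with constants `c` and `C`. -/
structure RegularAt (M : DistModel G P) (n : ℕ) (c C : ℝ) : Prop where
  clientSetting : ∀ k, ClientSetting G (M.obs n k) (M.z n) (M.β₀ n) (M.B n) c C
  balanced : ∀ k l, (M.size n k : ℝ) ≤ C * M.size n l
  noise : IsNoise (P n) (M.error n) C

variable (M : DistModel G P)

lemma measurable_error (n : ℕ) (i : Fin n) : Measurable (M.error n i) :=
  (M.y_measurable n i).sub_const _

lemma memLp_y (n : ℕ) (i : Fin n) : MemLp (M.y n i) 2 (P n) := by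
  have h := G.memLp_id_law (G.u_mem (inner ℝ (M.z n i) (M.β₀ n)))
  rw [← M.y_law n i] at h
  exact h.comp_of_map (M.y_measurable n i).aemeasurable

lemma integral_error_comp (n : ℕ) (i : Fin n) {g : ℝ → ℝ} (hg : Measurable g) :
    ∫ ω, g (M.error n i ω) ∂(P n) = ∫ y, g (y - G.h (inner ℝ (M.z n i) (M.β₀ n)))
      ∂(G.law (G.u (inner ℝ (M.z n i) (M.β₀ n)))) := by
  rw [← M.y_law n i, integral_map (M.y_measurable n i).aemeasurable
    (f := fun y => g (y - G.h (inner ℝ (M.z n i) (M.β₀ n))))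
    (Measurable.aestronglyMeasurable (by fun_prop))]
  rfl

variable [∀ n, IsProbabilityMeasure (P n)]

lemma memLp_error (n : ℕ) (i : Fin n) : MemLp (M.error n i) 2 (P n) :=
  (M.memLp_y n i).sub (memLp_const _)

omit [∀ n, IsProbabilityMeasure (P n)] in
lemma iIndepFun_error (n : ℕ) : iIndepFun (M.error n) (P n) :=
  (M.y_indep n).comp (fun i y => y - G.h (inner ℝ (M.z n i) (M.β₀ n)))
    fun _ => measurable_id.sub_const _

lemma integral_error (n : ℕ) (i : Fin n) : ∫ ω, M.error n i ω ∂(P n) = 0 := by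
  have h := G.integral_id_law (G.u_mem (inner ℝ (M.z n i) (M.β₀ n)))
  rw [G.mean_u, ← M.y_law n i, integral_map (M.y_measurable n i).aemeasurable
    (by fun_prop)] at h
  unfold error
  rw [integral_sub ((M.memLp_y n i).integrable (by norm_num)) (integrable_const _)]
  simpa [sub_eq_zero] using h

omit [∀ n, IsProbabilityMeasure (P n)] in
lemma integral_error_sq (n : ℕ) (i : Fin n) :
    ∫ ω, M.error n i ω ^ 2 ∂(P n) = G.v (inner ℝ (M.z n i) (M.β₀ n)) := by
  rw [M.integral_error_comp n i (g := fun x => x ^ 2) (by fun_prop), GLM.v,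
    ← G.integral_sq_law (G.u_mem _), G.mean_u]

/-- All constants merge into one lower bound and one upper bound, and the conditions on unit vectors
extend to all vectors by homogeneity. -/
theorem Regular.exists_regularAt (hM : M.Regular) :
    ∃ c C : ℝ, 0 < c ∧ 0 < C ∧ ∀ᶠ n in atTop, 0 < M.p n → M.RegularAt n c C := by
  obtain ⟨Ce, hCe⟩ := hM.error_bdd
  obtain ⟨r, R, hr, hrR⟩ := hM.param
  obtain ⟨Cb, hCb⟩ := hM.bdd
  obtain ⟨cw, hcw, hcw'⟩ := hM.w_min
  obtain ⟨cg, Cg, hcg, hg⟩ := hM.gram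
  obtain ⟨Cn, hCn⟩ := hM.cov_norm
  obtain ⟨Cf, hCf⟩ := hM.cov_fourth
  obtain ⟨Cl, hCl⟩ := hM.balanced
  set C := 1 + |Ce| + |R| + |Cb| + |Cg| + |Cn| + |Cf| + |Cl| with hC
  have n1 := abs_nonneg Ce
  have n2 := abs_nonneg R
  have n3 := abs_nonneg Cb
  have n4 := abs_nonneg Cg
  have n5 := abs_nonneg Cn
  have n6 := abs_nonneg Cf
  have n7 := abs_nonneg Cl
  have l1 : Ce ≤ C := (le_abs_self Ce).trans (by linarith)
  have l2 : R ≤ C := (le_abs_self R).trans (by linarith)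
  have l3 : Cb ≤ C := (le_abs_self Cb).trans (by linarith)
  have l4 : Cg ≤ C := (le_abs_self Cg).trans (by linarith)
  have l5 : Cn ≤ C := (le_abs_self Cn).trans (by linarith)
  have l6 : Cf ≤ C := (le_abs_self Cf).trans (by linarith)
  have l7 : Cl ≤ C := (le_abs_self Cl).trans (by linarith)
  have hCpos : 0 < C := by linarith
  clear_value C
  refine ⟨min r (min cw cg), C, lt_min hr (lt_min hcw hcg), hCpos, ?_⟩
  have c1 : min r (min cw cg) ≤ r := min_le_left _ _
  have c2 : min r (min cw cg) ≤ cw := (min_le_right _ _).trans (min_le_left _ _)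
  have c3 : min r (min cw cg) ≤ cg := (min_le_right _ _).trans (min_le_right _ _)
  have hcpos : 0 < min r (min cw cg) := lt_min hr (lt_min hcw hcg)
  generalize min r (min cw cg) = c at *
  filter_upwards [hCe, hrR, hCb, hcw', hg, hCn, hCf, hCl] with n hCe hrR hCb hcw' hg hCn hCf hCl hp
  have hpR : (0 : ℝ) < M.p n := Nat.cast_pos.2 hp
  have hcard : ∀ k, 0 < (M.obs n k).card := by
    intro k
    by_contra! hk
    have hk0 : M.size n k = 0 := Nat.le_zero.1 hk
    -- The normalized Gram form of an empty client is zero since `0⁻¹ = 0`, against its lower bound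
    -- on a unit vector; such a vector exists because the dimension is positive.
    have := (hg k (EuclideanSpace.single ⟨0, hp⟩ 1) (by simp)).1
    rw [hk0] at this
    simp at this
    linarith
  have hunit : ∀ a : EuclideanSpace ℝ (Fin (M.p n)), a ≠ 0 →
      ∃ b : EuclideanSpace ℝ (Fin (M.p n)), ‖b‖ = 1 ∧
        ∀ z : EuclideanSpace ℝ (Fin (M.p n)), (inner ℝ z a : ℝ) = ‖a‖ * inner ℝ b z := by
    intro a ha
    refine ⟨‖a‖⁻¹ • a, norm_smul_inv_norm ha, fun z => ?_⟩
    rw [real_inner_smul_left, ← mul_assoc, mul_inv_cancel₀ (norm_ne_zero_iff.2 ha), one_mul,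
      real_inner_comm]
  refine ⟨fun k => ⟨hcpos, hCpos, hp, hcard k, fun a => ?_, fun a => ?_, fun a b => ?_,
    fun i _ => (hCn i).trans (mul_le_mul_of_nonneg_right l5 hpR.le), fun i _ β hβ => ?_,
    fun i _ => c2.trans (hcw' i), ?_, ?_⟩, fun k l => (hCl k l).trans
      (mul_le_mul_of_nonneg_right l7 (Nat.cast_nonneg _)), ?_⟩
  · rcases eq_or_ne a 0 with rfl | ha
    · simp
    obtain ⟨b, hb, hab⟩ := hunit a ha
    have h1 := (hg k b hb).1
    have hk : (0 : ℝ) < M.size n k := Nat.cast_pos.2 (hcard k)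
    rw [inv_mul_eq_div, le_div_iff₀ hk] at h1
    simp only [hab, mul_pow, ← Finset.mul_sum]
    rw [mul_comm]
    exact mul_le_mul_of_nonneg_left ((mul_le_mul_of_nonneg_right c3 hk.le).trans h1) (sq_nonneg _)
  · rcases eq_or_ne a 0 with rfl | ha
    · simp
    obtain ⟨b, hb, hab⟩ := hunit a ha
    have h1 := (hg k b hb).2
    have hk : (0 : ℝ) < M.size n k := Nat.cast_pos.2 (hcard k)
    rw [inv_mul_eq_div, div_le_iff₀ hk] at h1
    simp only [hab, mul_pow, ← Finset.mul_sum]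
    rw [mul_comm]
    exact mul_le_mul_of_nonneg_right (h1.trans (mul_le_mul_of_nonneg_right l4 hk.le)) (sq_nonneg _)
  · rcases eq_or_ne a 0 with rfl | ha
    · simp
    rcases eq_or_ne b 0 with rfl | hb
    · simp
    obtain ⟨a', ha', haa⟩ := hunit a ha
    obtain ⟨b', hb', hbb⟩ := hunit b hb
    have h1 := hCf k a' b' ha' hb'
    have hk : (0 : ℝ) < M.size n k := Nat.cast_pos.2 (hcard k)
    have h2 := mul_le_mul_of_nonneg_right (h1.trans (mul_le_mul_of_nonneg_right l6 hk.le))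
      (show 0 ≤ ‖a‖ ^ 2 * ‖b‖ ^ 2 by positivity)
    refine le_trans (le_of_eq ?_) h2
    simp only [haa, hbb, Finset.sum_mul]
    exact Finset.sum_congr rfl fun i _ => by ring
  · obtain ⟨h1, h2, h3, h4, h5, h6, h7⟩ := hCb i β hβ
    exact ⟨h1.trans l3, h2.trans l3, h3.trans l3, h4.trans l3, h5.trans l3, h6.trans l3,
      h7.trans l3⟩
  · exact (Metric.closedBall_subset_closedBall
      (div_le_div_of_nonneg_right c1 (Real.sqrt_nonneg _))).trans hrR.1
  · exact hrR.2.trans (Metric.closedBall_subset_closedBall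
      (mul_le_mul_of_nonneg_right l2 (Real.sqrt_nonneg _)))
  · exact ⟨M.measurable_error n, M.iIndepFun_error n, M.memLp_error n, M.integral_error n,
      fun i => (hCe i).trans l1⟩

omit [∀ n, IsProbabilityMeasure (P n)] in
lemma localLogLik_eq (n : ℕ) (k : Fin (M.K n)) (ω : Ω n) :
    M.localLogLik n k ω = fun β => ∑ i ∈ M.obs n k,
      G.logDensity (M.error n i ω + G.h (inner ℝ (M.z n i) (M.β₀ n))) (inner ℝ (M.z n i) β) := by
  ext β
  simp [localLogLik, error]

-- The log-likelihood is continuous in the parameter and measurable in the responses, and the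
-- parameter set is compact and nonempty, so measurable selection applies.
omit [∀ n, IsProbabilityMeasure (P n)] in
theorem exists_isLocalMLE (hu : ContDiff ℝ 3 G.u) :
    ∃ βhat : ∀ n, Fin (M.K n) → Ω n → EuclideanSpace ℝ (Fin (M.p n)), M.IsLocalMLE βhat := by
  have hcont : ∀ y, Continuous (G.logDensity y) := by
    intro y
    have hb : Continuous fun x => G.b (G.u x) := continuous_iff_continuousAt.2 fun x =>
      ((G.hasDerivAt_b (G.u_mem x)).comp x (GLM.hasDerivAt_u hu x)).continuousAt
    have := hu.continuous
    unfold GLM.logDensity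
    fun_prop
  have hmeas : ∀ x, Measurable fun y => G.logDensity y x := by
    intro x
    have := G.c_measurable
    unfold GLM.logDensity
    fun_prop
  have h : ∀ n k, ∃ s : Ω n → EuclideanSpace ℝ (Fin (M.p n)), Measurable s ∧
      ∀ ω, s ω ∈ M.B n ∧ IsMaxOn (M.localLogLik n k ω) (M.B n) (s ω) := fun n k =>
    exists_measurable_isMaxOn (M.B_compact n) ⟨_, interior_subset (M.β₀_interior n)⟩
      (fun β _ => Finset.measurable_fun_sum _ fun i _ => (hmeas _).comp (M.y_measurable n i))
      (fun ω => (continuous_finsetSum _ fun i _ => (hcont _).comp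
        (continuous_const.inner continuous_id)).continuousOn)
  choose s hs using h
  exact ⟨s, hs⟩

omit [∀ n, IsProbabilityMeasure (P n)] in
lemma sum_size (n : ℕ) : ∑ k, M.size n k = n := by
  simpa [size, obs] using (Finset.card_eq_sum_card_fiberwise (f := M.client n) (s := Finset.univ)
    (t := Finset.univ) (fun _ _ => Finset.mem_coe.2 (Finset.mem_univ _))).symm

omit [∀ n, IsProbabilityMeasure (P n)] in
lemma sum_obs {A : Type*} [AddCommMonoid A] (n : ℕ) (f : Fin n → A) :
    ∑ k, ∑ i ∈ M.obs n k, f i = ∑ i, f i :=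
  Finset.sum_fiberwise _ _ _

-- Balance makes every client at least of the average size `n / K` up to a constant; this converts
-- rates in `n_k` into rates in `n`.
omit [∀ n, IsProbabilityMeasure (P n)] in
lemma RegularAt.le_mul_size {M : DistModel G P} {n : ℕ} {c C : ℝ} (h : M.RegularAt n c C)
    (k : Fin (M.K n)) : (n : ℝ) ≤ M.K n * C * M.size n k := by
  have h1 : (n : ℝ) = ∑ l, (M.size n l : ℝ) := by exact_mod_cast (M.sum_size n).symm
  rw [h1]
  refine (Finset.sum_le_sum fun l _ => h.balanced l k).trans (le_of_eq ?_)
  simp [mul_assoc]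

end DistModel

/-! ### Information matrices as quadratic forms, and the estimating equation. -/

section WeightedGram

variable {ι m : Type*} [Fintype m] [DecidableEq m] (s : Finset ι) (x : ι → ℝ)
  (z : ι → EuclideanSpace ℝ m)

lemma toEuclideanLin_vecMulVec (z b : EuclideanSpace ℝ m) :
    Matrix.toEuclideanLin (Matrix.vecMulVec z.ofLp z.ofLp) b = (inner ℝ z b : ℝ) • z := by
  ext j
  simp [Matrix.vecMulVec_mulVec, PiLp.inner_apply, dotProduct, mul_comm]

lemma inner_toEuclideanLin_sum_vecMulVec (a b : EuclideanSpace ℝ m) :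
    inner ℝ a (Matrix.toEuclideanLin
      (∑ i ∈ s, x i • Matrix.vecMulVec (z i).ofLp (z i).ofLp) b) =
      ∑ i ∈ s, x i * inner ℝ (z i) a * inner ℝ (z i) b := by
  rw [map_sum, LinearMap.sum_apply, inner_sum]
  refine Finset.sum_congr rfl fun i _ => ?_
  rw [map_smul, LinearMap.smul_apply, toEuclideanLin_vecMulVec, inner_smul_right, inner_smul_right,
    real_inner_comm a]
  ring

omit [Fintype m] [DecidableEq m] in
lemma isHermitian_sum_vecMulVec :
    (∑ i ∈ s, x i • Matrix.vecMulVec (z i).ofLp (z i).ofLp).IsHermitian := by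
  refine Finset.sum_induction _ _ (fun _ _ => Matrix.IsHermitian.add) Matrix.isHermitian_zero
    fun i _ => ?_
  ext j k
  simp [Matrix.vecMulVec_apply, mul_comm]

lemma posDef_of_inner_pos {A : Matrix m m ℝ} (hA : A.IsHermitian)
    (h : ∀ a : EuclideanSpace ℝ m, a ≠ 0 → 0 < (inner ℝ a (Matrix.toEuclideanLin A a) : ℝ)) :
    A.PosDef := by
  refine .of_dotProduct_mulVec_pos hA fun v hv => ?_
  have := h (WithLp.toLp 2 v) (by simpa using hv)
  simpa [PiLp.inner_apply, dotProduct, mul_comm] using this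

end WeightedGram

namespace DistModel

variable {G : GLM} {Ω : ℕ → Type*} [∀ n, MeasurableSpace (Ω n)] {P : ∀ n, Measure (Ω n)}
  {M : DistModel G P} {n : ℕ} {c C : ℝ}
  {βhat : ∀ n, Fin (M.K n) → Ω n → EuclideanSpace ℝ (Fin (M.p n))}

lemma inner_localFisher (k : Fin (M.K n)) (β a b : EuclideanSpace ℝ (Fin (M.p n))) :
    inner ℝ a (Matrix.toEuclideanLin (M.localFisher n k β) b) =
      ∑ i ∈ M.obs n k, G.w (inner ℝ (M.z n i) β) * inner ℝ (M.z n i) a * inner ℝ (M.z n i) b :=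
  inner_toEuclideanLin_sum_vecMulVec _ _ _ a b

lemma inner_fisher (β a b : EuclideanSpace ℝ (Fin (M.p n))) :
    inner ℝ a (Matrix.toEuclideanLin (M.fisher n β) b) =
      ∑ i, G.w (inner ℝ (M.z n i) β) * inner ℝ (M.z n i) a * inner ℝ (M.z n i) b :=
  inner_toEuclideanLin_sum_vecMulVec _ _ _ a b

lemma inner_fisherSum (ω : Ω n) (a b : EuclideanSpace ℝ (Fin (M.p n))) :
    inner ℝ a (Matrix.toEuclideanLin (M.fisherSum βhat n ω) b) =
      ∑ k, ∑ i ∈ M.obs n k,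
        G.w (inner ℝ (M.z n i) (βhat n k ω)) * inner ℝ (M.z n i) a * inner ℝ (M.z n i) b := by
  rw [fisherSum, map_sum, LinearMap.sum_apply, inner_sum]
  exact Finset.sum_congr rfl fun k _ => inner_localFisher k _ a b

lemma isHermitian_fisher (β : EuclideanSpace ℝ (Fin (M.p n))) : (M.fisher n β).IsHermitian :=
  isHermitian_sum_vecMulVec _ _ _

lemma isHermitian_fisherSum (ω : Ω n) : (M.fisherSum βhat n ω).IsHermitian :=
  Finset.sum_induction _ _ (fun _ _ => Matrix.IsHermitian.add) Matrix.isHermitian_zero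
    fun _ _ => isHermitian_sum_vecMulVec _ _ _

lemma toEuclideanLin_fisherSum_aee {ω : Ω n} (h : (M.fisherSum βhat n ω).PosDef) :
    Matrix.toEuclideanLin (M.fisherSum βhat n ω) (M.aee βhat n ω) =
      ∑ k, Matrix.toEuclideanLin (M.localFisher n k (βhat n k ω)) (βhat n k ω) := by
  rw [aee, map_sum]
  refine Finset.sum_congr rfl fun k _ => ?_
  rw [← LinearMap.comp_apply, ← Matrix.toLpLin_mul_same, ← Matrix.mul_assoc,
    Matrix.mul_nonsing_inv _ ((Matrix.isUnit_iff_isUnit_det _).1 h.isUnit), Matrix.one_mul]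

/-- Only the clients in `t` need estimates near the truth; the others contribute nonnegative forms
because the weights `w` are nonnegative. A singleton `t` serves (i), all clients serve (ii). -/
lemma RegularAt.le_inner_fisherSum (hM : M.RegularAt n c C) (hw : ContDiff ℝ 1 G.w) {ω : Ω n}
    (t : Finset (Fin (M.K n))) (hB : ∀ k ∈ t, βhat n k ω ∈ M.B n)
    (hτ : ∀ k ∈ t, √C * (√(M.p n) * ‖βhat n k ω - M.β₀ n‖) ≤ c / (2 * C))
    (a : EuclideanSpace ℝ (Fin (M.p n))) :
    ∑ k ∈ t, c / 2 * (c * M.size n k * ‖a‖ ^ 2) ≤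
      inner ℝ a (Matrix.toEuclideanLin (M.fisherSum βhat n ω) a) := by
  rw [inner_fisherSum]
  refine (Finset.sum_le_sum fun k hk => ?_).trans (Finset.sum_le_sum_of_subset_of_nonneg
    (Finset.subset_univ t) fun k _ _ => Finset.sum_nonneg fun i _ => ?_)
  · refine ((hM.clientSetting k).le_sum_w_mul_sq hw (hB k hk) (hτ k hk) a).trans
      (le_of_eq (Finset.sum_congr rfl fun i _ => by ring))
  · have := G.w_nonneg (inner ℝ (M.z n i) (βhat n k ω))
    rw [mul_assoc]
    exact mul_nonneg this (mul_self_nonneg _)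

lemma RegularAt.posDef_fisherSum (hM : M.RegularAt n c C) (hw : ContDiff ℝ 1 G.w) {ω : Ω n}
    (k : Fin (M.K n)) (hB : βhat n k ω ∈ M.B n)
    (hτ : √C * (√(M.p n) * ‖βhat n k ω - M.β₀ n‖) ≤ c / (2 * C)) :
    (M.fisherSum βhat n ω).PosDef := by
  refine posDef_of_inner_pos (isHermitian_fisherSum ω) fun a ha => ?_
  have h := hM.le_inner_fisherSum hw {k} (by simpa using hB) (by simpa using hτ) a
  refine lt_of_lt_of_le ?_ h
  rw [Finset.sum_singleton]
  have h1 := (hM.clientSetting k).card_pos'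
  have h2 := (hM.clientSetting k).c_pos
  have h3 := norm_pos_iff.2 ha
  unfold size
  positivity

/-- Since there is at least one client, `K = o(f / p ^ m)` forces the dimension to be positive. -/
lemma eventually_p_pos (M : DistModel G P) {f : ℕ → ℝ} {m : ℕ} (hm : m ≠ 0)
    (hK : (fun n => (M.K n : ℝ)) =o[atTop] fun n => f n / (M.p n : ℝ) ^ m) :
    ∀ᶠ n in atTop, 0 < M.p n := by
  filter_upwards [hK.def one_pos, eventually_gt_atTop 0] with n hn hn0
  by_contra! hp
  have hp0 : M.p n = 0 := Nat.le_zero.1 hp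
  -- For `p = 0` the right side is zero by the convention for division, which forces `K = 0`; but
  -- the first observation belongs to some client.
  rw [hp0] at hn
  simp [hm] at hn
  have := (M.client n ⟨0, hn0⟩).2
  omega

theorem tendsto_posDef_fisherSum [∀ n, IsProbabilityMeasure (P n)] (hM : M.Regular)
    (hK : (fun n => (M.K n : ℝ)) =o[atTop] fun n : ℕ => (n : ℝ) / (M.p n : ℝ) ^ 2)
    (hβ : M.IsLocalMLE βhat) :
    Tendsto (fun n => P n {ω | (M.fisherSum βhat n ω).PosDef}) atTop (𝓝 1) := by
  obtain ⟨c, C, hc, hC, hreg⟩ := hM.exists_regularAt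
  obtain ⟨D, hD, hbad⟩ := exists_bad_event G hM.u_smooth hM.w_smooth hc hC
  obtain ⟨D', hD', hbad⟩ := hbad (c / (2 * C) / √C) (by positivity)
  have hlim : Tendsto (fun n => 1 - ENNReal.ofReal (D' * C *
      ((M.K n : ℝ) / ((n : ℝ) / (M.p n : ℝ) ^ 2)))) atTop (𝓝 1) := by
    have h := ENNReal.tendsto_ofReal (hK.tendsto_div_nhds_zero.const_mul (D' * C))
    simpa using ENNReal.Tendsto.sub (tendsto_const_nhds (x := (1 : ENNReal))) h (by simp)
  refine tendsto_of_tendsto_of_tendsto_of_le_of_le' hlim tendsto_const_nhds ?_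
    (Eventually.of_forall fun n => prob_le_one)
  filter_upwards [hreg, M.eventually_p_pos two_ne_zero hK, eventually_gt_atTop 0]
    with n hreg hp hn
  have hreg := hreg hp
  -- Any one client suffices; that of the first observation exists and is nonempty.
  set k := M.client n ⟨0, hn⟩
  have hS := hreg.clientSetting k
  have hN := hS.card_pos'
  have hnR : (0 : ℝ) < n := Nat.cast_pos.2 hn
  obtain ⟨bad, hPbad, hbad⟩ := hbad (P n) hS hreg.noise
  have hsub : (Set.univ : Set (Ω n)) ⊆ {ω | (M.fisherSum βhat n ω).PosDef} ∪ bad := by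
    intro ω _
    by_cases hω : ω ∈ bad
    · exact Or.inr hω
    refine Or.inl (hreg.posDef_fisherSum hM.w_smooth k ((hβ n k).2 ω).1 ?_)
    have := (hbad ω hω _ ((hβ n k).2 ω).1 (M.localLogLik_eq n k ω ▸ ((hβ n k).2 ω).2)).2
    rw [le_div_iff₀ (Real.sqrt_pos.2 hC)] at this
    rwa [mul_comm]
  have h1 : (1 : ENNReal) ≤ P n {ω | (M.fisherSum βhat n ω).PosDef} + P n bad := by
    rw [← measure_univ (μ := P n)]
    exact (measure_mono hsub).trans (measure_union_le _ _)
  have h2 : P n bad ≤ ENNReal.ofReal (D' * C * ((M.K n : ℝ) / ((n : ℝ) / (M.p n : ℝ) ^ 2))) := by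
    rw [← ofReal_measureReal]
    refine ENNReal.ofReal_le_ofReal (hPbad.trans ?_)
    rw [mul_assoc]
    refine mul_le_mul_of_nonneg_left ?_ hD'
    rw [div_div_eq_mul_div, mul_div_assoc', div_le_div_iff₀ hN hnR]
    have := mul_le_mul_of_nonneg_left (hreg.le_mul_size k) (sq_nonneg (M.p n : ℝ))
    refine this.trans (le_of_eq ?_)
    rw [size]
    ring
  exact tsub_le_iff_right.2 (h1.trans (add_le_add_right h2 _))

end DistModel

/-! ### Asymptotic normality of the leading term. -/

namespace DistModel

variable {G : GLM} {Ω : ℕ → Type*} [∀ n, MeasurableSpace (Ω n)] {P : ∀ n, Measure (Ω n)}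
  {M : DistModel G P} {c C : ℝ}

lemma mem_obs_client (n : ℕ) (i : Fin n) : i ∈ M.obs n (M.client n i) := by simp [obs]

lemma RegularAt.boundedAt {n : ℕ} (hM : M.RegularAt n c C) (i : Fin n) :
    G.BoundedAt C (inner ℝ (M.z n i) (M.β₀ n)) :=
  (hM.clientSetting _).bdd i (mem_obs_client n i) _
    (subset_convexHull ℝ _ (hM.clientSetting (M.client n i)).β₀_mem)

lemma RegularAt.le_inner_fisher {n : ℕ} (hM : M.RegularAt n c C)
    (a : EuclideanSpace ℝ (Fin (M.p n))) :
    c * ∑ i, inner ℝ (M.z n i) a ^ 2 ≤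
      (inner ℝ a (Matrix.toEuclideanLin (M.fisher n (M.β₀ n)) a) : ℝ) := by
  rw [inner_fisher, Finset.mul_sum]
  refine Finset.sum_le_sum fun i _ => ?_
  rw [mul_assoc, ← sq]
  exact mul_le_mul_of_nonneg_right
    ((hM.clientSetting _).w_min i (mem_obs_client n i)) (sq_nonneg _)

lemma RegularAt.mul_norm_sq_le {n : ℕ} (hM : M.RegularAt n c C)
    (a : EuclideanSpace ℝ (Fin (M.p n))) :
    c * n * ‖a‖ ^ 2 ≤ ∑ i, inner ℝ (M.z n i) a ^ 2 := by
  rw [← M.sum_obs]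
  refine le_trans (le_of_eq ?_) (Finset.sum_le_sum fun k _ => (hM.clientSetting k).gram_lower a)
  rw [← Finset.sum_mul, ← Finset.mul_sum]
  congr 2
  exact_mod_cast (M.sum_size n).symm

/-- The coefficients of the errors in the leading term of the estimator in the direction `a`. -/
noncomputable def coef (M : DistModel G P) (n : ℕ) (a : EuclideanSpace ℝ (Fin (M.p n)))
    (i : Fin n) : ℝ :=
  G.disp⁻¹ * (deriv G.u (inner ℝ (M.z n i) (M.β₀ n)) * inner ℝ (M.z n i) a)

lemma RegularAt.coef_sq_le {n : ℕ} (hM : M.RegularAt n c C) (a : EuclideanSpace ℝ (Fin (M.p n)))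
    (i : Fin n) : M.coef n a i ^ 2 ≤ G.disp⁻¹ ^ 2 * C ^ 2 * inner ℝ (M.z n i) a ^ 2 := by
  have h := sq_le_sq' (abs_le.1 (hM.boundedAt i).2.2.1).1 (abs_le.1 (hM.boundedAt i).2.2.1).2
  rw [coef, mul_pow, mul_pow, mul_assoc]
  gcongr

variable [∀ n, IsProbabilityMeasure (P n)]

-- The score has the Fisher information as variance: the identity `u' ^ 2 * v = disp ^ 2 * w` holds
-- term by term.
omit [∀ n, IsProbabilityMeasure (P n)] in
lemma sum_coef_sq_mul_integral (hu : ContDiff ℝ 3 G.u) (n : ℕ)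
    (a : EuclideanSpace ℝ (Fin (M.p n))) :
    ∑ i, ∫ ω, (M.coef n a i * M.error n i ω) ^ 2 ∂(P n) =
      inner ℝ a (Matrix.toEuclideanLin (M.fisher n (M.β₀ n)) a) := by
  rw [inner_fisher]
  refine Finset.sum_congr rfl fun i _ => ?_
  simp_rw [mul_pow]
  rw [integral_const_mul, M.integral_error_sq]
  have h := GLM.deriv_u_sq_mul_v hu (inner ℝ (M.z n i) (M.β₀ n))
  have hd := G.disp_pos.ne'
  rw [coef, mul_pow, mul_pow,
    show ∀ x y z v : ℝ, x * (y * z) * v = x * z * (y * v) by intros; ring, h]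
  field_simp

/-- The squared errors are uniformly integrable. -/
lemma exists_uniform_tail_error (M : DistModel G P) (C : ℝ) {ε : ℝ} (hε : 0 < ε) :
    ∃ L, ∀ n i, |G.h (inner ℝ (M.z n i) (M.β₀ n))| ≤ C →
      ∫ ω, M.error n i ω ^ 2 ∂(P n) ≤ C →
      ∫ ω in {ω | L < |M.error n i ω|}, M.error n i ω ^ 2 ∂(P n) ≤ ε := by
  obtain ⟨T, hT⟩ := G.exists_uniform_tail (C + 2 * C + 2 * C ^ 2) (ε := ENNReal.ofReal (ε / 4))
    (by simpa using hε)
  -- Means are at most `C`, so above this level `|y| > T` and `|error| ≤ 2 * |y|`. The square loses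
  -- a factor 4, hence the tail level `ε / 4` for `y`.
  refine ⟨2 * C + |T|, fun n i hh he => ?_⟩
  set μ := G.h (inner ℝ (M.z n i) (M.β₀ n)) with hμ
  have hC : 0 ≤ C := (abs_nonneg _).trans hh
  have hint := (M.memLp_y n i).integrable_sq
  have hinte := (M.memLp_error n i).integrable_sq
  have hm := M.y_measurable n i
  have hsecond : ∫ ω, M.y n i ω ^ 2 ∂(P n) ≤ C + 2 * C + 2 * C ^ 2 := by
    have h1 : ∫ ω, M.y n i ω ^ 2 ∂(P n) ≤ ∫ ω, (2 * M.error n i ω ^ 2 + 2 * C ^ 2) ∂(P n) := by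
      refine integral_mono hint ((hinte.const_mul 2).add (integrable_const _)) fun ω => ?_
      have h2 : M.y n i ω = M.error n i ω + μ := by simp [error, μ]
      have h3 : μ ^ 2 ≤ C ^ 2 := sq_le_sq' (abs_le.1 hh).1 (abs_le.1 hh).2
      simp only
      rw [h2]
      nlinarith [sq_nonneg (M.error n i ω - μ)]
    rw [integral_add (hinte.const_mul 2) (integrable_const _), integral_const_mul] at h1
    simp at h1
    linarith
  have htail := hT _ (G.u_mem (inner ℝ (M.z n i) (M.β₀ n)))
    (by rw [G.mean_u]; exact hh.trans (by nlinarith)) ?_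
  · rw [← M.y_law n i] at htail
    have h1 : ∫ ω in {ω | T < |M.y n i ω|}, M.y n i ω ^ 2 ∂(P n) ≤ ε / 4 := by
      rw [integral_eq_lintegral_of_nonneg_ae (ae_of_all _ fun ω => sq_nonneg _)
        (by fun_prop)]
      refine ENNReal.toReal_le_of_le_ofReal (by positivity) ?_
      rwa [setLIntegral_map (measurableSet_lt measurable_const (by fun_prop)) (by fun_prop) hm]
        at htail
    have hms : MeasurableSet {ω | 2 * C + |T| < |M.error n i ω|} :=
      measurableSet_lt measurable_const (M.measurable_error n i).abs
    have hsub : {ω | 2 * C + |T| < |M.error n i ω|} ⊆ {ω | T < |M.y n i ω|} := by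
      intro ω hω
      have h2 : |M.error n i ω| ≤ |M.y n i ω| + |μ| := abs_sub _ _
      have h3 : 2 * C + |T| < |M.error n i ω| := hω
      show T < |M.y n i ω|
      linarith [le_abs_self T]
    calc ∫ ω in {ω | 2 * C + |T| < |M.error n i ω|}, M.error n i ω ^ 2 ∂(P n)
        ≤ ∫ ω in {ω | 2 * C + |T| < |M.error n i ω|}, 4 * M.y n i ω ^ 2 ∂(P n) := by
          refine setIntegral_mono_on hinte.integrableOn (hint.const_mul 4).integrableOn hms
            fun ω hω => ?_
          have h2 : |M.error n i ω| ≤ |M.y n i ω| + |μ| := abs_sub _ _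
          have h3 : 2 * C + |T| < |M.error n i ω| := hω
          have h4 : |M.error n i ω| ≤ 2 * |M.y n i ω| := by linarith [abs_nonneg T]
          have h5 := pow_le_pow_left₀ (abs_nonneg _) h4 2
          rw [mul_pow, sq_abs, sq_abs] at h5
          linarith
      _ ≤ ∫ ω in {ω | T < |M.y n i ω|}, 4 * M.y n i ω ^ 2 ∂(P n) :=
          setIntegral_mono_set (hint.const_mul 4).integrableOn
            (ae_of_all _ fun ω => by positivity) hsub.eventuallyLE
      _ ≤ ε := by
          rw [integral_const_mul]
          linarith
  · rw [← M.y_law n i, lintegral_map (by fun_prop) hm,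
      ← ofReal_integral_eq_lintegral_ofReal hint (ae_of_all _ fun ω => sq_nonneg _)]
    exact ENNReal.ofReal_le_ofReal hsecond

/-- Asymptotic normality of the leading term of the estimator. -/
theorem tendsto_charFun_sum_coef_mul_error (hu : ContDiff ℝ 3 G.u) (hc : 0 < c)
    (hM : ∀ᶠ n in atTop, M.RegularAt n c C)
    (hp : Tendsto (fun n => (M.p n : ℝ) / n) atTop (𝓝 0))
    (a : ∀ n, EuclideanSpace ℝ (Fin (M.p n)))
    (ha : ∀ᶠ n in atTop, (inner ℝ (a n)
      (Matrix.toEuclideanLin (M.fisher n (M.β₀ n)) (a n)) : ℝ) = 1) (t : ℝ) :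
    Tendsto (fun n => charFun ((P n).map fun ω => ∑ i, M.coef n (a n) i * M.error n i ω) t) atTop
      (𝓝 (charFun (gaussianReal 0 1) t)) := by
  have hd := G.disp_pos
  refine tendsto_charFun_of_lindeberg (fun n i => (M.measurable_error n i).const_mul _)
    (fun n i => (M.memLp_error n i).const_mul _)
    (fun n i => by rw [integral_const_mul, M.integral_error, mul_zero])
    (fun n => (M.iIndepFun_error n).comp (fun i x => M.coef n (a n) i * x)
      fun i => measurable_const_mul _)
    (ha.mono fun n hn => (sum_coef_sq_mul_integral hu n (a n)).trans hn) (fun ε hε => ?_) t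
  set S : ℝ := G.disp⁻¹ ^ 2 * C ^ 2 with hS
  have hS0 : 0 ≤ S := by positivity
  rw [Metric.tendsto_nhds]
  intro δ hδ
  -- The squared coefficients sum to at most `S / c`, so this level bounds the Lindeberg sum by `δ /
  -- 2`.
  obtain ⟨L, hL⟩ := M.exists_uniform_tail_error C (ε := δ / (2 * (S / c + 1))) (by positivity)
  have hsmall : ∀ᶠ n in atTop, S * C / (c * c) * L ^ 2 * ((M.p n : ℝ) / n) < ε ^ 2 := by
    have h := hp.const_mul (S * C / (c * c) * L ^ 2)
    rw [mul_zero] at h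
    exact h.eventually_lt_const (by positivity)
  filter_upwards [hM, ha, hsmall, eventually_gt_atTop 0] with n hM ha hsmall hn
  have hnR : (0 : ℝ) < n := Nat.cast_pos.2 hn
  have hsum : ∑ i, inner ℝ (M.z n i) (a n) ^ 2 ≤ 1 / c := by
    rw [le_div_iff₀ hc, mul_comm]
    exact (hM.le_inner_fisher _).trans ha.le
  have hcoef : ∀ i, M.coef n (a n) i ^ 2 ≤ S * C / (c * c) * ((M.p n : ℝ) / n) := by
    intro i
    refine (hM.coef_sq_le _ i).trans ?_
    have h1 : inner ℝ (M.z n i) (a n) ^ 2 ≤ ‖M.z n i‖ ^ 2 * ‖a n‖ ^ 2 := by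
      rw [← mul_pow, ← sq_abs]
      exact pow_le_pow_left₀ (abs_nonneg _) (abs_real_inner_le_norm _ _) 2
    have h2 := (hM.clientSetting _).norm_sq_le i (mem_obs_client n i)
    have h3 : ‖a n‖ ^ 2 ≤ 1 / (c * c * n) := by
      rw [le_div_iff₀ (by positivity)]
      have := mul_le_mul_of_nonneg_left ((hM.mul_norm_sq_le (a n)).trans hsum) hc.le
      rw [mul_one_div_cancel hc.ne'] at this
      linarith
    have h4 : inner ℝ (M.z n i) (a n) ^ 2 ≤ C * M.p n * (1 / (c * c * n)) :=
      h1.trans (mul_le_mul h2 h3 (sq_nonneg _) ((sq_nonneg _).trans h2))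
    refine (mul_le_mul_of_nonneg_left h4 hS0).trans (le_of_eq ?_)
    field_simp
  have hterm : ∀ i, ∫ ω in {ω | ε < |M.coef n (a n) i * M.error n i ω|},
      (M.coef n (a n) i * M.error n i ω) ^ 2 ∂(P n) ≤
      S * inner ℝ (M.z n i) (a n) ^ 2 * (δ / (2 * (S / c + 1))) := by
    intro i
    simp_rw [mul_pow]
    rw [integral_const_mul]
    have hsub : {ω | ε < |M.coef n (a n) i * M.error n i ω|} ⊆ {ω | L < |M.error n i ω|} := by
      intro ω hω
      have h1 : ε < |M.coef n (a n) i * M.error n i ω| := hω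
      show L < |M.error n i ω|
      by_contra! hcon
      have h2 := pow_lt_pow_left₀ h1 hε.le two_ne_zero
      rw [sq_abs, mul_pow] at h2
      have h3 : M.error n i ω ^ 2 ≤ L ^ 2 := by
        rw [← sq_abs]
        exact pow_le_pow_left₀ (abs_nonneg _) hcon 2
      have h4 := mul_le_mul (hcoef i) h3 (sq_nonneg _) ((sq_nonneg _).trans (hcoef i))
      linarith
    exact mul_le_mul (hM.coef_sq_le _ i) ((setIntegral_mono_set
      (M.memLp_error n i).integrable_sq.integrableOn (ae_of_all _ fun ω => sq_nonneg _)
      hsub.eventuallyLE).trans (hL n i (hM.boundedAt i).1 (hM.noise.integral_sq_le i)))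
      (integral_nonneg fun ω => sq_nonneg _) (by positivity)
  rw [Real.dist_eq, sub_zero, abs_of_nonneg (Finset.sum_nonneg fun i _ =>
    integral_nonneg fun ω => sq_nonneg _)]
  refine lt_of_le_of_lt (Finset.sum_le_sum fun i _ => hterm i) ?_
  rw [← Finset.sum_mul, ← Finset.mul_sum]
  have h1 : S * ∑ i, inner ℝ (M.z n i) (a n) ^ 2 ≤ S / c + 1 := by
    have := mul_le_mul_of_nonneg_left hsum hS0
    rw [mul_one_div] at this
    linarith
  refine (mul_le_mul_of_nonneg_right h1 (by positivity)).trans_lt ?_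
  have h2 : S / c + 1 ≠ 0 := by positivity
  rw [show (S / c + 1) * (δ / (2 * (S / c + 1))) = δ / 2 by field_simp]
  linarith

end DistModel

/-- The quadratic form of a positive definite matrix against a solution of `√A a = α`. -/
lemma exists_inner_eq_inner_sqrt {m : Type*} [Fintype m] [DecidableEq m] {A : Matrix m m ℝ}
    (hA : A.PosDef) (α : EuclideanSpace ℝ m) :
    ∃ a : EuclideanSpace ℝ m, (inner ℝ a (Matrix.toEuclideanLin A a) : ℝ) = ‖α‖ ^ 2 ∧
      ∀ b : EuclideanSpace ℝ m, (inner ℝ α (Matrix.toEuclideanLin (CFC.sqrt A) b) : ℝ) =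
        inner ℝ a (Matrix.toEuclideanLin A b) := by
  have hA0 : 0 ≤ A := Matrix.nonneg_iff_posSemidef.2 hA.posSemidef
  have hsq : CFC.sqrt A * CFC.sqrt A = A := CFC.sqrt_mul_sqrt_self A hA0
  have hsym : (Matrix.toEuclideanLin (CFC.sqrt A)).IsSymmetric :=
    Matrix.isSymmetric_toEuclideanLin_iff.2
      (Matrix.nonneg_iff_posSemidef.1 (CFC.sqrt_nonneg A)).isHermitian
  have hdet : IsUnit (CFC.sqrt A).det := by
    have h1 : IsUnit A.det := (Matrix.isUnit_iff_isUnit_det _).1 hA.isUnit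
    rw [← hsq, Matrix.det_mul] at h1
    exact isUnit_of_mul_isUnit_left h1
  set a := Matrix.toEuclideanLin (CFC.sqrt A)⁻¹ α with ha
  have haα : Matrix.toEuclideanLin (CFC.sqrt A) a = α := by
    rw [ha, ← LinearMap.comp_apply, ← Matrix.toLpLin_mul_same, Matrix.mul_nonsing_inv _ hdet,
      Matrix.toLpLin_one, LinearMap.id_apply]
  have hb : ∀ b : EuclideanSpace ℝ m, (inner ℝ α (Matrix.toEuclideanLin (CFC.sqrt A) b) : ℝ) =
      inner ℝ a (Matrix.toEuclideanLin A b) := by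
    intro b
    conv_rhs => rw [← hsq, Matrix.toLpLin_mul_same, LinearMap.comp_apply]
    rw [← hsym a (Matrix.toEuclideanLin (CFC.sqrt A) b), haα]
  refine ⟨a, ?_, hb⟩
  rw [← hb a, haα, real_inner_self_eq_norm_sq]

/-! ### Moments of the remainder. -/

namespace DistModel

variable {G : GLM} {Ω : ℕ → Type*} [∀ n, MeasurableSpace (Ω n)] {P : ∀ n, Measure (Ω n)}

/-- The norm of the score of client `k` at the truth, up to the dispersion. -/
noncomputable def scoreNorm (M : DistModel G P) (n : ℕ) (k : Fin (M.K n)) (ω : Ω n) : ℝ :=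
  ‖∑ i ∈ M.obs n k, M.error n i ω • deriv G.u (inner ℝ (M.z n i) (M.β₀ n)) • M.z n i‖

/-- The norm of the random part of the derivative of the score in the direction `a`. -/
noncomputable def hessianNorm (M : DistModel G P) (n : ℕ) (a : EuclideanSpace ℝ (Fin (M.p n)))
    (k : Fin (M.K n)) (ω : Ω n) : ℝ :=
  ‖∑ i ∈ M.obs n k, M.error n i ω • (iteratedDeriv 2 G.u (inner ℝ (M.z n i) (M.β₀ n)) *
    inner ℝ (M.z n i) a) • M.z n i‖

/-- The norm of the fluctuation that dominates the second derivative of the score in the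
direction `a`. -/
noncomputable def thirdOrderNorm (M : DistModel G P) (n : ℕ) (a : EuclideanSpace ℝ (Fin (M.p n)))
    (k : Fin (M.K n)) (ω : Ω n) : ℝ :=
  ‖∑ i ∈ M.obs n k, (|M.error n i ω| - ∫ ω', |M.error n i ω'| ∂(P n)) •
    |inner ℝ (M.z n i) a| • outer (M.z n i) (M.z n i)‖

/-- A bound on the remainder of the estimator, up to a constant. -/
noncomputable def remainder (M : DistModel G P) (n : ℕ) (a : EuclideanSpace ℝ (Fin (M.p n)))
    (ω : Ω n) : ℝ :=
  ∑ k, (M.scoreNorm n k ω ^ 2 / √n + √n * M.hessianNorm n a k ω ^ 2 +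
    √n / M.p n * M.thirdOrderNorm n a k ω ^ 2) / M.size n k

variable {M : DistModel G P} {n : ℕ} {c C : ℝ} [∀ n, IsProbabilityMeasure (P n)]

omit [∀ n, IsProbabilityMeasure (P n)] in
lemma RegularAt.integral_scoreNorm_sq_le (hM : M.RegularAt n c C) (k : Fin (M.K n)) :
    Integrable (fun ω => M.scoreNorm n k ω ^ 2) (P n) ∧
    ∫ ω, M.scoreNorm n k ω ^ 2 ∂(P n) ≤ C ^ 4 * M.p n * M.size n k := by
  have hS := hM.clientSetting k
  have hC := hS.C_pos
  refine ⟨integrable_norm_sq_sum_smul hM.noise.memLp _ _, ?_⟩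
  refine (hM.noise.integral_norm_sq_le (M.obs n k) _ (W := C ^ 2 * (C * M.p n)) hC.le
    fun i hi => ?_).trans (le_of_eq (by rw [size]; ring))
  rw [norm_smul, mul_pow, Real.norm_eq_abs, sq_abs]
  have h := (hM.boundedAt i).2.2.1
  exact mul_le_mul (sq_le_sq' (abs_le.1 h).1 (abs_le.1 h).2) (hS.norm_sq_le i hi) (sq_nonneg _)
    (sq_nonneg _)

omit [∀ n, IsProbabilityMeasure (P n)] in
lemma RegularAt.integral_hessianNorm_sq_le (hM : M.RegularAt n c C)
    (a : EuclideanSpace ℝ (Fin (M.p n))) (k : Fin (M.K n)) :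
    Integrable (fun ω => M.hessianNorm n a k ω ^ 2) (P n) ∧
    ∫ ω, M.hessianNorm n a k ω ^ 2 ∂(P n) ≤ C ^ 5 * M.p n * M.size n k * ‖a‖ ^ 2 := by
  have hS := hM.clientSetting k
  have hC := hS.C_pos
  refine ⟨integrable_norm_sq_sum_smul hM.noise.memLp _ _, ?_⟩
  refine (integral_norm_sq_sum_smul_le hM.noise.memLp hM.noise.integral_eq_zero hM.noise.indep
    (M.obs n k) _ (W := fun i => C ^ 2 * (C * M.p n) * inner ℝ (M.z n i) a ^ 2)
    hM.noise.integral_sq_le hC.le fun i hi => ?_).trans ?_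
  · rw [norm_smul, mul_pow, Real.norm_eq_abs, sq_abs, mul_pow]
    have h := (hM.boundedAt i).2.2.2.1
    have h1 := mul_le_mul (sq_le_sq' (abs_le.1 h).1 (abs_le.1 h).2) (hS.norm_sq_le i hi)
      (sq_nonneg _) (sq_nonneg _)
    have h2 := mul_le_mul_of_nonneg_right h1 (sq_nonneg (inner ℝ (M.z n i) a : ℝ))
    linarith
  · rw [← Finset.mul_sum]
    have h := mul_le_mul_of_nonneg_left (hS.gram_upper a)
      (show 0 ≤ C * (C ^ 2 * (C * M.p n)) by positivity)
    refine (le_of_eq (by ring)).trans (h.trans (le_of_eq (by rw [size]; ring)))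

lemma RegularAt.integral_thirdOrderNorm_sq_le (hM : M.RegularAt n c C)
    (a : EuclideanSpace ℝ (Fin (M.p n))) (k : Fin (M.K n)) :
    Integrable (fun ω => M.thirdOrderNorm n a k ω ^ 2) (P n) ∧
    ∫ ω, M.thirdOrderNorm n a k ω ^ 2 ∂(P n) ≤
      C ^ 4 * (M.p n : ℝ) ^ 2 * M.size n k * ‖a‖ ^ 2 := by
  have hS := hM.clientSetting k
  have hC := hS.C_pos
  have hN := hM.noise.centered (g := fun x => |x|) (by fun_prop) fun x => (abs_abs x).le
  refine ⟨integrable_norm_sq_sum_smul hN.memLp _ _, ?_⟩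
  refine (integral_norm_sq_sum_smul_le hN.memLp hN.integral_eq_zero hN.indep
    (M.obs n k) _ (W := fun i => (C * M.p n) ^ 2 * inner ℝ (M.z n i) a ^ 2)
    hN.integral_sq_le hC.le fun i hi => ?_).trans ?_
  · rw [norm_smul, mul_pow, norm_outer, Real.norm_eq_abs, abs_abs, sq_abs, ← sq, mul_comm]
    exact mul_le_mul_of_nonneg_right (pow_le_pow_left₀ (sq_nonneg _) (hS.norm_sq_le i hi) 2)
      (sq_nonneg _)
  · rw [← Finset.mul_sum]
    have h := mul_le_mul_of_nonneg_left (hS.gram_upper a)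
      (show 0 ≤ C * (C * M.p n) ^ 2 by positivity)
    refine (le_of_eq (by ring)).trans (h.trans (le_of_eq (by rw [size]; ring)))

/-- The squared norms have means of order `p n_k`, `p n_k ‖a‖²` and `p² n_k ‖a‖²`, and `‖a‖²` is of
order `1 / n`. The weights in `remainder` bring all three to order `p / √n` per client. -/
lemma RegularAt.integral_remainder_le (hM : M.RegularAt n c C) (hc : 0 < c) (hn : 0 < n)
    {a : EuclideanSpace ℝ (Fin (M.p n))} (ha : c * c * n * ‖a‖ ^ 2 ≤ 1) :
    Integrable (M.remainder n a) (P n) ∧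
    ∫ ω, M.remainder n a ω ∂(P n) ≤
      (C ^ 4 + C ^ 5 / (c * c) + C ^ 4 / (c * c)) * (M.K n * (M.p n / √n)) := by
  have h1 := fun k => hM.integral_scoreNorm_sq_le k
  have h2 := fun k => hM.integral_hessianNorm_sq_le a k
  have h3 := fun k => hM.integral_thirdOrderNorm_sq_le a k
  have hi : ∀ k, Integrable (fun ω => (M.scoreNorm n k ω ^ 2 / √n +
      √n * M.hessianNorm n a k ω ^ 2 + √n / M.p n * M.thirdOrderNorm n a k ω ^ 2) /
        M.size n k) (P n) := fun k =>
    ((((h1 k).1.div_const _).add ((h2 k).1.const_mul _)).add ((h3 k).1.const_mul _)).div_const _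
  refine ⟨integrable_finsetSum _ fun k _ => hi k, ?_⟩
  unfold remainder
  rw [integral_finsetSum _ fun k _ => hi k]
  have hr : 0 < √(n : ℝ) := Real.sqrt_pos.2 (Nat.cast_pos.2 hn)
  have hrr : √(n : ℝ) * √(n : ℝ) = n := Real.mul_self_sqrt (Nat.cast_nonneg n)
  set r := √(n : ℝ)
  have ha' : r * ‖a‖ ^ 2 ≤ 1 / (c * c) * (1 / r) := by
    rw [one_div_mul_one_div_rev, le_div_iff₀ (by positivity)]
    rw [← hrr] at ha
    linarith
  refine (Finset.sum_le_card_nsmul _ _ ((C ^ 4 + C ^ 5 / (c * c) + C ^ 4 / (c * c)) *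
    (M.p n / r)) fun k _ => ?_).trans (le_of_eq (by simp; ring))
  have hS := hM.clientSetting k
  have hC := hS.C_pos
  have hp : (0 : ℝ) < M.p n := Nat.cast_pos.2 hS.p_pos
  have hN : (0 : ℝ) < M.size n k := hS.card_pos'
  rw [integral_div, integral_add
    (f := fun ω => M.scoreNorm n k ω ^ 2 / r + r * M.hessianNorm n a k ω ^ 2)
    (((h1 k).1.div_const _).add ((h2 k).1.const_mul _)) ((h3 k).1.const_mul _), integral_add ((h1 k).1.div_const _) ((h2 k).1.const_mul _),
    integral_div, integral_const_mul, integral_const_mul, div_le_iff₀ hN]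
  have e1 := div_le_div_of_nonneg_right (h1 k).2 hr.le
  have e2 := mul_le_mul_of_nonneg_left (h2 k).2 hr.le
  have e3 := mul_le_mul_of_nonneg_left (h3 k).2 (div_pos hr hp).le
  have f2 := mul_le_mul_of_nonneg_left ha' (show 0 ≤ C ^ 5 * M.p n * M.size n k by positivity)
  have f3 := mul_le_mul_of_nonneg_left ha' (show 0 ≤ C ^ 4 * M.p n * M.size n k by positivity)
  have g3 : r / M.p n * (C ^ 4 * (M.p n : ℝ) ^ 2 * M.size n k * ‖a‖ ^ 2) =
      C ^ 4 * M.p n * M.size n k * (r * ‖a‖ ^ 2) := by field_simp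
  rw [g3] at e3
  calc _ ≤ C ^ 4 * M.p n * M.size n k / r +
        C ^ 5 * M.p n * M.size n k * (1 / (c * c) * (1 / r)) +
        C ^ 4 * M.p n * M.size n k * (1 / (c * c) * (1 / r)) := by
        linarith
    _ = _ := by field_simp

end DistModel

/-! ### Linearization of the aggregated estimator. -/

lemma mul_le_div_add_mul_sq {r : ℝ} (hr : 0 < r) (A x : ℝ) : A * x ≤ x ^ 2 / r + r * A ^ 2 := by
  have h : x ^ 2 / r + r * A ^ 2 - A * x = ((x - r * A) ^ 2 + x ^ 2 + (r * A) ^ 2) / (2 * r) := by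
    field_simp
    ring
  have h2 : 0 ≤ ((x - r * A) ^ 2 + x ^ 2 + (r * A) ^ 2) / (2 * r) := by positivity
  linarith

/-- Here `x`, `A`, `Q` are the score, Hessian and third-order norms, `g` and `α` the norms of `β -
β₀` and `a`, and `r = √n`, `q = √p`. The first term uses `α ≤ 1 / (c * r)`, the second the weighted
inequality between the means. In the third, one factor `g` is first replaced by `τ / q`, after which
`Q / q` plays the role of `A`. -/
lemma linearization_error_le {κ C D τ d c N r q p g α x A Q : ℝ} (hκ : 0 ≤ κ) (hC : 0 ≤ C)
    (hD : 0 ≤ D) (hτ : 0 ≤ τ) (hd : 0 ≤ d) (hc : 0 < c) (hN : 0 < N) (hr : 0 < r) (hq : 0 < q)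
    (hqp : q * q = p) (hg : 0 ≤ g) (hα : 0 ≤ α) (hx : 0 ≤ x) (hA : 0 ≤ A) (hQ : 0 ≤ Q)
    (hgx : g ≤ D * (x / N)) (hgτ : q * g ≤ τ) (hαr : c * r * α ≤ 1) :
    κ * (C * N * (g * g * α)) + d * (A * g) + d * C * (Q * (g * g)) ≤
      (κ * C * D ^ 2 / c + d * D + d * C * τ * D) *
        ((x ^ 2 / r + r * A ^ 2 + r / p * Q ^ 2) / N) := by
  have hQq : r / p * Q ^ 2 = r * (Q / q) ^ 2 := by rw [← hqp]; field_simp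
  rw [hQq]
  have hxN : 0 ≤ x / N := by positivity
  have n1 : 0 ≤ x ^ 2 / r := by positivity
  have n2 : 0 ≤ r * A ^ 2 := by positivity
  have n3 : 0 ≤ r * (Q / q) ^ 2 := by positivity
  set U := (x ^ 2 / r + r * A ^ 2 + r * (Q / q) ^ 2) / N with hU
  have t1 : N * (g * g * α) ≤ D ^ 2 / c * U := by
    have h1 : g * g ≤ (D * (x / N)) * (D * (x / N)) := mul_le_mul hgx hgx hg (hg.trans hgx)
    have h2 : α ≤ 1 / (c * r) := by
      rw [le_div_iff₀ (by positivity)]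
      linarith
    have h3 : x ^ 2 / r / N ≤ U := div_le_div_of_nonneg_right (by linarith) hN.le
    calc N * (g * g * α) ≤ N * ((D * (x / N)) * (D * (x / N)) * (1 / (c * r))) := by
          refine mul_le_mul_of_nonneg_left (mul_le_mul h1 h2 hα (by positivity)) hN.le
      _ = D ^ 2 / c * (x ^ 2 / r / N) := by field_simp
      _ ≤ D ^ 2 / c * U := mul_le_mul_of_nonneg_left h3 (by positivity)
  have t2 : A * g ≤ D * U := by
    have h1 := mul_le_div_add_mul_sq hr A x
    have h2 : A * x / N ≤ U := div_le_div_of_nonneg_right (by linarith) hN.le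
    calc A * g ≤ A * (D * (x / N)) := mul_le_mul_of_nonneg_left hgx hA
      _ = D * (A * x / N) := by ring
      _ ≤ D * U := mul_le_mul_of_nonneg_left h2 hD
  have t3 : Q * (g * g) ≤ τ * D * U := by
    have h1 := mul_le_div_add_mul_sq hr (Q / q) x
    have h2 : Q / q * x / N ≤ U := div_le_div_of_nonneg_right (by linarith) hN.le
    calc Q * (g * g) = Q / q * (q * g * g) := by field_simp
      _ ≤ Q / q * (τ * (D * (x / N))) :=
          mul_le_mul_of_nonneg_left (mul_le_mul hgτ hgx hg hτ) (by positivity)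
      _ = τ * D * (Q / q * x / N) := by ring
      _ ≤ τ * D * U := mul_le_mul_of_nonneg_left h2 (by positivity)
  have s1 := mul_le_mul_of_nonneg_left t1 (mul_nonneg hκ hC)
  have s2 := mul_le_mul_of_nonneg_left t2 hd
  have s3 := mul_le_mul_of_nonneg_left t3 (mul_nonneg hd hC)
  calc _ = κ * C * (N * (g * g * α)) + d * (A * g) + d * C * (Q * (g * g)) := by ring
    _ ≤ κ * C * (D ^ 2 / c * U) + d * (D * U) + d * C * (τ * D * U) := by linarith
    _ = _ := by ring

namespace DistModel

variable {G : GLM} {Ω : ℕ → Type*} [∀ n, MeasurableSpace (Ω n)] {P : ∀ n, Measure (Ω n)}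
  {M : DistModel G P} {n : ℕ} {c C D τ : ℝ}
  {βhat : ∀ n, Fin (M.K n) → Ω n → EuclideanSpace ℝ (Fin (M.p n))} {ω : Ω n}
  {a : EuclideanSpace ℝ (Fin (M.p n))}

/-- The local estimates at `ω` are maximizers of the likelihood that are close to the truth. -/
structure GoodAt (M : DistModel G P)
    (βhat : ∀ n, Fin (M.K n) → Ω n → EuclideanSpace ℝ (Fin (M.p n))) (n : ℕ) (ω : Ω n)
    (D τ : ℝ) : Prop where
  mem : ∀ k, βhat n k ω ∈ M.B n
  isMaxOn : ∀ k, IsMaxOn (M.localLogLik n k ω) (M.B n) (βhat n k ω)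
  norm_sub_le : ∀ k, ‖βhat n k ω - M.β₀ n‖ ≤ D * (M.scoreNorm n k ω / M.size n k)
  sqrt_mul_norm_sub_le : ∀ k, √(M.p n) * ‖βhat n k ω - M.β₀ n‖ ≤ τ

lemma sum_coef_mul_error (a : EuclideanSpace ℝ (Fin (M.p n))) (ω : Ω n) :
    ∑ i, M.coef n a i * M.error n i ω = ∑ k, G.disp⁻¹ * inner ℝ (∑ i ∈ M.obs n k,
      M.error n i ω • deriv G.u (inner ℝ (M.z n i) (M.β₀ n)) • M.z n i) a := by
  rw [← M.sum_obs]
  refine Finset.sum_congr rfl fun k _ => ?_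
  rw [ClientSetting.inner_sum_smul_smul, Finset.mul_sum]
  exact Finset.sum_congr rfl fun i _ => by rw [coef]; ring

lemma GoodAt.sqrt_C_mul_le (h : M.GoodAt βhat n ω D τ) (hτC : √C * τ ≤ c / (2 * C))
    (k : Fin (M.K n)) : √C * (√(M.p n) * ‖βhat n k ω - M.β₀ n‖) ≤ c / (2 * C) :=
  (mul_le_mul_of_nonneg_left (h.sqrt_mul_norm_sub_le k) (Real.sqrt_nonneg _)).trans hτC

lemma GoodAt.size_mul_norm_le (h : M.GoodAt βhat n ω D τ) (hM : M.RegularAt n c C)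
    (k : Fin (M.K n)) : M.size n k * ‖βhat n k ω - M.β₀ n‖ ≤ D * M.scoreNorm n k ω := by
  have hN : (0 : ℝ) < M.size n k := (hM.clientSetting k).card_pos'
  refine (mul_le_mul_of_nonneg_left (h.norm_sub_le k) hN.le).trans (le_of_eq ?_)
  field_simp

lemma toEuclideanLin_fisherSum_sub (h : (M.fisherSum βhat n ω).PosDef) :
    Matrix.toEuclideanLin (M.fisherSum βhat n ω) (M.aee βhat n ω - M.β₀ n) =
      ∑ k, Matrix.toEuclideanLin (M.localFisher n k (βhat n k ω)) (βhat n k ω - M.β₀ n) := by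
  rw [map_sub, toEuclideanLin_fisherSum_aee h, fisherSum, map_sum, LinearMap.sum_apply,
    ← Finset.sum_sub_distrib]
  exact Finset.sum_congr rfl fun k _ => (map_sub _ _ _).symm

/-- A crude rate: the estimating equation is paired with the error of the aggregated estimator. The
left side is of order at least `n` times its square, and each client contributes at most `C ^ 2 *
n_k` times the product of the two errors. -/
lemma GoodAt.mul_norm_aee_sub_le (h : M.GoodAt βhat n ω D τ) (hM : M.RegularAt n c C)
    (hw : ContDiff ℝ 1 G.w) (hτC : √C * τ ≤ c / (2 * C)) (k₀ : Fin (M.K n)) :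
    c * c / 2 * n * ‖M.aee βhat n ω - M.β₀ n‖ ≤ C ^ 2 * D * ∑ k, M.scoreNorm n k ω := by
  have hC := (hM.clientSetting k₀).C_pos
  have hpd := hM.posDef_fisherSum hw k₀ (h.mem k₀) (h.sqrt_C_mul_le hτC k₀)
  set b := M.aee βhat n ω - M.β₀ n with hb
  have h1 := hM.le_inner_fisherSum hw Finset.univ (fun k _ => h.mem k)
    (fun k _ => h.sqrt_C_mul_le hτC k) b
  rw [toEuclideanLin_fisherSum_sub hpd, inner_sum] at h1
  have h2 : ∑ k, (inner ℝ b (Matrix.toEuclideanLin (M.localFisher n k (βhat n k ω))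
      (βhat n k ω - M.β₀ n)) : ℝ) ≤ ∑ k, C ^ 2 * D * ‖b‖ * M.scoreNorm n k ω := by
    refine Finset.sum_le_sum fun k _ => ?_
    rw [inner_localFisher]
    refine (le_abs_self _).trans (((hM.clientSetting k).abs_sum_w_mul_le (h.mem k) _ _).trans ?_)
    have h3 := mul_le_mul_of_nonneg_left (h.size_mul_norm_le hM k)
      (show 0 ≤ C ^ 2 * ‖b‖ by positivity)
    refine le_trans (le_of_eq ?_) (h3.trans (le_of_eq (by ring)))
    rw [size]
    ring
  have h3 : ∑ k, c / 2 * (c * M.size n k * ‖b‖ ^ 2) = c * c / 2 * n * ‖b‖ ^ 2 := by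
    have : (n : ℝ) = ∑ k, (M.size n k : ℝ) := by exact_mod_cast (M.sum_size n).symm
    rw [this, Finset.mul_sum, Finset.sum_mul]
    exact Finset.sum_congr rfl fun k _ => by ring
  rw [h3] at h1
  have h4 := h1.trans h2
  rw [← Finset.mul_sum] at h4
  rcases (norm_nonneg b).eq_or_lt with h0 | h0
  · rw [← h0, mul_zero]
    have hD : 0 ≤ D * ∑ k, M.scoreNorm n k ω := by
      rw [Finset.mul_sum]
      exact Finset.sum_nonneg fun k _ => le_trans (by positivity) (h.size_mul_norm_le hM k)
    rw [mul_assoc]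
    positivity
  · refine le_of_mul_le_mul_right ?_ h0
    refine le_trans (le_of_eq (by ring)) (h4.trans (le_of_eq (by ring)))

/-- Cauchy–Schwarz gives a factor `K`, and `K * n_k ≤ C * n` by balance. -/
lemma RegularAt.sq_sum_le (hM : M.RegularAt n c C) (x : Fin (M.K n) → ℝ) :
    (∑ k, x k) ^ 2 ≤ n * C * ∑ k, x k ^ 2 / M.size n k := by
  have h1 := sq_sum_le_card_mul_sum_sq (s := Finset.univ) (f := x)
  rw [Finset.card_univ, Fintype.card_fin] at h1
  refine h1.trans ?_
  rw [Finset.mul_sum, Finset.mul_sum]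
  refine Finset.sum_le_sum fun k _ => ?_
  have hN : (0 : ℝ) < M.size n k := (hM.clientSetting k).card_pos'
  have h2 : M.K n * (M.size n k : ℝ) ≤ C * n := by
    have : (n : ℝ) = ∑ k, (M.size n k : ℝ) := by exact_mod_cast (M.sum_size n).symm
    rw [this, Finset.mul_sum]
    refine le_trans (le_of_eq ?_) (Finset.sum_le_sum fun l _ => hM.balanced k l)
    simp
  rw [mul_div_assoc', le_div_iff₀ hN]
  have := mul_le_mul_of_nonneg_right h2 (sq_nonneg (x k))
  linarith

lemma le_of_mul_norm_sq_le (hc : 0 < c) (ha : c * c * n * ‖a‖ ^ 2 ≤ 1) : c * √n * ‖a‖ ≤ 1 := by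
  refine (sq_le_one_iff₀ (by positivity)).1 ?_
  rw [mul_pow, mul_pow, Real.sq_sqrt (Nat.cast_nonneg n)]
  linarith

variable [∀ n, IsProbabilityMeasure (P n)]

lemma GoodAt.abs_inner_localFisher_sub_le (h : M.GoodAt βhat n ω D τ) (hM : M.RegularAt n c C)
    (hu : ContDiff ℝ 3 G.u) (hw : ContDiff ℝ 1 G.w) (hτC : √C * τ ≤ c / (2 * C)) (hτc : τ < c)
    (hD : 0 ≤ D) (hn : 0 < n) (ha : c * c * n * ‖a‖ ^ 2 ≤ 1) (k : Fin (M.K n)) :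
    |inner ℝ a (Matrix.toEuclideanLin (M.localFisher n k (βhat n k ω)) (βhat n k ω - M.β₀ n)) -
      G.disp⁻¹ * inner ℝ (∑ i ∈ M.obs n k,
        M.error n i ω • deriv G.u (inner ℝ (M.z n i) (M.β₀ n)) • M.z n i) a| ≤
      (((C + C * (C / (c * G.disp / (2 * C)))) + G.disp⁻¹ * C * (1 + C)) * C * D ^ 2 / c +
        G.disp⁻¹ * D + G.disp⁻¹ * C * τ * D) *
      ((M.scoreNorm n k ω ^ 2 / √n + √n * M.hessianNorm n a k ω ^ 2 +
        √n / M.p n * M.thirdOrderNorm n a k ω ^ 2) / M.size n k) := by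
  have hS := hM.clientSetting k
  have hC := hS.C_pos
  have hc := hS.c_pos
  have hd := G.disp_pos
  have hmax := h.isMaxOn k
  rw [M.localLogLik_eq] at hmax
  have hscore := hS.score_eq_zero hu hmax ((h.sqrt_mul_norm_sub_le k).trans_lt hτc) a
  have habs : ∀ i, ∫ ω', |M.error n i ω'| ∂(P n) ≤ 1 + C := by
    intro i
    have h1 : ∫ ω', |M.error n i ω'| ∂(P n) ≤ ∫ ω', (1 + M.error n i ω' ^ 2) ∂(P n) := by
      refine integral_mono ((M.memLp_error n i).integrable (by norm_num)).abs
        ((integrable_const _).add (M.memLp_error n i).integrable_sq) fun ω' => ?_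
      simp only
      rw [← sq_abs]
      nlinarith [sq_nonneg (|M.error n i ω'| - 1), abs_nonneg (M.error n i ω')]
    rw [integral_add (integrable_const _) (M.memLp_error n i).integrable_sq] at h1
    simp at h1
    linarith [hM.noise.integral_sq_le i]
  -- Each `|error|` is split into its mean, at most `1 + C` because `|x| ≤ 1 + x ^ 2`, and a
  -- centered fluctuation, whose sum is `thirdOrderNorm`.
  have hlin := hS.abs_linearization_le hu hw (h.mem k) (m := 1 + C) (by linarith) a hscore
    (h.sqrt_C_mul_le hτC k) (ξ := fun i => |M.error n i ω| - ∫ ω', |M.error n i ω'| ∂(P n))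
    (fun i _ => by linarith [habs i])
  have hτ : 0 ≤ τ := le_trans (by positivity) (h.sqrt_mul_norm_sub_le k)
  have hfin := linearization_error_le
    (κ := (C + C * (C / (c * G.disp / (2 * C)))) + G.disp⁻¹ * C * (1 + C))
    (by positivity) hC.le hD hτ (inv_nonneg.2 hd.le) hc hS.card_pos'
    (Real.sqrt_pos.2 (Nat.cast_pos.2 hn)) hS.sqrt_p_pos
    (Real.mul_self_sqrt (Nat.cast_nonneg _)) (norm_nonneg (βhat n k ω - M.β₀ n)) (norm_nonneg a)
    (norm_nonneg _) (norm_nonneg _) (norm_nonneg _) (h.norm_sub_le k)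
    (h.sqrt_mul_norm_sub_le k) (le_of_mul_norm_sq_le hc ha)
    (A := M.hessianNorm n a k ω) (Q := M.thirdOrderNorm n a k ω)
  refine le_trans (le_of_eq ?_) (hlin.trans hfin)
  rw [inner_localFisher]
  congr 2
  exact Finset.sum_congr rfl fun i _ => by ring

/-- The linearization of the estimator. -/
theorem GoodAt.abs_inner_fisher_sub_le (h : M.GoodAt βhat n ω D τ) (hM : M.RegularAt n c C)
    (hu : ContDiff ℝ 3 G.u) (hw : ContDiff ℝ 1 G.w) (hτC : √C * τ ≤ c / (2 * C)) (hτc : τ < c)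
    (hD : 0 ≤ D) (hn : 0 < n) (ha : c * c * n * ‖a‖ ^ 2 ≤ 1) :
    |inner ℝ a (Matrix.toEuclideanLin (M.fisher n (M.β₀ n)) (M.aee βhat n ω - M.β₀ n)) -
      ∑ i, M.coef n a i * M.error n i ω| ≤
      ((((C + C * (C / (c * G.disp / (2 * C)))) + G.disp⁻¹ * C * (1 + C)) * C * D ^ 2 / c +
        G.disp⁻¹ * D + G.disp⁻¹ * C * τ * D) + 2 * C ^ 5 * D ^ 2 / c ^ 3) *
        M.remainder n a ω := by
  set k₀ := M.client n ⟨0, hn⟩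
  have hC := (hM.clientSetting k₀).C_pos
  have hc := (hM.clientSetting k₀).c_pos
  have hnR : (0 : ℝ) < n := Nat.cast_pos.2 hn
  have hpd := hM.posDef_fisherSum hw k₀ (h.mem k₀) (h.sqrt_C_mul_le hτC k₀)
  have hbb := h.mul_norm_aee_sub_le hM hw hτC k₀
  have heq := toEuclideanLin_fisherSum_sub hpd
  set b := M.aee βhat n ω - M.β₀ n with hb
  set κ := ((C + C * (C / (c * G.disp / (2 * C)))) + G.disp⁻¹ * C * (1 + C)) * C * D ^ 2 / c +
        G.disp⁻¹ * D + G.disp⁻¹ * C * τ * D with hκ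
  set σ := ∑ k, M.scoreNorm n k ω with hσ
  have hσ0 : 0 ≤ σ := Finset.sum_nonneg fun k _ => norm_nonneg _
  -- The estimating equation involves the information at the local estimates, the claim that at the
  -- truth. The first sum collects the local linearization errors, the second the change of
  -- information applied to the crude error `b`.
  have e1 : inner ℝ a (Matrix.toEuclideanLin (M.fisher n (M.β₀ n)) b) -
      ∑ i, M.coef n a i * M.error n i ω =
      (∑ k, (inner ℝ a (Matrix.toEuclideanLin (M.localFisher n k (βhat n k ω))
        (βhat n k ω - M.β₀ n)) - G.disp⁻¹ * inner ℝ (∑ i ∈ M.obs n k,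
          M.error n i ω • deriv G.u (inner ℝ (M.z n i) (M.β₀ n)) • M.z n i) a)) -
      ∑ k, ∑ i ∈ M.obs n k, (G.w (inner ℝ (M.z n i) (βhat n k ω)) -
        G.w (inner ℝ (M.z n i) (M.β₀ n))) * inner ℝ (M.z n i) a * inner ℝ (M.z n i) b := by
    rw [sum_coef_mul_error, Finset.sum_sub_distrib, ← inner_sum, ← heq, inner_fisherSum,
      inner_fisher, ← M.sum_obs]
    simp only [sub_mul, Finset.sum_sub_distrib]
    ring
  have b1 : |∑ k, (inner ℝ a (Matrix.toEuclideanLin (M.localFisher n k (βhat n k ω))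
        (βhat n k ω - M.β₀ n)) - G.disp⁻¹ * inner ℝ (∑ i ∈ M.obs n k,
          M.error n i ω • deriv G.u (inner ℝ (M.z n i) (M.β₀ n)) • M.z n i) a)| ≤
      κ * M.remainder n a ω := by
    rw [remainder, Finset.mul_sum]
    exact (Finset.abs_sum_le_sum_abs _ _).trans (Finset.sum_le_sum fun k _ =>
      h.abs_inner_localFisher_sub_le hM hu hw hτC hτc hD hn ha k)
  have b2 : |∑ k, ∑ i ∈ M.obs n k, (G.w (inner ℝ (M.z n i) (βhat n k ω)) -
        G.w (inner ℝ (M.z n i) (M.β₀ n))) * inner ℝ (M.z n i) a * inner ℝ (M.z n i) b| ≤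
      C ^ 2 * D * σ * (‖a‖ * ‖b‖) := by
    refine (Finset.abs_sum_le_sum_abs _ _).trans ?_
    rw [hσ, Finset.mul_sum, Finset.sum_mul]
    refine Finset.sum_le_sum fun k _ => ?_
    refine ((hM.clientSetting k).abs_sum_w_sub_le hw (h.mem k) a b).trans ?_
    have h3 := mul_le_mul_of_nonneg_left (h.size_mul_norm_le hM k)
      (show 0 ≤ C ^ 2 * (‖a‖ * ‖b‖) by positivity)
    refine le_trans (le_of_eq ?_) (h3.trans (le_of_eq (by ring)))
    rw [size]
    ring
  have hr : 0 < √(n : ℝ) := Real.sqrt_pos.2 hnR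
  have b3 : C ^ 2 * D * σ * (‖a‖ * ‖b‖) ≤ 2 * C ^ 5 * D ^ 2 / c ^ 3 * M.remainder n a ω := by
    have h1 := le_of_mul_norm_sq_le hc ha
    have h2 : ‖a‖ ≤ 1 / (c * √n) := by
      rw [le_div_iff₀ (by positivity)]
      linarith
    have h3 : ‖b‖ ≤ C ^ 2 * D * σ / (c * c / 2 * n) := by
      rw [le_div_iff₀ (by positivity)]
      linarith
    have h4 := hM.sq_sum_le fun k => M.scoreNorm n k ω
    rw [← hσ] at h4
    have h5 : (1 / √n) * ∑ k, M.scoreNorm n k ω ^ 2 / M.size n k ≤ M.remainder n a ω := by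
      rw [remainder, Finset.mul_sum]
      refine Finset.sum_le_sum fun k _ => ?_
      rw [mul_div_assoc', one_div_mul_eq_div]
      refine div_le_div_of_nonneg_right ?_ (Nat.cast_nonneg _)
      have : 0 ≤ √n * M.hessianNorm n a k ω ^ 2 + √n / M.p n * M.thirdOrderNorm n a k ω ^ 2 := by
        positivity
      linarith
    calc C ^ 2 * D * σ * (‖a‖ * ‖b‖)
        ≤ C ^ 2 * D * σ * (1 / (c * √n) * (C ^ 2 * D * σ / (c * c / 2 * n))) := by gcongr
      _ = 2 * C ^ 4 * D ^ 2 / c ^ 3 * (1 / (√n * n)) * σ ^ 2 := by field_simp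
      _ ≤ 2 * C ^ 4 * D ^ 2 / c ^ 3 * (1 / (√n * n)) *
          (n * C * ∑ k, M.scoreNorm n k ω ^ 2 / M.size n k) :=
          mul_le_mul_of_nonneg_left h4 (by positivity)
      _ = 2 * C ^ 5 * D ^ 2 / c ^ 3 *
          ((1 / √n) * ∑ k, M.scoreNorm n k ω ^ 2 / M.size n k) := by
          generalize ∑ k, M.scoreNorm n k ω ^ 2 / M.size n k = y
          field_simp
      _ ≤ _ := mul_le_mul_of_nonneg_left h5 (by positivity)
  rw [e1, add_mul]
  exact (abs_sub _ _).trans (add_le_add b1 (b2.trans b3))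

end DistModel

/-! ### Measurability of the aggregated estimator. -/

section Measurability

variable {Ω m : Type*} [MeasurableSpace Ω] [Fintype m] [DecidableEq m]

lemma measurable_toEuclideanLin_apply {A : Ω → Matrix m m ℝ} {v : Ω → EuclideanSpace ℝ m}
    (hA : ∀ i j, Measurable fun ω => A ω i j) (hv : Measurable v) :
    Measurable fun ω => Matrix.toEuclideanLin (A ω) (v ω) := by
  refine (WithLp.measurable_toLp 2 _).comp (measurable_pi_iff.2 fun i => ?_)
  have hv' : ∀ j, Measurable fun ω => (v ω).ofLp j := fun j =>
    (measurable_pi_apply j).comp ((WithLp.measurable_ofLp 2 _).comp hv)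
  exact Finset.measurable_fun_sum _ fun j _ => (hA i j).mul (hv' j)

lemma measurable_matrix_inv {A : Ω → Matrix m m ℝ} (hA : ∀ i j, Measurable fun ω => A ω i j)
    (i j : m) : Measurable fun ω => (A ω)⁻¹ i j := by
  have hm : Measurable fun ω => (fun i j => A ω i j : m → m → ℝ) :=
    measurable_pi_iff.2 fun i => measurable_pi_iff.2 fun j => hA i j
  have hdet : Continuous fun B : m → m → ℝ => (Matrix.of B).det := Continuous.matrix_det continuous_id
  have hadj : Continuous fun B : m → m → ℝ => (Matrix.of B).adjugate i j :=
    (Continuous.matrix_adjugate continuous_id).matrix_elem i j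
  have h := (hdet.measurable.comp hm).inv.mul (hadj.measurable.comp hm)
  convert h using 1
  funext ω
  simp only [Matrix.inv_def, Ring.inverse_eq_inv', Matrix.smul_apply, smul_eq_mul]
  rfl

end Measurability

/-! ### The limit distribution of the aggregated estimator. -/

namespace DistModel

variable {G : GLM} {Ω : ℕ → Type*} [∀ n, MeasurableSpace (Ω n)] {P : ∀ n, Measure (Ω n)}
  {M : DistModel G P} {c C D τ : ℝ}
  {βhat : ∀ n, Fin (M.K n) → Ω n → EuclideanSpace ℝ (Fin (M.p n))}

lemma IsLocalMLE.measurable_localFisher (hβ : M.IsLocalMLE βhat) (hw : ContDiff ℝ 1 G.w) (n : ℕ)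
    (k : Fin (M.K n)) (i j : Fin (M.p n)) :
    Measurable fun ω => M.localFisher n k (βhat n k ω) i j := by
  have hw' := hw.continuous.measurable
  have hβ' := (hβ n k).1
  simp only [localFisher, Matrix.sum_apply, Matrix.smul_apply, smul_eq_mul]
  refine Finset.measurable_fun_sum _ fun l _ => Measurable.mul_const ?_ _
  exact hw'.comp (measurable_const.inner hβ')

lemma IsLocalMLE.measurable_aee (hβ : M.IsLocalMLE βhat) (hw : ContDiff ℝ 1 G.w) (n : ℕ) :
    Measurable (M.aee βhat n) := by
  have hF : ∀ i j, Measurable fun ω => M.fisherSum βhat n ω i j := by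
    intro i j
    simp only [fisherSum, Matrix.sum_apply]
    exact Finset.measurable_fun_sum _ fun k _ => hβ.measurable_localFisher hw n k i j
  unfold aee
  refine Finset.measurable_fun_sum _ fun k _ =>
    measurable_toEuclideanLin_apply (fun i j => ?_) (hβ n k).1
  simp only [Matrix.mul_apply]
  exact Finset.measurable_fun_sum _ fun l _ =>
    (measurable_matrix_inv hF i l).mul (hβ.measurable_localFisher hw n k l j)

lemma RegularAt.posDef_fisher {n : ℕ} (hM : M.RegularAt n c C) (hc : 0 < c) (hn : 0 < n) :
    (M.fisher n (M.β₀ n)).PosDef := by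
  refine posDef_of_inner_pos (isHermitian_fisher _) fun a ha => ?_
  refine lt_of_lt_of_le ?_ (hM.le_inner_fisher a)
  have h1 := norm_pos_iff.2 ha
  have h2 : (0 : ℝ) < n := Nat.cast_pos.2 hn
  have h3 : 0 < c * n * ‖a‖ ^ 2 := by positivity
  exact mul_pos hc (h3.trans_le (hM.mul_norm_sq_le a))

lemma remainder_nonneg (M : DistModel G P) (n : ℕ) (a : EuclideanSpace ℝ (Fin (M.p n)))
    (ω : Ω n) : 0 ≤ M.remainder n a ω :=
  Finset.sum_nonneg fun k _ => by positivity

variable [∀ n, IsProbabilityMeasure (P n)]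

/-- Outside an event of probability `O(K² p² / n)`, all local estimates are close to the truth. -/
theorem exists_forall_goodAt (M : DistModel G P) (hu : ContDiff ℝ 3 G.u) (hw : ContDiff ℝ 1 G.w)
    (hc : 0 < c) (hC : 0 < C) :
    ∃ D > 0, ∀ τ > 0, ∃ D' ≥ 0, ∀ n, 0 < n → M.RegularAt n c C → ∀ βhat, M.IsLocalMLE βhat →
      ∃ bad : Set (Ω n), (P n).real bad ≤ D' * (M.K n * (M.p n / √n)) ^ 2 ∧
        ∀ ω ∉ bad, M.GoodAt βhat n ω D τ := by
  obtain ⟨D, hD, hbad⟩ := exists_bad_event G hu hw hc hC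
  refine ⟨D, hD, fun τ hτ => ?_⟩
  obtain ⟨D', hD', hbad⟩ := hbad τ hτ
  refine ⟨D' * C, by positivity, fun n hn hM βhat hβ => ?_⟩
  choose bad hPbad hbad using fun k => hbad (P n) (hM.clientSetting k) hM.noise
  refine ⟨⋃ k, bad k, ?_, fun ω hω => ?_⟩
  · refine (measureReal_iUnion_fintype_le bad).trans ((Finset.sum_le_card_nsmul _ _
      (D' * ((M.p n : ℝ) ^ 2 * (M.K n * C) / n)) fun k _ => (hPbad k).trans ?_).trans
      (le_of_eq ?_))
    · refine mul_le_mul_of_nonneg_left ?_ hD'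
      rw [div_le_div_iff₀ (hM.clientSetting k).card_pos' (Nat.cast_pos.2 hn), mul_assoc]
      exact mul_le_mul_of_nonneg_left (hM.le_mul_size k) (sq_nonneg _)
    · rw [mul_pow, div_pow, Real.sq_sqrt (Nat.cast_nonneg n)]
      simp only [Finset.card_univ, Fintype.card_fin, nsmul_eq_mul]
      ring
  · have h : ∀ k, ω ∉ bad k := fun k hk => hω (Set.mem_iUnion.2 ⟨k, hk⟩)
    have h' := fun k => hbad k ω (h k) _ ((hβ n k).2 ω).1
      (M.localLogLik_eq n k ω ▸ ((hβ n k).2 ω).2)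
    exact ⟨fun k => ((hβ n k).2 ω).1, fun k => ((hβ n k).2 ω).2, fun k => (h' k).1,
      fun k => (h' k).2⟩

/-- The distance to the leading term exceeds `ε` only on the bad event, of probability `O((K
p/√n)²)`, or where the remainder is large. By Markov's inequality the latter has probability `O(K
p/√n)`. -/
theorem tendstoInDistribution_aee (hM : M.Regular)
    (hp : (fun n => (M.p n : ℝ)) =o[atTop] fun n : ℕ => √(n : ℝ))
    (hK : (fun n => (M.K n : ℝ)) =o[atTop] fun n : ℕ => √(n : ℝ) / (M.p n : ℝ))
    (hβ : M.IsLocalMLE βhat) (α : ∀ n, EuclideanSpace ℝ (Fin (M.p n)))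
    (hα : ∀ᶠ n in atTop, ‖α n‖ = 1) :
    TendstoInDistribution
      (fun n ω => inner ℝ (α n)
        (Matrix.toEuclideanLin (CFC.sqrt (M.fisher n (M.β₀ n))) (M.aee βhat n ω - M.β₀ n)))
      atTop (id : ℝ → ℝ) P (gaussianReal 0 1) := by
  have hu := hM.u_smooth
  have hw := hM.w_smooth
  obtain ⟨c, C, hc, hC, hreg⟩ := hM.exists_regularAt
  obtain ⟨D, hD, hgood⟩ := M.exists_forall_goodAt hu hw hc hC
  -- The first bound keeps local estimates in the interior of the parameter set, where the score
  -- equation holds; the second keeps linear predictors in the range where `w` is at least `c / 2`.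
  set τ := min (c / 2) (c / (2 * C) / √C) with hτ
  have hτpos : 0 < τ := lt_min (by positivity) (by positivity)
  have hτc : τ < c := (min_le_left _ _).trans_lt (by linarith)
  have hτC : √C * τ ≤ c / (2 * C) := by
    have := min_le_right (c / 2) (c / (2 * C) / √C)
    rw [le_div_iff₀ (Real.sqrt_pos.2 hC)] at this
    rwa [mul_comm]
  obtain ⟨D', hD', hgood⟩ := hgood τ hτpos
  have hppos := M.eventually_p_pos (f := fun n => √(n : ℝ)) one_ne_zero (by simpa using hK)
  have hreg : ∀ᶠ n in atTop, M.RegularAt n c C := by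
    filter_upwards [hreg, hppos] with n h1 h2 using h1 h2
  -- the direction of the leading term
  have ha : ∀ n, ∃ a : EuclideanSpace ℝ (Fin (M.p n)), 0 < n → M.RegularAt n c C →
      (inner ℝ a (Matrix.toEuclideanLin (M.fisher n (M.β₀ n)) a) : ℝ) = ‖α n‖ ^ 2 ∧
      ∀ b : EuclideanSpace ℝ (Fin (M.p n)),
        (inner ℝ (α n) (Matrix.toEuclideanLin (CFC.sqrt (M.fisher n (M.β₀ n))) b) : ℝ) =
          inner ℝ a (Matrix.toEuclideanLin (M.fisher n (M.β₀ n)) b) := by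
    intro n
    by_cases h : 0 < n ∧ M.RegularAt n c C
    · obtain ⟨a, ha⟩ := exists_inner_eq_inner_sqrt (h.2.posDef_fisher hc h.1) (α n)
      exact ⟨a, fun _ _ => ha⟩
    · exact ⟨0, fun h1 h2 => absurd ⟨h1, h2⟩ h⟩
  choose a ha using ha
  have ha1 : ∀ᶠ n in atTop, (inner ℝ (a n)
      (Matrix.toEuclideanLin (M.fisher n (M.β₀ n)) (a n)) : ℝ) = 1 := by
    filter_upwards [hreg, eventually_gt_atTop 0, hα] with n h1 h2 h3
    rw [(ha n h2 h1).1, h3, one_pow]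
  have hpn : Tendsto (fun n => (M.p n : ℝ) / n) atTop (𝓝 0) := by
    refine squeeze_zero' (Eventually.of_forall fun n => by positivity) ?_
      hp.tendsto_div_nhds_zero
    filter_upwards [eventually_gt_atTop 0] with n hn
    have h1 : (1 : ℝ) ≤ n := by exact_mod_cast hn
    refine div_le_div_of_nonneg_left (Nat.cast_nonneg _) (Real.sqrt_pos.2 (by linarith)) ?_
    exact Real.sqrt_le_iff.2 ⟨by linarith, by nlinarith⟩
  have hKp : Tendsto (fun n => (M.K n : ℝ) * (M.p n / √n)) atTop (𝓝 0) := by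
    refine hK.tendsto_div_nhds_zero.congr fun n => ?_
    rw [div_div_eq_mul_div, mul_div_assoc]
  refine tendstoInDistribution_gaussian_of_charFun
    (fun n => Finset.measurable_fun_sum _ fun i _ => (M.measurable_error n i).const_mul _)
    (fun n => measurable_const.inner ((LinearMap.continuous_of_finiteDimensional _).measurable.comp
      ((hβ.measurable_aee hw n).sub_const _)))
    (tendsto_charFun_sum_coef_mul_error hu hc hreg hpn a ha1) fun ε hε => ?_
  set κ := ((((C + C * (C / (c * G.disp / (2 * C)))) + G.disp⁻¹ * C * (1 + C)) * C * D ^ 2 / c +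
    G.disp⁻¹ * D + G.disp⁻¹ * C * τ * D) + 2 * C ^ 5 * D ^ 2 / c ^ 3) with hκ
  set δ := ε / (|κ| + 1) with hδ
  have hδpos : 0 < δ := by positivity
  set κ' := C ^ 4 + C ^ 5 / (c * c) + C ^ 4 / (c * c) with hκ'
  have hlim : Tendsto (fun n => D' * ((M.K n : ℝ) * (M.p n / √n)) ^ 2 +
      κ' / δ * (M.K n * (M.p n / √n))) atTop (𝓝 0) := by
    simpa using ((hKp.pow 2).const_mul D').add (hKp.const_mul (κ' / δ))
  refine squeeze_zero' (Eventually.of_forall fun n => measureReal_nonneg) ?_ hlim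
  filter_upwards [hreg, eventually_gt_atTop 0, ha1] with n hreg hn ha1
  have hnR : (0 : ℝ) < n := Nat.cast_pos.2 hn
  obtain ⟨bad, hPbad, hbad⟩ := hgood n hn hreg βhat hβ
  have han : c * c * n * ‖a n‖ ^ 2 ≤ 1 := by
    have := (mul_le_mul_of_nonneg_left (hreg.mul_norm_sq_le (a n)) hc.le).trans
      ((hreg.le_inner_fisher (a n)).trans ha1.le)
    linarith
  obtain ⟨hRint, hR⟩ := hreg.integral_remainder_le hc hn han
  have hsub : {ω | ε < |inner ℝ (α n) (Matrix.toEuclideanLin (CFC.sqrt (M.fisher n (M.β₀ n)))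
      (M.aee βhat n ω - M.β₀ n)) - ∑ i, M.coef n (a n) i * M.error n i ω|} ⊆
      bad ∪ {ω | δ ≤ M.remainder n (a n) ω} := by
    intro ω hω
    by_cases hωb : ω ∈ bad
    · exact Or.inl hωb
    refine Or.inr ?_
    have h1 := (hbad ω hωb).abs_inner_fisher_sub_le hreg hu hw hτC hτc hD.le hn han
    rw [← (ha n hn hreg).2, ← hκ] at h1
    have h2 : ε < κ * M.remainder n (a n) ω := lt_of_lt_of_le hω h1
    show δ ≤ M.remainder n (a n) ω
    rw [hδ, div_le_iff₀ (by positivity)]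
    have h3 := M.remainder_nonneg n (a n) ω
    have h4 := mul_le_mul_of_nonneg_right ((le_abs_self κ).trans (lt_add_one _).le) h3
    linarith
  refine (measureReal_mono hsub).trans ((measureReal_union_le _ _).trans (add_le_add hPbad ?_))
  have hmark := mul_meas_ge_le_integral_of_nonneg (ae_of_all _ (M.remainder_nonneg n (a n))) hRint δ
  rw [div_mul_eq_mul_div, le_div_iff₀ hδpos, mul_comm]
  exact hmark.trans hR

end DistModel

theorem theorem3 {Ω : ℕ → Type*} [∀ n, MeasurableSpace (Ω n)] (P : ∀ n, Measure (Ω n))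
    [∀ n, IsProbabilityMeasure (P n)] (G : GLM) (M : DistModel G P) (hM : M.Regular) :
    ((fun n => (M.p n : ℝ)) =o[atTop] (fun n : ℕ => (n : ℝ)) →
      (fun n => (M.K n : ℝ)) =o[atTop] (fun n : ℕ => (n : ℝ) / (M.p n : ℝ) ^ 2) →
      (∃ βhat : ∀ n, Fin (M.K n) → Ω n → EuclideanSpace ℝ (Fin (M.p n)), M.IsLocalMLE βhat) ∧
      ∀ βhat : ∀ n, Fin (M.K n) → Ω n → EuclideanSpace ℝ (Fin (M.p n)), M.IsLocalMLE βhat →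
        Tendsto (fun n => P n {ω | (M.fisherSum βhat n ω).PosDef ∧
          Matrix.toEuclideanLin (M.fisherSum βhat n ω) (M.aee βhat n ω) =
            ∑ k, Matrix.toEuclideanLin (M.localFisher n k (βhat n k ω)) (βhat n k ω)})
          atTop (𝓝 1)) ∧
    ((fun n => (M.p n : ℝ)) =o[atTop] (fun n : ℕ => √(n : ℝ)) →
      (fun n => (M.K n : ℝ)) =o[atTop] (fun n : ℕ => √(n : ℝ) / (M.p n : ℝ)) →
      ∀ βhat : ∀ n, Fin (M.K n) → Ω n → EuclideanSpace ℝ (Fin (M.p n)), M.IsLocalMLE βhat →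
      ∀ α : ∀ n, EuclideanSpace ℝ (Fin (M.p n)), (∀ᶠ n in atTop, ‖α n‖ = 1) →
        TendstoInDistribution
          (fun n ω => inner ℝ (α n)
            (Matrix.toEuclideanLin (CFC.sqrt (M.fisher n (M.β₀ n))) (M.aee βhat n ω - M.β₀ n)))
          atTop (id : ℝ → ℝ) P (gaussianReal 0 1)) := by
  refine ⟨fun _ hK => ⟨M.exists_isLocalMLE hM.u_smooth, fun βhat hβ => ?_⟩,
    fun hp hK βhat hβ α hα => DistModel.tendstoInDistribution_aee hM hp hK hβ α hα⟩
  refine (DistModel.tendsto_posDef_fisherSum hM hK hβ).congr fun n => congrArg (P n) ?_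
  ext ω
  exact ⟨fun h => ⟨h, DistModel.toEuclideanLin_fisherSum_aee h⟩, fun h => h.1⟩
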